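/- All graphs are undirected and simple, of arbitrary (possibly infinite) size. For a graph $G=(V,E)$ and a module $M$ over a commutative ring $R$, let $H_q^{VR}(G;M)$, $q\in\mathbb{Z}$, be the Vietoris–Rips homology of $G$ with coefficients in $M$: the homology of the clique complex of $G$, computed by the simplicial set whose $n$-simplices are the tuples $(x_0,\dots,x_n)\in V^{n+1}$ with $x_i=x_j$ or $\{x_i,x_j\}\in E$ for all $i,j$ (faces omit and degeneracies repeat an entry), with differential $\sum_i(-1)^i\partial_i$ on chains with coefficients in $M$; it is zero for $q<0$. A map of graphs is a map of vertex sets sending adjacent vertices to adjacent or equal vertices. The strong product $G\boxtimes G'$ has vertex set $V\times V'$, and $(v_0,v_0')$, $(v_1,v_1')$ are adjacent iff one of the following holds: (1) $\{v_0,v_1\}\in E$ and $\{v_0',v_1'\}\in E'$; (2) $v_0=v_1$ and $\{v_0',v_1'\}\in E'$; (3) $\{v_0,v_1\}\in E$ and $v_0'=v_1'$. **Theorem.** Let $R$ be a principal ideal domain. For every $q\in\mathbb{Z}$, and for all graphs $G,G'$ and all $R$-modules $M,M'$ with $\operatorname{Tor}_1^R(M,M')=0$, there is a short exact sequence of $R$-modules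 $$0\to\bigoplus_{i+j=q}H_i^{VR}(G;M)\otimes_R H_j^{VR}(G';M')\to H_q^{VR}(G\boxtimes G';M\otimes_R M')\to\bigoplus_{i+j=q-1}\operatorname{Tor}_1^R\bigl(H_i^{VR}(G;M),H_j^{VR}(G';M')\bigr)\to 0,$$ and these sequences can be chosen natural with respect to maps of graphs in $G$ and $G'$ and $R$-linear maps in $M$ and $M'$ (between pairs of modules with vanishing $\operatorname{Tor}_1$). -/

import Mathlib

open CategoryTheory CategoryTheory.Limits CategoryTheory.MonoidalCategory

universe u

noncomputable section

namespace VietorisRips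

/-- An undirected graph (of arbitrary size): a vertex set together with a symmetric
irreflexive adjacency relation. -/
structure Graph : Type (u + 1) where
  V : Type u
  graph : SimpleGraph V

namespace Graph

/-- `G.Rel v w` says that `(v, w)` lies in `E ∪ Δ`, the edge relation together with
the diagonal. -/
def Rel (G : Graph.{u}) (v w : G.V) : Prop := v = w ∨ G.graph.Adj v w

/-- A map of graphs: a map on vertices which sends `E ∪ Δ` into `E' ∪ Δ'`, i.e. adjacent
vertices go to adjacent or equal vertices. Equivalently, a simplicial map of the clique
complexes. -/
@[ext]
structure Hom (G H : Graph.{u}) where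
  toFun : G.V → H.V
  map_rel : ∀ v w, G.Rel v w → H.Rel (toFun v) (toFun w)

instance : Category Graph.{u} where
  Hom := Hom
  id _ := ⟨fun v => v, fun _ _ h => h⟩
  comp f g := ⟨fun v => g.toFun (f.toFun v), fun _ _ h => g.map_rel _ _ (f.map_rel _ _ h)⟩

/-- The strong product `G ⊠ G'`. -/
def strongProd (G G' : Graph.{u}) : Graph.{u} where
  V := G.V × G'.V
  graph :=
    { Adj := fun x y =>
        (G.graph.Adj x.1 y.1 ∧ G'.graph.Adj x.2 y.2) ∨
        (x.1 = y.1 ∧ G'.graph.Adj x.2 y.2) ∨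
        (G.graph.Adj x.1 y.1 ∧ x.2 = y.2)
      symm := ⟨fun _ _ h => by
        rcases h with ⟨h, h'⟩ | ⟨h, h'⟩ | ⟨h, h'⟩
        · exact Or.inl ⟨h.symm, h'.symm⟩
        · exact Or.inr (Or.inl ⟨h.symm, h'.symm⟩)
        · exact Or.inr (Or.inr ⟨h.symm, h'.symm⟩)⟩
      loopless := ⟨fun x h => by
        rcases h with ⟨h, _⟩ | ⟨_, h⟩ | ⟨h, _⟩
        · exact G.graph.loopless.irrefl _ h
        · exact G'.graph.loopless.irrefl _ h
        · exact G.graph.loopless.irrefl _ h⟩ }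

lemma strongProd_rel (G G' : Graph.{u}) (x y : (G.strongProd G').V) :
    (G.strongProd G').Rel x y ↔ G.Rel x.1 y.1 ∧ G'.Rel x.2 y.2 := by
  obtain ⟨a, a'⟩ := x
  obtain ⟨b, b'⟩ := y
  have h : ((a, a') : G.V × G'.V) = (b, b') ↔ a = b ∧ a' = b' := Prod.mk_inj
  change (((a, a') : G.V × G'.V) = (b, b') ∨ _ ∨ _ ∨ _) ↔ (_ ∨ _) ∧ (_ ∨ _)
  rw [h]
  tauto

/-- The strong product as a functor of both graphs. -/
@[simps]
def strongProdFunctor : Graph.{u} × Graph.{u} ⥤ Graph.{u} where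
  obj P := P.1.strongProd P.2
  map {P Q} f :=
    { toFun := fun x => (f.1.toFun x.1, f.2.toFun x.2)
      map_rel := fun x y h =>
        have h' := (strongProd_rel P.1 P.2 x y).1 h
        (strongProd_rel Q.1 Q.2 _ _).2 ⟨f.1.map_rel _ _ h'.1, f.2.map_rel _ _ h'.2⟩ }
  map_id _ := rfl
  map_comp _ _ := rfl

/-- The Vietoris-Rips complex of a graph, as a simplicial set (the simplicial set generated by
the clique complex): the `n`-simplices are the tuples `(x₀, …, xₙ)` of vertices, repetitions
allowed, any two entries of which are equal or adjacent; faces delete an entry and degeneracies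
repeat one. -/
def vrComplex (G : Graph.{u}) : SSet.{u} where
  obj n := { x : Fin (n.unop.len + 1) → G.V // ∀ i j, G.Rel (x i) (x j) }
  map θ := TypeCat.ofHom fun x => ⟨fun i => x.1 (θ.unop.toOrderHom i), fun _ _ => x.2 _ _⟩
  map_id _ := rfl
  map_comp _ _ := rfl

/-- A tuple of vertices is a simplex exactly when its entries form a clique. -/
lemma forall_rel_iff_isClique (G : Graph.{u}) {n : ℕ} (x : Fin (n + 1) → G.V) :
    (∀ i j, G.Rel (x i) (x j)) ↔ G.graph.IsClique (Set.range x) := by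
  constructor
  · rintro h _ ⟨i, rfl⟩ _ ⟨j, rfl⟩ hij
    exact (h i j).resolve_left hij
  · intro h i j
    by_cases hij : x i = x j
    · exact Or.inl hij
    · exact Or.inr (h ⟨i, rfl⟩ ⟨j, rfl⟩ hij)

/-- The Vietoris-Rips complex as a functor from graphs to simplicial sets. -/
def vrFunctor : Graph.{u} ⥤ SSet.{u} where
  obj G := G.vrComplex
  map f :=
    { app := fun _ => TypeCat.ofHom fun x =>
        ⟨fun i => f.toFun (x.1 i), fun _ _ => f.map_rel _ _ (x.2 _ _)⟩
      naturality := fun _ _ _ => rfl }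
  map_id _ := rfl
  map_comp _ _ := rfl

end Graph

variable (R : Type u) [CommRing R]

/-- Vietoris-Rips homology `H_q(G; M)` in degree `q : ℤ` as a functor of the coefficient module
`M` and of the graph `G`: the homology of the alternating face map complex of the
Vietoris-Rips complex, whose `n`-chains are a direct sum of copies of `M` indexed by the
`n`-simplices; there are no simplices, hence no homology, in negative degrees. -/
def homology : ℤ → (ModuleCat.{u} R ⥤ Graph.{u} ⥤ ModuleCat.{u} R)
  | .ofNat n =>
    SSet.chainComplexFunctor (ModuleCat.{u} R) ⋙
      (Functor.whiskeringLeft _ _ _).obj Graph.vrFunctor.{u} ⋙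
      (Functor.whiskeringRight _ _ _).obj (HomologicalComplex.homologyFunctor _ _ n)
  | .negSucc _ => (Functor.const _).obj ((Functor.const _).obj (ModuleCat.of R PUnit.{u + 1}))

/-- The pairs `(M, M')` of `R`-modules with `Tor₁(M, M') = 0`. -/
def torVanishing : ObjectProperty (ModuleCat.{u} R × ModuleCat.{u} R) :=
  fun P => IsZero (((Tor (ModuleCat.{u} R) 1).obj P.1).obj P.2)

/-- The category of inputs `((G, G'), (M, M'))`: two graphs and two `R`-modules with
`Tor₁(M, M') = 0`. Morphisms are quadruples of two maps of graphs and two linear maps. -/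
abbrev Input : Type (u + 1) := (Graph.{u} × Graph.{u}) × (torVanishing R).FullSubcategory

variable {R} in
/-- The objectwise direct sum of a family of functors. -/
def directSum {D : Type*} [Category* D] {ι : Type} (F : ι → D ⥤ ModuleCat.{u} R) :
    D ⥤ ModuleCat.{u} R where
  obj X := ∐ fun p => (F p).obj X
  map f := Limits.Sigma.map fun p => (F p).map f

namespace Input

/-- `((G, G'), (M, M')) ↦ (G, G')` -/
abbrev graphs : Input R ⥤ Graph.{u} × Graph.{u} := CategoryTheory.Prod.fst _ _

/-- `((G, G'), (M, M')) ↦ (M, M')` -/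
abbrev modules : Input R ⥤ ModuleCat.{u} R × ModuleCat.{u} R :=
  CategoryTheory.Prod.snd _ _ ⋙ (torVanishing R).ι

/-- `((G, G'), (M, M')) ↦ H_i(G; M)` -/
def homologyLeft (i : ℤ) : Input R ⥤ ModuleCat.{u} R :=
  (modules R ⋙ CategoryTheory.Prod.fst _ _).prod' (graphs R ⋙ CategoryTheory.Prod.fst _ _) ⋙
    Functor.uncurry.obj (homology R i)

/-- `((G, G'), (M, M')) ↦ H_j(G'; M')` -/
def homologyRight (j : ℤ) : Input R ⥤ ModuleCat.{u} R :=
  (modules R ⋙ CategoryTheory.Prod.snd _ _).prod' (graphs R ⋙ CategoryTheory.Prod.snd _ _) ⋙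
    Functor.uncurry.obj (homology R j)

/-- `((G, G'), (M, M')) ↦ H_q(G ⊠ G'; M ⊗ M')` -/
def homologyStrongProd (q : ℤ) : Input R ⥤ ModuleCat.{u} R :=
  (modules R ⋙ tensor (ModuleCat.{u} R)).prod' (graphs R ⋙ Graph.strongProdFunctor) ⋙
    Functor.uncurry.obj (homology R q)

/-- `((G, G'), (M, M')) ↦ ⨁_{i + j = q} H_i(G; M) ⊗ H_j(G'; M')` -/
def tensorSum (q : ℤ) : Input R ⥤ ModuleCat.{u} R :=
  directSum fun p : { p : ℤ × ℤ // p.1 + p.2 = q } =>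
    (homologyLeft R p.1.1).prod' (homologyRight R p.1.2) ⋙ tensor (ModuleCat.{u} R)

/-- `((G, G'), (M, M')) ↦ ⨁_{i + j = q} Tor₁(H_i(G; M), H_j(G'; M'))` -/
def torSum (q : ℤ) : Input R ⥤ ModuleCat.{u} R :=
  directSum fun p : { p : ℤ × ℤ // p.1 + p.2 = q } =>
    (homologyLeft R p.1.1).prod' (homologyRight R p.1.2) ⋙
      Functor.uncurry.obj (Tor (ModuleCat.{u} R) 1)

end Input

end VietorisRips

end

/-! A simplex of the Vietoris–Rips complex of `G ⊠ G'` is a pair of simplices of the factors. Hence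
the simplicial module of chains on `G ⊠ G'` with coefficients in `M ⊗ M'` is the levelwise tensor
product of the simplicial modules `A` and `B` of chains on the factors (`chainsTensorIso`), and
`Tor₁(M, M') = 0` gives `Tor₁(A_n, B_n) = 0` for every `n` (`isZero_tor_chains`). What remains is a
natural Künneth sequence for `A ⊗ B` (`simplicialKunneth_shortExact`). It is obtained without the
Eilenberg–Zilber theorem, by treating `L ↦ H_q(Γ(L) ⊗ B)` as a homological functor of a chain
complex `L`, where `Γ` is the inverse Dold–Kan functor and the tensor product is levelwise.

This functor vanishes on contractible `L` (`isZero_tensorHomology_of_contractible`). Indeed `tuples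
A` is `A ⊗ E` with `E_n = R^{n+1}`; truncating tuples contracts `tuples A ⊗ B`, and `A` is a retract
of `tuples A` when its normalized chains are contractible. Applied to cones, this gives suspension
isomorphisms. A flat module `M` in degree zero gives the constant simplicial module and the value `M
⊗ H_q(B)`. So a degreewise flat `M` with zero differential has the value `⨁ M_i ⊗ H_{q-i}(B)`
(`gradedKunneth`).

If `L` is degreewise flat, its cycles and boundaries are flat because `R` is a principal ideal
domain. The short exact sequence from the cycles to `L` to the shifted boundaries gives a long exact
sequence whose connecting map is, up to suspension, induced by the inclusion of the boundaries in
the cycles (`tensorδ_cyclesSequence`). By `gradedKunneth`, the cokernel of that map is `⨁ H_i(L) ⊗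
H_{q-i}(B)`, and the kernel of its shifted version is `⨁ Tor₁(H_{i-1}(L), H_{q-i}(B))`. This is
`kunneth_shortExact`.

A general `A` is replaced by the pullback of `A` and the tuples in the free module on `A`, over
`tuples A`. This is functorial and levelwise torsion-free, hence flat. The kernel of its projection
to `A` is a module of tuples, hence acyclic; the vanishing of `Tor₁(A_n, B_n)` keeps the sequence
exact after tensoring with `B`, where the kernel is still acyclic. Naturality holds because the
Künneth maps are determined by their composites with a natural epimorphism and a natural
monomorphism. -/

noncomputable section

namespace VietorisRips

/-! ### Connecting maps of first left derived functors, for a sequence of functors -/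

section LeftDerivedBifunctor

variable {C D : Type*} [Category* C] [Category* D] [Abelian C] [Abelian D]

section

variable {F G : C ⥤ D} [F.Additive] [G.Additive]

/-- The map `H₀(F(P)) ⟶ F(Y)` for a projective resolution `P` of `Y`. -/
def homologyAugmentation (F : C ⥤ D) [F.Additive] {Y : C} (P : ProjectiveResolution Y) :
    ((F.mapHomologicalComplex _).obj P.complex).homology 0 ⟶ F.obj Y :=
  (ChainComplex.isoHomologyι₀ _).hom ≫ P.fromLeftDerivedZero' F

instance isIso_homologyAugmentation [PreservesFiniteColimits F] {Y : C} (P : ProjectiveResolution Y) :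
    IsIso (homologyAugmentation F P) := by
  have : IsIso (P.fromLeftDerivedZero' F) := inferInstance
  exact IsIso.comp_isIso

/-- The augmentation of a projective resolution in degree zero. -/
def augmentation {Y : C} (P : ProjectiveResolution Y) : P.complex.X 0 ⟶ Y := P.π.f 0

/-- The projection from the cycles of degree zero of `F(K)`. -/
def iCyclesMap (F : C ⥤ D) [F.Additive] (K : ChainComplex C ℕ) :
    ((F.mapHomologicalComplex _).obj K).cycles 0 ⟶ F.obj (K.X 0) :=
  ((F.mapHomologicalComplex _).obj K).iCycles 0

lemma cyclesMap_iCyclesMap {K L : ChainComplex C ℕ} (φ : K ⟶ L) :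
    HomologicalComplex.cyclesMap ((F.mapHomologicalComplex _).map φ) 0 ≫ iCyclesMap F L =
      iCyclesMap F K ≫ F.map (φ.f 0) :=
  HomologicalComplex.cyclesMap_i _ _

lemma cyclesMap_natTrans_iCyclesMap (α : F ⟶ G) (K : ChainComplex C ℕ) :
    HomologicalComplex.cyclesMap ((NatTrans.mapHomologicalComplex α _).app K) 0 ≫ iCyclesMap G K =
      iCyclesMap F K ≫ α.app (K.X 0) :=
  HomologicalComplex.cyclesMap_i _ _

/-- Characterizes the augmentation by its composite with the epimorphism from the cycles; both
naturality statements below follow by cancelling that epimorphism. -/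
lemma homologyπ_homologyAugmentation {Y : C} (P : ProjectiveResolution Y) :
    ((F.mapHomologicalComplex _).obj P.complex).homologyπ 0 ≫ homologyAugmentation F P =
      iCyclesMap F P.complex ≫ F.map (augmentation P) := by
  simp only [homologyAugmentation, iCyclesMap, augmentation, HomologicalComplex.isoHomologyι_hom,
    HomologicalComplex.homology_π_ι_assoc, ProjectiveResolution.pOpcycles_comp_fromLeftDerivedZero']
  rfl

lemma homologyAugmentation_naturality {Y Y' : C} {g : Y ⟶ Y'} (P : ProjectiveResolution Y)
    (Q : ProjectiveResolution Y') (φ : P.complex ⟶ Q.complex)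
    (hφ : φ.f 0 ≫ augmentation Q = augmentation P ≫ g) :
    HomologicalComplex.homologyMap ((F.mapHomologicalComplex _).map φ) 0 ≫
      homologyAugmentation F Q = homologyAugmentation F P ≫ F.map g := by
  rw [← cancel_epi (HomologicalComplex.homologyπ _ 0),
    HomologicalComplex.homologyπ_naturality_assoc, homologyπ_homologyAugmentation,
    reassoc_of% homologyπ_homologyAugmentation, reassoc_of% cyclesMap_iCyclesMap, ← F.map_comp,
    hφ, F.map_comp]

lemma homologyAugmentation_natTrans (α : F ⟶ G) {Y : C} (P : ProjectiveResolution Y) :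
    HomologicalComplex.homologyMap ((NatTrans.mapHomologicalComplex α _).app P.complex) 0 ≫
      homologyAugmentation G P = homologyAugmentation F P ≫ α.app Y := by
  rw [← cancel_epi (HomologicalComplex.homologyπ _ 0),
    HomologicalComplex.homologyπ_naturality_assoc, homologyπ_homologyAugmentation,
    reassoc_of% homologyπ_homologyAugmentation, reassoc_of% cyclesMap_natTrans_iCyclesMap, α.naturality]

end

variable {F₁ F₂ F₃ G₁ G₂ G₃ : C ⥤ D} [F₁.Additive] [F₂.Additive] [F₃.Additive]
  [G₁.Additive] [G₂.Additive] [G₃.Additive]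

/-- The short complex of chain complexes obtained by evaluating a sequence of functors. -/
def evalComplex (f : F₁ ⟶ F₂) (g : F₂ ⟶ F₃) (w : f ≫ g = 0) (K : ChainComplex C ℕ) :
    ShortComplex (ChainComplex D ℕ) where
  X₁ := (F₁.mapHomologicalComplex _).obj K
  X₂ := (F₂.mapHomologicalComplex _).obj K
  X₃ := (F₃.mapHomologicalComplex _).obj K
  f := (NatTrans.mapHomologicalComplex f _).app K
  g := (NatTrans.mapHomologicalComplex g _).app K
  zero := by
    ext i
    exact NatTrans.congr_app w (K.X i)

/-- A sequence of functors which is short exact on projective objects. -/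
structure ShortExactOnProjectives (f : F₁ ⟶ F₂) (g : F₂ ⟶ F₃) : Prop where
  w : f ≫ g = 0
  shortExact (P : C) [Projective P] :
    (ShortComplex.mk (f.app P) (g.app P) (NatTrans.congr_app w P)).ShortExact

variable {f : F₁ ⟶ F₂} {g : F₂ ⟶ F₃}

lemma ShortExactOnProjectives.evalComplex (h : ShortExactOnProjectives f g) {Y : C}
    (P : ProjectiveResolution Y) : (evalComplex f g h.w P.complex).ShortExact :=
  HomologicalComplex.shortExact_of_degreewise_shortExact _ fun i => h.shortExact (P.complex.X i)

namespace ShortExactOnProjectives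

/-- The connecting map `H₁(F₃(P)) ⟶ H₀(F₁(P))` for a projective resolution `P`. -/
def connecting (h : ShortExactOnProjectives f g) {Y : C} (P : ProjectiveResolution Y) :
    ((F₃.mapHomologicalComplex _).obj P.complex).homology 1 ⟶
      ((F₁.mapHomologicalComplex _).obj P.complex).homology 0 :=
  (h.evalComplex P).δ 1 0 (by simp)

lemma mono_connecting (h : ShortExactOnProjectives f g) {Y : C} (P : ProjectiveResolution Y)
    (hY : IsZero (((F₂.mapHomologicalComplex _).obj P.complex).homology 1)) :
    Mono (h.connecting P) :=
  ShortComplex.ShortExact.mono_δ _ _ _ _ hY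

lemma connecting_comp (h : ShortExactOnProjectives f g) {Y : C} (P : ProjectiveResolution Y) :
    h.connecting P ≫ HomologicalComplex.homologyMap
      ((NatTrans.mapHomologicalComplex f _).app P.complex) 0 = 0 :=
  (h.evalComplex P).δ_comp 1 0 (by simp)

lemma connecting_exact (h : ShortExactOnProjectives f g) {Y : C} (P : ProjectiveResolution Y) :
    (ShortComplex.mk _ _ (h.connecting_comp P)).Exact :=
  (h.evalComplex P).homology_exact₁ 1 0 (by simp)

lemma connecting_natTrans {f' : G₁ ⟶ G₂} {g' : G₂ ⟶ G₃}
    (h : ShortExactOnProjectives f g) (h' : ShortExactOnProjectives f' g')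
    (α₁ : F₁ ⟶ G₁) (α₂ : F₂ ⟶ G₂) (α₃ : F₃ ⟶ G₃) (w₁ : f ≫ α₂ = α₁ ≫ f')
    (w₂ : g ≫ α₃ = α₂ ≫ g') {Y : C} (P : ProjectiveResolution Y) :
    HomologicalComplex.homologyMap ((NatTrans.mapHomologicalComplex α₃ _).app P.complex) 1 ≫
      h'.connecting P = h.connecting P ≫
      HomologicalComplex.homologyMap ((NatTrans.mapHomologicalComplex α₁ _).app P.complex) 0 := by
  let φ : VietorisRips.evalComplex f g h.w P.complex ⟶
      VietorisRips.evalComplex f' g' h'.w P.complex :=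
    { τ₁ := (NatTrans.mapHomologicalComplex α₁ _).app P.complex
      τ₂ := (NatTrans.mapHomologicalComplex α₂ _).app P.complex
      τ₃ := (NatTrans.mapHomologicalComplex α₃ _).app P.complex
      comm₁₂ := by
        ext i
        exact (NatTrans.congr_app w₁ (P.complex.X i)).symm
      comm₂₃ := by
        ext i
        exact (NatTrans.congr_app w₂ (P.complex.X i)).symm }
  exact (HomologicalComplex.HomologySequence.δ_naturality φ (h.evalComplex P)
    (h'.evalComplex P) 1 0 (by simp)).symm

lemma connecting_map (h : ShortExactOnProjectives f g) {Y Y' : C} (P : ProjectiveResolution Y)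
    (Q : ProjectiveResolution Y') (ψ : P.complex ⟶ Q.complex) :
    HomologicalComplex.homologyMap ((F₃.mapHomologicalComplex _).map ψ) 1 ≫
      h.connecting Q = h.connecting P ≫
      HomologicalComplex.homologyMap ((F₁.mapHomologicalComplex _).map ψ) 0 := by
  let φ : VietorisRips.evalComplex f g h.w P.complex ⟶
      VietorisRips.evalComplex f g h.w Q.complex :=
    { τ₁ := (F₁.mapHomologicalComplex _).map ψ
      τ₂ := (F₂.mapHomologicalComplex _).map ψ
      τ₃ := (F₃.mapHomologicalComplex _).map ψ
      comm₁₂ := ((NatTrans.mapHomologicalComplex f _).naturality ψ)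
      comm₂₃ := ((NatTrans.mapHomologicalComplex g _).naturality ψ) }
  exact (HomologicalComplex.HomologySequence.δ_naturality φ (h.evalComplex P)
    (h.evalComplex Q) 1 0 (by simp)).symm

variable [HasProjectiveResolutions C]

/-- A left derived functor computed by a projective resolution. -/
def _root_.VietorisRips.derivedIso {Y : C} (P : ProjectiveResolution Y) (F : C ⥤ D) [F.Additive]
    (n : ℕ) : (F.leftDerived n).obj Y ≅ ((F.mapHomologicalComplex _).obj P.complex).homology n :=
  P.isoLeftDerivedObj F n

lemma _root_.VietorisRips.derivedIso_natTrans {Y : C} (P : ProjectiveResolution Y) {F G : C ⥤ D}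
    [F.Additive] [G.Additive] (α : F ⟶ G) (n : ℕ) :
    (NatTrans.leftDerived α n).app Y ≫ (derivedIso P G n).hom = (derivedIso P F n).hom ≫
      HomologicalComplex.homologyMap ((NatTrans.mapHomologicalComplex α _).app P.complex) n := by
  rw [← Iso.eq_comp_inv, Category.assoc]
  exact P.leftDerived_app_eq α n

lemma _root_.VietorisRips.derivedIso_map {Y Y' : C} {k : Y ⟶ Y'} (P : ProjectiveResolution Y)
    (Q : ProjectiveResolution Y') (ψ : P.complex ⟶ Q.complex)
    (hψ : ψ.f 0 ≫ augmentation Q = augmentation P ≫ k) (F : C ⥤ D) [F.Additive] (n : ℕ) :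
    (F.leftDerived n).map k ≫ (derivedIso Q F n).hom = (derivedIso P F n).hom ≫
      HomologicalComplex.homologyMap ((F.mapHomologicalComplex _).map ψ) n :=
  P.isoLeftDerivedObj_hom_naturality k Q ψ hψ F n

/-- The connecting map `L₁F₃(Y) ⟶ F₁(Y)`. -/
def δ (h : ShortExactOnProjectives f g) (Y : C) : (F₃.leftDerived 1).obj Y ⟶ F₁.obj Y :=
  (derivedIso (projectiveResolution Y) F₃ 1).hom ≫
    h.connecting (projectiveResolution Y) ≫ homologyAugmentation F₁ (projectiveResolution Y)

/-- The same projective resolution serves both sides, so the transformations `αᵢ` give a morphism of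
short exact sequences of complexes. -/
lemma δ_natTrans {f' : G₁ ⟶ G₂} {g' : G₂ ⟶ G₃}
    (h : ShortExactOnProjectives f g) (h' : ShortExactOnProjectives f' g')
    (α₁ : F₁ ⟶ G₁) (α₂ : F₂ ⟶ G₂) (α₃ : F₃ ⟶ G₃) (w₁ : f ≫ α₂ = α₁ ≫ f')
    (w₂ : g ≫ α₃ = α₂ ≫ g') (Y : C) :
    (NatTrans.leftDerived α₃ 1).app Y ≫ h'.δ Y = h.δ Y ≫ α₁.app Y := by
  rw [δ, δ, reassoc_of% derivedIso_natTrans, reassoc_of% connecting_natTrans h h' α₁ α₂ α₃ w₁ w₂,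
    homologyAugmentation_natTrans, Category.assoc, Category.assoc]

/-- Any lift of `k` to the projective resolutions works, since only its compatibility with the
augmentations in degree zero matters. -/
lemma δ_map (h : ShortExactOnProjectives f g) {Y Y' : C} (k : Y ⟶ Y') :
    (F₃.leftDerived 1).map k ≫ h.δ Y' = h.δ Y ≫ F₁.map k := by
  obtain ⟨ψ, hψ⟩ : ∃ ψ : (projectiveResolution Y).complex ⟶ (projectiveResolution Y').complex,
      ψ.f 0 ≫ augmentation (projectiveResolution Y') =
        augmentation (projectiveResolution Y) ≫ k :=
    ⟨ProjectiveResolution.lift k _ _, ProjectiveResolution.lift_commutes_zero k _ _⟩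
  rw [δ, δ, reassoc_of% derivedIso_map _ _ ψ hψ, reassoc_of% h.connecting_map,
    homologyAugmentation_naturality _ _ ψ hψ, Category.assoc, Category.assoc]

lemma δ_comp (h : ShortExactOnProjectives f g) (Y : C) : h.δ Y ≫ f.app Y = 0 := by
  rw [δ, Category.assoc, Category.assoc, ← homologyAugmentation_natTrans, reassoc_of% h.connecting_comp,
    zero_comp, comp_zero]

/-- Exactness of `L₁F₃(Y) ⟶ F₁(Y) ⟶ F₂(Y)`. -/
lemma exact [PreservesFiniteColimits F₁] [PreservesFiniteColimits F₂]
    (h : ShortExactOnProjectives f g) (Y : C) :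
    (ShortComplex.mk (h.δ Y) (f.app Y) (h.δ_comp Y)).Exact := by
  refine (ShortComplex.exact_iff_of_iso (ShortComplex.isoMk
    (derivedIso (projectiveResolution Y) F₃ 1).symm
    (asIso (homologyAugmentation F₁ (projectiveResolution Y)))
    (asIso (homologyAugmentation F₂ (projectiveResolution Y))) ?_ ?_)).1
    (h.connecting_exact (projectiveResolution Y))
  · exact (derivedIso (projectiveResolution Y) F₃ 1).inv_hom_id_assoc _
  · exact (homologyAugmentation_natTrans f _).symm

lemma mono_δ [PreservesFiniteColimits F₁]
    (h : ShortExactOnProjectives f g) (Y : C) (hY : IsZero ((F₂.leftDerived 1).obj Y)) :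
    Mono (h.δ Y) := by
  have : Mono (h.connecting (projectiveResolution Y)) :=
    h.mono_connecting _ (hY.of_iso (derivedIso (projectiveResolution Y) F₂ 1).symm)
  exact mono_comp _ _

end ShortExactOnProjectives

end LeftDerivedBifunctor

end VietorisRips

end

/-! ### The connecting map of `Tor₁` in its first variable -/

noncomputable section

namespace VietorisRips

variable {R : Type u} [CommRing R]

section Tor

lemma shortExact_whiskerRight {S : ShortComplex (ModuleCat.{u} R)} (hS : S.ShortExact)
    (N : ModuleCat.{u} R) (h : Module.Flat R N) : (S.map (tensorRight N)).ShortExact :=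
  ModuleCat.shortComplex_shortExact _
    (rTensor_exact N ((ShortComplex.ShortExact.moduleCat_exact_iff_function_exact _).1 hS.exact)
      hS.moduleCat_surjective_g)
    (Module.Flat.rTensor_preserves_injective_linearMap _ hS.moduleCat_injective_f)
    (LinearMap.rTensor_surjective N hS.moduleCat_surjective_g)

lemma flat_of_projective (P : ModuleCat.{u} R) [Projective P] : Module.Flat R P :=
  have := (IsProjective.iff_projective (R := R) (P := P)).2 ‹_›
  inferInstance

/-- `Tor` is derived in its second variable, so a short exact sequence in the first variable is a
sequence of functors to be derived. Projective modules are flat, which makes this sequence short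
exact on them. -/
lemma shortExactOnProjectives_tensoringLeft {S : ShortComplex (ModuleCat.{u} R)}
    (hS : S.ShortExact) :
    ShortExactOnProjectives ((tensoringLeft (ModuleCat.{u} R)).map S.f)
      ((tensoringLeft (ModuleCat.{u} R)).map S.g) where
  w := by rw [← Functor.map_comp, S.zero, Functor.map_zero]
  shortExact P _ := shortExact_whiskerRight hS P (flat_of_projective P)

instance (X : ModuleCat.{u} R) :
    PreservesFiniteColimits ((tensoringLeft (ModuleCat.{u} R)).obj X) :=
  inferInstanceAs (PreservesFiniteColimits (tensorLeft X))

/-- The connecting map `Tor₁(S.X₃, Y) ⟶ S.X₁ ⊗ Y` of a short exact sequence. -/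
def torδ {S : ShortComplex (ModuleCat.{u} R)} (hS : S.ShortExact) (Y : ModuleCat.{u} R) :
    ((Tor (ModuleCat.{u} R) 1).obj S.X₃).obj Y ⟶ S.X₁ ⊗ Y :=
  (shortExactOnProjectives_tensoringLeft hS).δ Y

lemma torδ_naturality {S S' : ShortComplex (ModuleCat.{u} R)} (hS : S.ShortExact)
    (hS' : S'.ShortExact) (φ : S ⟶ S') (Y : ModuleCat.{u} R) :
    ((Tor (ModuleCat.{u} R) 1).map φ.τ₃).app Y ≫ torδ hS' Y = torδ hS Y ≫ φ.τ₁ ▷ Y :=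
  (shortExactOnProjectives_tensoringLeft hS).δ_natTrans
    (shortExactOnProjectives_tensoringLeft hS') ((tensoringLeft (ModuleCat.{u} R)).map φ.τ₁)
    ((tensoringLeft (ModuleCat.{u} R)).map φ.τ₂) ((tensoringLeft (ModuleCat.{u} R)).map φ.τ₃)
    (by rw [← Functor.map_comp, ← Functor.map_comp, φ.comm₁₂])
    (by rw [← Functor.map_comp, ← Functor.map_comp, φ.comm₂₃]) Y

lemma torδ_map {S : ShortComplex (ModuleCat.{u} R)} (hS : S.ShortExact) {Y Y' : ModuleCat.{u} R}
    (k : Y ⟶ Y') :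
    ((Tor (ModuleCat.{u} R) 1).obj S.X₃).map k ≫ torδ hS Y' = torδ hS Y ≫ S.X₁ ◁ k :=
  (shortExactOnProjectives_tensoringLeft hS).δ_map k

lemma torδ_comp {S : ShortComplex (ModuleCat.{u} R)} (hS : S.ShortExact) (Y : ModuleCat.{u} R) :
    torδ hS Y ≫ S.f ▷ Y = 0 :=
  (shortExactOnProjectives_tensoringLeft hS).δ_comp Y

lemma torδ_exact {S : ShortComplex (ModuleCat.{u} R)} (hS : S.ShortExact) (Y : ModuleCat.{u} R) :
    (ShortComplex.mk _ _ (torδ_comp hS Y)).Exact :=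
  (shortExactOnProjectives_tensoringLeft hS).exact Y

/-- Tensoring with the flat module `X` keeps a projective resolution of `Y` exact in degree one. -/
lemma isZero_tor_one_of_flat (X Y : ModuleCat.{u} R) [Module.Flat R X] :
    IsZero (((Tor (ModuleCat.{u} R) 1).obj X).obj Y) := by
  refine IsZero.of_iso ?_ (derivedIso (projectiveResolution Y) _ 1)
  rw [← HomologicalComplex.exactAt_iff_isZero_homology]
  have h := (projectiveResolution Y).exact_succ 0
  have h' := Module.Flat.lTensor_shortComplex_exact X _ h
  rw [HomologicalComplex.exactAt_iff' _ 2 1 0 (by simp) (by simp)]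
  exact h'

lemma torδ_mono {S : ShortComplex (ModuleCat.{u} R)} (hS : S.ShortExact) (Y : ModuleCat.{u} R)
    (h : Module.Flat R S.X₂) : Mono (torδ hS Y) :=
  (shortExactOnProjectives_tensoringLeft hS).mono_δ Y (isZero_tor_one_of_flat S.X₂ Y)

/-- If `Tor₁(S.X₃, Y)` vanishes, then tensoring with `Y` preserves the exactness of `S`. -/
lemma shortExact_whiskerRight_of_isZero_tor {S : ShortComplex (ModuleCat.{u} R)}
    (hS : S.ShortExact) {Y : ModuleCat.{u} R}
    (h : IsZero (((Tor (ModuleCat.{u} R) 1).obj S.X₃).obj Y)) :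
    (S.map (tensorRight Y)).ShortExact := by
  have : Mono (S.f ▷ Y) := (torδ_exact hS Y).mono_g (h.eq_of_src _ _)
  exact ModuleCat.shortComplex_shortExact _
    (rTensor_exact Y ((ShortComplex.ShortExact.moduleCat_exact_iff_function_exact _).1 hS.exact)
      hS.moduleCat_surjective_g)
    ((ModuleCat.mono_iff_injective (S.f ▷ Y)).1 this)
    (LinearMap.rTensor_surjective Y hS.moduleCat_surjective_g)

/-- If tensoring with `Y` preserves the injectivity of `S.f` and `S.X₂` is flat, then
`Tor₁(S.X₃, Y)` vanishes. -/
lemma isZero_tor_of_mono_whiskerRight {S : ShortComplex (ModuleCat.{u} R)}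
    (hS : S.ShortExact) {Y : ModuleCat.{u} R} (hflat : Module.Flat R S.X₂)
    (h : Mono (S.f ▷ Y)) : IsZero (((Tor (ModuleCat.{u} R) 1).obj S.X₃).obj Y) := by
  have := torδ_mono hS Y hflat
  have h0 : torδ hS Y = 0 := by
    rw [← cancel_mono (S.f ▷ Y), torδ_comp, zero_comp]
  rw [IsZero.iff_id_eq_zero, ← cancel_mono (torδ hS Y), h0, comp_zero, comp_zero]

end Tor

end VietorisRips

end

/-! ### Simplicial modules of tuples and their contraction -/

noncomputable section

namespace VietorisRips

section Truncation

open Simplicial Opposite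

variable {C : Type*} [Category* C] [Preadditive C]

/-- Endomorphisms `τ n t` of the objects of a simplicial object, which truncate an `n`-simplex
with `n + 1` entries to the first `t` entries. -/
structure Truncation (X : SimplicialObject C) where
  τ (n t : ℕ) : X _⦋n⦌ ⟶ X _⦋n⦌
  zero (n : ℕ) : τ n 0 = 0
  id (n : ℕ) : τ n (n + 1) = 𝟙 _
  δ_le {n t : ℕ} (i : Fin (n + 2)) (h : t ≤ i) : τ (n + 1) t ≫ X.δ i = X.δ i ≫ τ n t
  δ_lt {n t : ℕ} (i : Fin (n + 2)) (h : (i : ℕ) < t + 1) :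
    τ (n + 1) (t + 1) ≫ X.δ i = X.δ i ≫ τ n t
  σ_le {n t : ℕ} (i : Fin (n + 1)) (h : t ≤ i) : τ n t ≫ X.σ i = X.σ i ≫ τ (n + 1) t
  σ_lt {n t : ℕ} (i : Fin (n + 1)) (h : (i : ℕ) < t) : τ n t ≫ X.σ i = X.σ i ≫ τ (n + 1) (t + 1)

/-- Truncation endomorphisms give a contraction. -/
def Truncation.homotopy {X : SimplicialObject C} (T : Truncation X) :
    SimplicialObject.Homotopy (𝟙 X) 0 where
  h {n} i := X.σ i ≫ T.τ (n + 1) (i + 1)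
  -- At this end no entry survives, which gives `0`; at the last end all entries survive, which
  -- gives the identity.
  h_zero_comp_δ_zero n := by
    rw [Category.assoc, T.δ_lt _ (by simp), Fin.val_zero, T.zero, comp_zero, comp_zero]
    rfl
  h_last_comp_δ_last n := by
    rw [Category.assoc, T.δ_le _ (by simp), Fin.val_last, T.id, Category.comp_id]
    exact X.δ_comp_σ_succ (i := Fin.last n)
  h_succ_comp_δ_castSucc_of_lt {n} i j hij := by
    rw [Category.assoc, T.δ_lt _ (by
      simp only [Fin.le_def, Fin.val_castSucc, Fin.val_succ] at *; omega),
      X.δ_comp_σ_of_le_assoc hij, Fin.val_succ]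
  h_succ_comp_δ_castSucc_succ {n} j := by
    rw [Category.assoc, Category.assoc, T.δ_lt _ (by simp), T.δ_le _ (by simp),
      Fin.val_succ, Fin.val_castSucc, ← Fin.castSucc_succ, X.δ_comp_σ_self_assoc,
      Fin.castSucc_succ, X.δ_comp_σ_succ_assoc]
  h_castSucc_comp_δ_succ_of_lt {n} i j hji := by
    rw [Category.assoc, T.δ_le _ (by
      simp only [Fin.lt_def, Fin.val_castSucc, Fin.val_succ] at *; omega),
      X.δ_comp_σ_of_gt_assoc hji, Fin.val_castSucc]
  h_comp_σ_castSucc_of_le {n} i j hij := by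
    rw [Category.assoc, T.σ_lt _ (by
      simp only [Fin.le_def, Fin.val_castSucc] at *; omega),
      X.σ_comp_σ_assoc hij, Fin.val_succ]
  h_comp_σ_succ_of_lt {n} i j hji := by
    rw [Category.assoc, T.σ_le _ (by
      simp only [Fin.le_def, Fin.val_succ] at *; omega),
      ← X.σ_comp_σ_assoc hji, Fin.val_castSucc]

end Truncation

variable {R : Type u} [CommRing R]

section

open Simplicial Opposite

/-- The homology of the alternating face map complex of a simplicial module. -/
def simplicialHomology (q : ℕ) : SimplicialObject (ModuleCat.{u} R) ⥤ ModuleCat.{u} R :=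
  AlgebraicTopology.alternatingFaceMapComplex _ ⋙ HomologicalComplex.homologyFunctor _ _ q

instance (q : ℕ) : (simplicialHomology (R := R) q).Additive := by
  unfold simplicialHomology
  infer_instance

lemma Truncation.isZero_simplicialHomology {X : SimplicialObject (ModuleCat.{u} R)}
    (T : Truncation X) (q : ℕ) : IsZero ((simplicialHomology q).obj X) := by
  rw [IsZero.iff_id_eq_zero, ← (simplicialHomology q).map_id, ← (simplicialHomology q).map_zero]
  exact T.homotopy.map_homology_eq q

/-- The module of `n + 1`-tuples in the module of `n`-simplices of a simplicial module. -/
def tuplesObj (A : SimplicialObject (ModuleCat.{u} R)) (n : SimplexCategoryᵒᵖ) : ModuleCat.{u} R :=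
  ModuleCat.of R (Fin (n.unop.len + 1) → A.obj n)

section tuples

variable (A : SimplicialObject (ModuleCat.{u} R))

/-- An entry of a tuple. -/
def entry (n : SimplexCategoryᵒᵖ) (i : Fin (n.unop.len + 1)) : tuplesObj A n ⟶ A.obj n :=
  ModuleCat.ofHom (LinearMap.proj i)

variable {A} in
/-- The map to a module of tuples with given entries. -/
def tupleLift {n : SimplexCategoryᵒᵖ} {M : ModuleCat.{u} R}
    (f : Fin (n.unop.len + 1) → (M ⟶ A.obj n)) : M ⟶ tuplesObj A n :=
  ModuleCat.ofHom (LinearMap.pi fun i => (f i).hom)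

variable {A} in
@[simp]
lemma tupleLift_entry {n : SimplexCategoryᵒᵖ} {M : ModuleCat.{u} R}
    (f : Fin (n.unop.len + 1) → (M ⟶ A.obj n)) (i : Fin (n.unop.len + 1)) :
    tupleLift f ≫ entry A n i = f i := rfl

variable {A} in
lemma tuples_hom_ext {n : SimplexCategoryᵒᵖ} {M : ModuleCat.{u} R} {f g : M ⟶ tuplesObj A n}
    (h : ∀ i, f ≫ entry A n i = g ≫ entry A n i) : f = g :=
  ModuleCat.hom_ext (LinearMap.ext fun x => funext fun i =>
    congrArg (fun (k : M ⟶ A.obj n) => k.hom x) (h i))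

/-- The simplicial structure on tuples, acting both on a tuple and on its entries. -/
def tuplesMap {m n : SimplexCategoryᵒᵖ} (θ : m ⟶ n) : tuplesObj A m ⟶ tuplesObj A n :=
  tupleLift fun i => entry A _ (θ.unop.toOrderHom i) ≫ A.map θ

@[simp]
lemma tuplesMap_entry {m n : SimplexCategoryᵒᵖ} (θ : m ⟶ n) (i : Fin (n.unop.len + 1)) :
    tuplesMap A θ ≫ entry A n i = entry A m (θ.unop.toOrderHom i) ≫ A.map θ := rfl

/-- The simplicial module with `n`-simplices the `n + 1`-tuples in `A_n`. -/
def tuples : SimplicialObject (ModuleCat.{u} R) where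
  obj n := tuplesObj A n
  map θ := tuplesMap A θ
  map_id n := tuples_hom_ext fun i => by simp
  map_comp θ θ' := tuples_hom_ext fun i => by
    rw [Category.assoc, tuplesMap_entry, tuplesMap_entry, reassoc_of% tuplesMap_entry, A.map_comp]
    rfl

/-- Truncation of a tuple to its first `t` entries. -/
def truncateTuple (n : SimplexCategoryᵒᵖ) (t : ℕ) : tuplesObj A n ⟶ tuplesObj A n :=
  tupleLift fun i => if (i : ℕ) < t then entry A n i else 0

/-- The structure map of `θ` reindexes entries along `θ`. The two truncations therefore match when
the first `t` indices are the preimage of the first `s`, and each face and degeneracy axiom of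
`Truncation` is such a comparison of initial segments. -/
lemma truncateTuple_comp_map {m n : SimplexCategoryᵒᵖ}
    (θ : m ⟶ n) (s t : ℕ) (h : ∀ i, (θ.unop.toOrderHom i : ℕ) < s ↔ (i : ℕ) < t) :
    truncateTuple A m s ≫ tuplesMap A θ = tuplesMap A θ ≫ truncateTuple A n t := by
  refine tuples_hom_ext fun i => ?_
  simp only [truncateTuple, Category.assoc, tupleLift_entry, reassoc_of% tupleLift_entry, h,
    tuplesMap_entry]
  split_ifs <;> simp

end tuples

lemma truncateTuple_whiskerRight_comp_map (A B : SimplicialObject (ModuleCat.{u} R))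
    {m n : SimplexCategoryᵒᵖ} (θ : m ⟶ n) (s t : ℕ)
    (h : ∀ i, (θ.unop.toOrderHom i : ℕ) < s ↔ (i : ℕ) < t) :
    truncateTuple A m s ▷ B.obj m ≫ (tuplesMap A θ ⊗ₘ B.map θ) =
      (tuplesMap A θ ⊗ₘ B.map θ) ≫ truncateTuple A n t ▷ B.obj n := by
  rw [whiskerRight_comp_tensorHom, tensorHom_comp_whiskerRight, truncateTuple_comp_map A θ s t h]

/-- The truncation endomorphisms of `tuples A ⊗ B`. -/
def truncation (A B : SimplicialObject (ModuleCat.{u} R)) : Truncation (tuples A ⊗ B) where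
  τ n t := truncateTuple A (op ⦋n⦌) t ▷ B _⦋n⦌
  zero n := by
    have : truncateTuple A (op ⦋n⦌) 0 = 0 :=
      tuples_hom_ext fun i => by simp [truncateTuple]
    rw [this, MonoidalPreadditive.zero_whiskerRight]
    rfl
  id n := by
    have : truncateTuple A (op ⦋n⦌) (n + 1) = 𝟙 _ :=
      tuples_hom_ext fun i => by rw [truncateTuple, tupleLift_entry, if_pos i.2, Category.id_comp]
    rw [this, id_whiskerRight]
    rfl
  δ_le {n t} i h := by
    refine truncateTuple_whiskerRight_comp_map A B (SimplexCategory.δ i).op t t fun j => ?_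
    change (i.succAbove j : ℕ) < t ↔ (j : ℕ) < t
    rw [Fin.succAbove]
    split_ifs with hj <;> simp only [Fin.lt_def, Fin.val_castSucc, Fin.val_succ] at * <;> omega
  δ_lt {n t} i h := by
    refine truncateTuple_whiskerRight_comp_map A B (SimplexCategory.δ i).op (t + 1) t fun j => ?_
    change (i.succAbove j : ℕ) < t + 1 ↔ (j : ℕ) < t
    rw [Fin.succAbove]
    split_ifs with hj <;> simp only [Fin.lt_def, Fin.val_castSucc, Fin.val_succ] at * <;> omega
  σ_le {n t} i h := by
    refine truncateTuple_whiskerRight_comp_map A B (SimplexCategory.σ i).op t t fun j => ?_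
    change (i.predAbove j : ℕ) < t ↔ (j : ℕ) < t
    rw [Fin.predAbove]
    split_ifs with hj
    · have hj' : (i : ℕ) < j := hj
      rw [Fin.val_pred]
      omega
    · rfl
  σ_lt {n t} i h := by
    refine truncateTuple_whiskerRight_comp_map A B (SimplexCategory.σ i).op t (t + 1) fun j => ?_
    change (i.predAbove j : ℕ) < t ↔ (j : ℕ) < t + 1
    rw [Fin.predAbove]
    split_ifs with hj
    · have hj' : (i : ℕ) < j := hj
      rw [Fin.val_pred]
      omega
    · have hj' : ¬ (i : ℕ) < j := hj
      rw [Fin.coe_castPred]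
      omega

/-- The truncations act on the tuple factor only, so `B` may be arbitrary. -/
lemma isZero_simplicialHomology_tuples_tensor (A B : SimplicialObject (ModuleCat.{u} R)) (q : ℕ) :
    IsZero ((simplicialHomology q).obj (tuples A ⊗ B)) :=
  (truncation A B).isZero_simplicialHomology q

end

end VietorisRips

end

/-! ### The Dold–Kan correspondence and acyclicity for contractible complexes -/

noncomputable section

namespace VietorisRips

variable {R : Type u} [CommRing R]

section DoldKan

open Simplicial Opposite AlgebraicTopology

variable (R) in
/-- The Dold-Kan equivalence for modules. -/
abbrev doldKan : SimplicialObject (ModuleCat.{u} R) ≌ ChainComplex (ModuleCat.{u} R) ℕ :=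
  Abelian.DoldKan.equivalence

/-- The inclusion of the normalized chains. -/
def mooreInclusion (A : SimplicialObject (ModuleCat.{u} R)) (n : ℕ) :
    ((doldKan R).functor.obj A).X n ⟶ A _⦋n⦌ :=
  (inclusionOfMooreComplexMap A).f n

instance (A : SimplicialObject (ModuleCat.{u} R)) (n : ℕ) : Mono (mooreInclusion A n) := by
  have : Mono (inclusionOfMooreComplexMap A) := inferInstance
  exact inferInstanceAs (Mono ((inclusionOfMooreComplexMap A).f n))

/-- The projection to the normalized chains. -/
def mooreProjection (A : SimplicialObject (ModuleCat.{u} R)) (n : ℕ) :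
    A _⦋n⦌ ⟶ ((doldKan R).functor.obj A).X n :=
  (DoldKan.PInftyToNormalizedMooreComplex A).f n

@[simp]
lemma mooreInclusion_projection (A : SimplicialObject (ModuleCat.{u} R)) (n : ℕ) :
    mooreInclusion A n ≫ mooreProjection A n = 𝟙 _ :=
  HomologicalComplex.congr_hom (DoldKan.splitMonoInclusionOfMooreComplexMap A).id n

lemma mooreProjection_inclusion (A : SimplicialObject (ModuleCat.{u} R)) (n : ℕ) :
    mooreProjection A n ≫ mooreInclusion A n = DoldKan.PInfty.f n :=
  HomologicalComplex.congr_hom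
    (DoldKan.PInftyToNormalizedMooreComplex_comp_inclusionOfMooreComplexMap A) n

lemma moore_map_inclusion {A B : SimplicialObject (ModuleCat.{u} R)} (f : A ⟶ B) (n : ℕ) :
    ((doldKan R).functor.map f).f n ≫ mooreInclusion B n =
      mooreInclusion A n ≫ f.app (op ⦋n⦌) :=
  HomologicalComplex.congr_hom ((inclusionOfMooreComplex (ModuleCat.{u} R)).naturality f) n

instance : (doldKan R).functor.Additive where
  map_add {A B f g} := by
    ext n : 1
    rw [← cancel_mono (mooreInclusion B n), HomologicalComplex.add_f_apply,
      Preadditive.add_comp, moore_map_inclusion, moore_map_inclusion, moore_map_inclusion,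
      ← Preadditive.comp_add]
    rfl

instance : (doldKan R).inverse.Additive := Equivalence.inverse_additive _

lemma PInfty_comp_app {A B : SimplicialObject (ModuleCat.{u} R)} (f : A ⟶ B) (n : ℕ)
    (hf : ((doldKan R).functor.map f).f n = 0) :
    (DoldKan.PInfty.f n : A _⦋n⦌ ⟶ A _⦋n⦌) ≫ f.app (op ⦋n⦌) = 0 := by
  have h := moore_map_inclusion f n
  rw [hf, zero_comp] at h
  rw [← mooreProjection_inclusion, Category.assoc, ← h, comp_zero]

/-- By induction on the degree: a simplex module is the sum of the normalized chains, where the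
hypothesis applies, and of images of degeneracies, where naturality reduces to the previous degree.
-/
lemma app_eq_zero_of_moore_map_eq_zero {A B : SimplicialObject (ModuleCat.{u} R)} (f : A ⟶ B)
    (q : ℕ) (hf : ∀ n ≤ q, ((doldKan R).functor.map f).f n = 0) : f.app (op ⦋q⦌) = 0 := by
  induction q with
  | zero =>
    have h := PInfty_comp_app f 0 (hf 0 le_rfl)
    rw [DoldKan.PInfty_f_0] at h
    exact (Category.id_comp _).symm.trans h
  | succ q ih =>
    have h0 := ih fun n hn => hf n (hn.trans q.le_succ)
    have h1 : ∀ i : Fin (q + 1), A.σ i ≫ f.app (op ⦋q + 1⦌) = 0 := fun i =>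
      (f.naturality (SimplexCategory.σ i).op).trans (by rw [h0, zero_comp])
    have h2 : (DoldKan.QInfty.f (q + 1) : A _⦋q + 1⦌ ⟶ A _⦋q + 1⦌) ≫ f.app (op ⦋q + 1⦌) = 0 := by
      rw [DoldKan.QInfty_f, DoldKan.decomposition_Q, Preadditive.sum_comp]
      refine Finset.sum_eq_zero fun i _ => ?_
      simp only [Category.assoc, h1, comp_zero]
    have h3 := congrArg (fun k => k ≫ f.app (op ⦋q + 1⦌))
      (DoldKan.PInfty_f_add_QInfty_f (X := A) (q + 1))
    rw [Preadditive.add_comp, h2, PInfty_comp_app f _ (hf _ le_rfl), add_zero] at h3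
    exact (Category.id_comp _).symm.trans h3.symm

/-- Over a principal ideal domain flat means torsion-free. Multiplication by `r` is a monomorphism
on `A` as soon as it is one on the normalized chains, because the Dold–Kan functor reflects
monomorphisms. -/
lemma flat_of_flat_moore [IsDomain R] [IsPrincipalIdealRing R]
    (A : SimplicialObject (ModuleCat.{u} R))
    (h : ∀ n, Module.Flat R (((doldKan R).functor.obj A).X n)) (n : ℕ) :
    Module.Flat R (A _⦋n⦌) := by
  suffices Module.IsTorsionFree R (A _⦋n⦌) from inferInstance
  refine ⟨fun r hr => ?_⟩
  have h1 : ∀ k, ((doldKan R).functor.map (r • 𝟙 A)).f k = r • 𝟙 _ := fun k => by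
    rw [← cancel_mono (mooreInclusion A k), moore_map_inclusion, Linear.smul_comp,
      Category.id_comp]
    exact (Linear.comp_smul _ _ _ _ _ _).trans (congrArg _ (Category.comp_id _))
  have h2 : ∀ k, Mono (((doldKan R).functor.map (r • 𝟙 A)).f k) := fun k => by
    have := h k
    rw [h1, ModuleCat.mono_iff_injective]
    exact hr.isSMulRegular
  have h3 : Mono ((doldKan R).functor.map (r • 𝟙 A)) := HomologicalComplex.mono_of_mono_f _ h2
  have h4 : Mono (r • 𝟙 A) := (doldKan R).functor.mono_of_mono_map h3
  have h5 : Mono ((r • 𝟙 A).app (op ⦋n⦌)) := inferInstance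
  exact (ModuleCat.mono_iff_injective _).1 h5

/-- The functor on chain complexes `L ↦ K(Γ(L) ⊗ B)`, where `Γ` is the inverse of the Dold-Kan
equivalence and `K` is the alternating face map complex. -/
def tensorChains (B : SimplicialObject (ModuleCat.{u} R)) :
    ChainComplex (ModuleCat.{u} R) ℕ ⥤ ChainComplex (ModuleCat.{u} R) ℕ :=
  (doldKan R).inverse ⋙ tensorRight B ⋙ alternatingFaceMapComplex _

/-- The homology of `Γ(L) ⊗ B`. -/
def tensorHomology (q : ℕ) (B : SimplicialObject (ModuleCat.{u} R)) :
    ChainComplex (ModuleCat.{u} R) ℕ ⥤ ModuleCat.{u} R :=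
  tensorChains B ⋙ HomologicalComplex.homologyFunctor _ _ q

instance (B : SimplicialObject (ModuleCat.{u} R)) :
    (tensorRight B : SimplicialObject (ModuleCat.{u} R) ⥤ _).Additive where
  map_add {X Y f g} := by
    refine NatTrans.ext (funext fun n => ?_)
    exact MonoidalPreadditive.add_whiskerRight (f.app n) (g.app n)

instance (B : SimplicialObject (ModuleCat.{u} R)) : (tensorChains B).Additive := by
  unfold tensorChains
  infer_instance

instance (q : ℕ) (B : SimplicialObject (ModuleCat.{u} R)) : (tensorHomology q B).Additive := by
  unfold tensorHomology
  infer_instance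

variable (B : SimplicialObject (ModuleCat.{u} R))

lemma inverse_map_app_eq_zero {L L' : ChainComplex (ModuleCat.{u} R) ℕ} (f : L ⟶ L') (q : ℕ)
    (hf : ∀ n ≤ q, f.f n = 0) : ((doldKan R).inverse.map f).app (op ⦋q⦌) = 0 := by
  refine app_eq_zero_of_moore_map_eq_zero _ q fun n hn => ?_
  have h := HomologicalComplex.congr_hom ((doldKan R).counitIso.hom.naturality f) n
  rw [HomologicalComplex.comp_f, HomologicalComplex.comp_f, Functor.id_map, hf n hn,
    comp_zero] at h
  have h' : (HomologicalComplex.Hom.f ((doldKan R).counitIso.hom.app L') n) ≫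
      (HomologicalComplex.Hom.f ((doldKan R).counitIso.inv.app L') n) = 𝟙 _ :=
    HomologicalComplex.congr_hom ((doldKan R).counitIso.hom_inv_id_app L') n
  refine (Category.comp_id _).symm.trans ((congrArg (fun k => _ ≫ k) h'.symm).trans ?_)
  exact ((Category.assoc _ _ _).symm.trans (congrArg (fun k => k ≫ _) h)).trans zero_comp

/-- A chain map vanishing in degrees at most `q` induces zero on homology in degree `q`. -/
lemma tensorHomology_map_eq_zero {L L' : ChainComplex (ModuleCat.{u} R) ℕ} (f : L ⟶ L') (q : ℕ)
    (hf : ∀ n ≤ q, f.f n = 0) : (tensorHomology q B).map f = 0 := by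
  have h : ((tensorChains B).map f).f q = 0 := by
    have := inverse_map_app_eq_zero f q hf
    exact (congrArg (fun k => k ▷ B _⦋q⦌) this).trans MonoidalPreadditive.zero_whiskerRight
  change HomologicalComplex.homologyMap ((tensorChains B).map f) q = 0
  rw [← cancel_epi (HomologicalComplex.homologyπ _ q), HomologicalComplex.homologyπ_naturality,
    comp_zero]
  have : HomologicalComplex.cyclesMap ((tensorChains B).map f) q = 0 := by
    rw [← cancel_mono (HomologicalComplex.iCycles _ q), HomologicalComplex.cyclesMap_i, h,
      comp_zero, zero_comp]
  rw [this, zero_comp]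

lemma flat_inverse_obj [IsDomain R] [IsPrincipalIdealRing R]
    (L : ChainComplex (ModuleCat.{u} R) ℕ) (hL : ∀ n, Module.Flat R (L.X n)) (n : ℕ) :
    Module.Flat R (((doldKan R).inverse.obj L) _⦋n⦌) := by
  refine flat_of_flat_moore _ (fun k => ?_) n
  have := hL k
  let e : ((doldKan R).functor.obj ((doldKan R).inverse.obj L)).X k ≅ L.X k :=
    (HomologicalComplex.eval _ _ k).mapIso ((doldKan R).counitIso.app L)
  exact Module.Flat.of_linearEquiv e.toLinearEquiv

/-- `Γ` is exact and preserves flatness of the quotient, so `Tor₁` of the quotient with each `B_n`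
vanishes and the levelwise tensor product with an arbitrary `B` stays exact. -/
lemma shortExact_tensorChains [IsDomain R] [IsPrincipalIdealRing R]
    {S : ShortComplex (ChainComplex (ModuleCat.{u} R) ℕ)} (hS : S.ShortExact)
    (h : ∀ n, Module.Flat R (S.X₃.X n)) : (S.map (tensorChains B)).ShortExact := by
  refine HomologicalComplex.shortExact_of_degreewise_shortExact _ fun n => ?_
  have h1 := hS.map_of_exact (doldKan R).inverse
  have h2 := h1.map_of_exact ((evaluation _ _).obj (op ⦋n⦌))
  refine shortExact_whiskerRight_of_isZero_tor (Y := B _⦋n⦌) h2 ?_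
  have := flat_inverse_obj S.X₃ h n
  exact isZero_tor_one_of_flat (((doldKan R).inverse.obj S.X₃) _⦋n⦌) _

/-- The diagonal of the module of tuples. -/
def diagonal (A : SimplicialObject (ModuleCat.{u} R)) : A ⟶ tuples A where
  app n := tupleLift fun _ => 𝟙 _
  naturality m n θ := tuples_hom_ext fun i => by
    change A.map θ ≫ 𝟙 _ = 𝟙 _ ≫ A.map θ
    simp

/-- A simplicial module whose normalized chain complex is contractible is a retract of its module
of tuples. -/
lemma exists_retraction_diagonal (A : SimplicialObject (ModuleCat.{u} R))
    (c : Homotopy (𝟙 ((doldKan R).functor.obj A)) 0) :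
    ∃ ρ : tuples A ⟶ A, diagonal A ≫ ρ = 𝟙 A := by
  -- Evaluation at the first entry need not be simplicial, but it is a left inverse of the diagonal
  -- in each degree. That is enough, since a null-homotopic map is a chain map whatever family of
  -- maps it is built from.
  let ev (n : ℕ) : tuples A _⦋n⦌ ⟶ A _⦋n⦌ := entry A (op ⦋n⦌) 0
  let r (n : ℕ) : ((doldKan R).functor.obj (tuples A)).X n ⟶ ((doldKan R).functor.obj A).X n :=
    mooreInclusion _ n ≫ ev n ≫ mooreProjection A n
  have hr (n : ℕ) : ((doldKan R).functor.map (diagonal A)).f n ≫ r n = 𝟙 _ := by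
    simp only [r]
    rw [reassoc_of% moore_map_inclusion]
    have : (diagonal A).app (op ⦋n⦌) ≫ ev n = 𝟙 _ := rfl
    rw [reassoc_of% this, mooreInclusion_projection]
  refine ⟨(doldKan R).functor.preimage (Homotopy.nullHomotopicMap fun i j => r i ≫ c.hom i j),
    (doldKan R).functor.map_injective ?_⟩
  rw [(doldKan R).functor.map_comp, Functor.map_preimage, (doldKan R).functor.map_id]
  -- Along the diagonal the family `r i ≫ c.hom i j` becomes `c` itself, so the composite is the
  -- identity by the homotopy equation of `c`.
  rw [Homotopy.comp_nullHomotopicMap]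
  ext n : 1
  have := c.comm n
  rw [HomologicalComplex.zero_f, add_zero] at this
  rw [this]
  simp only [← Category.assoc, hr, Category.id_comp]
  rfl

/-- `Γ(L)` is a retract of its module of tuples, and remains so after tensoring with `B` and taking
homology; there the larger module vanishes. -/
lemma isZero_tensorHomology_of_contractible (L : ChainComplex (ModuleCat.{u} R) ℕ)
    (c : Homotopy (𝟙 L) 0) (q : ℕ) : IsZero ((tensorHomology q B).obj L) := by
  let e := (doldKan R).counitIso.app L
  have c' : Homotopy (𝟙 ((doldKan R).functor.obj ((doldKan R).inverse.obj L))) 0 := by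
    refine (Homotopy.ofEq ?_).trans (((c.compRight e.inv).compLeft e.hom).trans (Homotopy.ofEq ?_))
    · simp
    · simp
  obtain ⟨ρ, hρ⟩ := exists_retraction_diagonal _ c'
  have h := isZero_simplicialHomology_tuples_tensor ((doldKan R).inverse.obj L) B q
  have h1 := congrArg (fun f => (simplicialHomology q).map (f ▷ B)) hρ
  simp only [comp_whiskerRight, Functor.map_comp, id_whiskerRight,
    h.eq_zero_of_tgt ((simplicialHomology q).map (diagonal _ ▷ B)), zero_comp] at h1
  exact (IsZero.iff_id_eq_zero ((simplicialHomology q).obj ((doldKan R).inverse.obj L ⊗ B))).2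
    (((simplicialHomology q).map_id _).symm.trans h1.symm)

end DoldKan

end VietorisRips

end

/-! ### The long exact sequence of `L ↦ H_q(Γ(L) ⊗ B)` -/

noncomputable section

namespace VietorisRips

variable {R : Type u} [CommRing R]

section TensorHomology

open Simplicial Opposite AlgebraicTopology

/-- The naturality of `Γ(L) ⊗ B` in `B`. -/
def tensorChainsMap {B B' : SimplicialObject (ModuleCat.{u} R)} (β : B ⟶ B') :
    tensorChains B ⟶ tensorChains B' :=
  Functor.whiskerLeft _ (Functor.whiskerRight
    ((tensoringRight (SimplicialObject (ModuleCat.{u} R))).map β) _)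

/-- The naturality of the homology of `Γ(L) ⊗ B` in `B`. -/
def tensorHomologyMap (q : ℕ) {B B' : SimplicialObject (ModuleCat.{u} R)} (β : B ⟶ B')
    (L : ChainComplex (ModuleCat.{u} R) ℕ) :
    (tensorHomology q B).obj L ⟶ (tensorHomology q B').obj L :=
  HomologicalComplex.homologyMap ((tensorChainsMap β).app L) q

lemma tensorHomologyMap_naturality (q : ℕ) {B B' : SimplicialObject (ModuleCat.{u} R)}
    (β : B ⟶ B') {L L' : ChainComplex (ModuleCat.{u} R) ℕ} (f : L ⟶ L') :
    (tensorHomology q B).map f ≫ tensorHomologyMap q β L' =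
      tensorHomologyMap q β L ≫ (tensorHomology q B').map f :=
  ((HomologicalComplex.homologyMap_comp _ _ _).symm.trans (congrArg
    (fun k => HomologicalComplex.homologyMap k q) ((tensorChainsMap β).naturality f))).trans
    (HomologicalComplex.homologyMap_comp _ _ _)

lemma tensorHomology_exact [IsDomain R] [IsPrincipalIdealRing R]
    (B : SimplicialObject (ModuleCat.{u} R)) {S : ShortComplex (ChainComplex (ModuleCat.{u} R) ℕ)}
    (hS : S.ShortExact) (h : ∀ n, Module.Flat R (S.X₃.X n)) (q : ℕ) :
    (S.map (tensorHomology q B)).Exact :=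
  (shortExact_tensorChains B hS h).homology_exact₂ q

variable [IsDomain R] [IsPrincipalIdealRing R] (B : SimplicialObject (ModuleCat.{u} R))
  {S : ShortComplex (ChainComplex (ModuleCat.{u} R) ℕ)} (hS : S.ShortExact)
  (h : ∀ n, Module.Flat R (S.X₃.X n)) (q : ℕ)

/-- The connecting map of the long exact homology sequence of `Γ(-) ⊗ B`. -/
def tensorδ : (tensorHomology (q + 1) B).obj S.X₃ ⟶ (tensorHomology q B).obj S.X₁ :=
  (shortExact_tensorChains B hS h).δ (q + 1) q rfl

@[simp]
lemma tensorδ_comp : tensorδ B hS h q ≫ (tensorHomology q B).map S.f = 0 :=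
  (shortExact_tensorChains B hS h).δ_comp (q + 1) q rfl

@[simp]
lemma comp_tensorδ : (tensorHomology (q + 1) B).map S.g ≫ tensorδ B hS h q = 0 :=
  (shortExact_tensorChains B hS h).comp_δ (q + 1) q rfl

lemma tensorδ_exact₁ : (ShortComplex.mk _ _ (tensorδ_comp B hS h q)).Exact :=
  (shortExact_tensorChains B hS h).homology_exact₁ (q + 1) q rfl

lemma tensorδ_exact₃ : (ShortComplex.mk _ _ (comp_tensorδ B hS h q)).Exact :=
  (shortExact_tensorChains B hS h).homology_exact₃ (q + 1) q rfl

lemma isIso_tensorδ (hz : ∀ n, IsZero ((tensorHomology n B).obj S.X₂)) :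
    IsIso (tensorδ B hS h q) :=
  (shortExact_tensorChains B hS h).isIso_δ (q + 1) q rfl (hz _) (hz _)

lemma tensorδ_naturality {S' : ShortComplex (ChainComplex (ModuleCat.{u} R) ℕ)}
    (hS' : S'.ShortExact) (h' : ∀ n, Module.Flat R (S'.X₃.X n)) (φ : S ⟶ S') :
    (tensorHomology (q + 1) B).map φ.τ₃ ≫ tensorδ B hS' h' q =
      tensorδ B hS h q ≫ (tensorHomology q B).map φ.τ₁ :=
  (HomologicalComplex.HomologySequence.δ_naturality ((tensorChains B).mapShortComplex.map φ)
    (shortExact_tensorChains B hS h) (shortExact_tensorChains B hS' h') (q + 1) q rfl).symm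

lemma tensorδ_naturality_right {B' : SimplicialObject (ModuleCat.{u} R)} (β : B ⟶ B') :
    tensorHomologyMap (q + 1) β S.X₃ ≫ tensorδ B' hS h q =
      tensorδ B hS h q ≫ tensorHomologyMap q β S.X₁ :=
  (HomologicalComplex.HomologySequence.δ_naturality (S.mapNatTrans (tensorChainsMap β))
    (shortExact_tensorChains B hS h) (shortExact_tensorChains B' hS h) (q + 1) q rfl).symm

end TensorHomology

/-! ### Graded modules, their cones, and the suspension isomorphism -/

section Graded

/-- The chain complex with zero differential on a graded module. -/
abbrev zeroDiff (M : ℕ → ModuleCat.{u} R) : ChainComplex (ModuleCat.{u} R) ℕ where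
  X := M
  d := fun _ _ => 0
  shape := fun _ _ _ => rfl
  d_comp_d' := fun _ _ _ _ _ => zero_comp

/-- The chain map given by a map of graded modules. -/
abbrev zeroDiffMap {M M' : ℕ → ModuleCat.{u} R} (f : ∀ n, M n ⟶ M' n) :
    zeroDiff M ⟶ zeroDiff M' where
  f := f
  comm' := fun _ _ _ => comp_zero.trans zero_comp.symm

/-- The graded module which is zero in degree zero and `M n` in degree `n + 1`. -/
def shiftObj (M : ℕ → ModuleCat.{u} R) : ℕ → ModuleCat.{u} R
  | 0 => ModuleCat.of R PUnit.{u + 1}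
  | n + 1 => M n

/-- The action of the shift on morphisms. -/
def shiftMap {M M' : ℕ → ModuleCat.{u} R} (f : ∀ n, M n ⟶ M' n) :
    ∀ n, shiftObj M n ⟶ shiftObj M' n
  | 0 => 𝟙 _
  | n + 1 => f n

/-- The component of degree `n + 1` of a shifted graded module. -/
def shiftSucc (M : ℕ → ModuleCat.{u} R) (n : ℕ) : shiftObj M (n + 1) ≅ M n := Iso.refl _

lemma shiftMap_succ {M M' : ℕ → ModuleCat.{u} R} (f : ∀ n, M n ⟶ M' n) (n : ℕ) :
    shiftMap f (n + 1) ≫ (shiftSucc M' n).hom = (shiftSucc M n).hom ≫ f n :=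
  (Category.comp_id _).trans (Category.id_comp _).symm

lemma isZero_shiftObj_zero (M : ℕ → ModuleCat.{u} R) : IsZero (shiftObj M 0) :=
  ModuleCat.isZero_of_subsingleton (ModuleCat.of R PUnit.{u + 1})

lemma flat_shiftObj (M : ℕ → ModuleCat.{u} R) (hM : ∀ n, Module.Flat R (M n)) (n : ℕ) :
    Module.Flat R (shiftObj M n) := by
  cases n with
  | zero => exact inferInstanceAs (Module.Flat R PUnit.{u + 1})
  | succ n => exact hM n

/-- The graded module which is `M` in degree zero and zero in the other degrees. -/
def singleObj (M : ModuleCat.{u} R) : ℕ → ModuleCat.{u} R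
  | 0 => M
  | _ + 1 => ModuleCat.of R PUnit.{u + 1}

lemma isZero_singleObj_succ (M : ModuleCat.{u} R) (n : ℕ) : IsZero (singleObj M (n + 1)) :=
  ModuleCat.isZero_of_subsingleton (ModuleCat.of R PUnit.{u + 1})

/-- The action of `singleObj` on morphisms. -/
def singleMap {M M' : ModuleCat.{u} R} (f : M ⟶ M') : ∀ n, singleObj M n ⟶ singleObj M' n
  | 0 => f
  | _ + 1 => 𝟙 _

/-- The graded module `n ↦ M (n + 1)`. -/
abbrev tail (M : ℕ → ModuleCat.{u} R) : ℕ → ModuleCat.{u} R := fun n => M (n + 1)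

/-- The inclusion of the component of degree zero. -/
def singleTo (M : ℕ → ModuleCat.{u} R) : ∀ n, singleObj (M 0) n ⟶ M n
  | 0 => 𝟙 _
  | _ + 1 => 0

/-- The projection to the component of degree zero. -/
def toSingle (M : ℕ → ModuleCat.{u} R) : ∀ n, M n ⟶ singleObj (M 0) n
  | 0 => 𝟙 _
  | _ + 1 => 0

/-- The inclusion of the components of positive degree. -/
def shiftTailTo (M : ℕ → ModuleCat.{u} R) : ∀ n, shiftObj (tail M) n ⟶ M n
  | 0 => 0
  | _ + 1 => 𝟙 _

/-- The projection to the components of positive degree. -/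
def toShiftTail (M : ℕ → ModuleCat.{u} R) : ∀ n, M n ⟶ shiftObj (tail M) n
  | 0 => 0
  | _ + 1 => 𝟙 _

variable (M : ℕ → ModuleCat.{u} R) {M' : ℕ → ModuleCat.{u} R} (f : ∀ n, M n ⟶ M' n)

lemma singleTo_toSingle : zeroDiffMap (singleTo M) ≫ zeroDiffMap (toSingle M) = 𝟙 _ := by
  ext n : 1
  cases n with
  | zero => exact Category.id_comp _
  | succ n => exact (isZero_singleObj_succ (M 0) n).eq_of_src _ _

lemma shiftTailTo_toShiftTail :
    zeroDiffMap (shiftTailTo M) ≫ zeroDiffMap (toShiftTail M) = 𝟙 _ := by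
  ext n : 1
  cases n with
  | zero => exact (isZero_shiftObj_zero (tail M)).eq_of_src _ _
  | succ n => exact Category.id_comp _

lemma singleTo_toShiftTail : zeroDiffMap (singleTo M) ≫ zeroDiffMap (toShiftTail M) = 0 := by
  ext n : 1
  cases n with
  | zero => exact (isZero_shiftObj_zero (tail M)).eq_of_tgt _ _
  | succ n => exact zero_comp

lemma shiftTailTo_toSingle : zeroDiffMap (shiftTailTo M) ≫ zeroDiffMap (toSingle M) = 0 := by
  ext n : 1
  cases n with
  | zero => exact (isZero_shiftObj_zero (tail M)).eq_of_src _ _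
  | succ n => exact comp_zero

lemma toSingle_singleTo_add :
    zeroDiffMap (toSingle M) ≫ zeroDiffMap (singleTo M) +
      zeroDiffMap (toShiftTail M) ≫ zeroDiffMap (shiftTailTo M) = 𝟙 _ := by
  ext n : 1
  cases n with
  | zero => exact (add_eq_left.2 zero_comp).trans (Category.id_comp _)
  | succ n => exact (add_eq_right.2 zero_comp).trans (Category.id_comp _)

variable {M}

lemma singleTo_naturality : zeroDiffMap (singleMap (f 0)) ≫ zeroDiffMap (singleTo M') =
    zeroDiffMap (singleTo M) ≫ zeroDiffMap f := by
  ext n : 1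
  cases n with
  | zero => exact (Category.comp_id _).trans (Category.id_comp _).symm
  | succ n => exact comp_zero.trans zero_comp.symm

lemma shiftTailTo_naturality :
    zeroDiffMap (shiftMap fun n => f (n + 1)) ≫ zeroDiffMap (shiftTailTo M') =
      zeroDiffMap (shiftTailTo M) ≫ zeroDiffMap f := by
  ext n : 1
  cases n with
  | zero => exact (isZero_shiftObj_zero (tail M)).eq_of_src _ _
  | succ n => exact (Category.comp_id _).trans (Category.id_comp _).symm

variable (M)

/-- The contractible chain complex `M n ⊞ M (n - 1)`. -/
def cone : ChainComplex (ModuleCat.{u} R) ℕ :=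
  ChainComplex.of (fun n => M n ⊞ shiftObj M n)
    (fun n => biprod.snd ≫ (shiftSucc M n).hom ≫ biprod.inl) (fun _ => by simp)

/-- A component of the cone. -/
def coneXIso (n : ℕ) : (cone M).X n ≅ M n ⊞ shiftObj M n := Iso.refl _

lemma cone_d (n : ℕ) : (cone M).d (n + 1) n =
    (coneXIso M (n + 1)).hom ≫ biprod.snd ≫ (shiftSucc M n).hom ≫ biprod.inl ≫
      (coneXIso M n).inv := by
  have h : ((biprod.snd : M (n + 1) ⊞ shiftObj M (n + 1) ⟶ _) ≫ (shiftSucc M n).hom ≫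
      (biprod.inl : M n ⟶ M n ⊞ shiftObj M n)) = 𝟙 _ ≫ biprod.snd ≫ (shiftSucc M n).hom ≫
      biprod.inl ≫ 𝟙 _ := by
    rw [Category.id_comp, Category.comp_id]
  exact (ChainComplex.of_d (fun n => M n ⊞ shiftObj M n)
    (fun n => biprod.snd ≫ (shiftSucc M n).hom ≫ biprod.inl) n).trans h

/-- The chain maps out of the cone. -/
def coneDesc (L : ChainComplex (ModuleCat.{u} R) ℕ) (a : ∀ n, M n ⟶ L.X n)
    (b : ∀ n, shiftObj M n ⟶ L.X n)
    (hab : ∀ n, b (n + 1) ≫ L.d (n + 1) n = (shiftSucc M n).hom ≫ a n)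
    (ha : ∀ n, a (n + 1) ≫ L.d (n + 1) n = 0) : cone M ⟶ L where
  f n := (coneXIso M n).hom ≫ biprod.desc (a n) (b n)
  comm' i j hij := by
    obtain rfl : j + 1 = i := hij
    rw [cone_d]
    simp only [Category.assoc, Iso.inv_hom_id_assoc, biprod.inl_desc]
    congr 1
    refine biprod.hom_ext' _ _ ?_ ?_
    · simp [ha]
    · simp [hab]

/-- The chain maps into the cone of graded modules. -/
def coneLift (L : ChainComplex (ModuleCat.{u} R) ℕ) (a : ∀ n, L.X n ⟶ M n)
    (b : ∀ n, L.X n ⟶ shiftObj M n)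
    (hab : ∀ n, b (n + 1) ≫ (shiftSucc M n).hom = L.d (n + 1) n ≫ a n)
    (hb : ∀ n, L.d (n + 1) n ≫ b n = 0) : L ⟶ cone M where
  f n := biprod.lift (a n) (b n) ≫ (coneXIso M n).inv
  comm' i j hij := by
    obtain rfl : j + 1 = i := hij
    rw [cone_d]
    simp only [Category.assoc, Iso.inv_hom_id_assoc]
    rw [biprod.lift_snd_assoc, ← Category.assoc, ← Category.assoc, ← Category.assoc]
    congr 1
    refine biprod.hom_ext _ _ ?_ ?_
    · simp [hab]
    · simp [hb]

/-- The inclusion of a graded module in its cone. -/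
def coneInl : zeroDiff M ⟶ cone M :=
  coneLift M _ (fun _ => 𝟙 _) (fun _ => 0) (fun _ => by simp) (fun _ => by simp)

/-- The projection of the cone of a graded module to the shift. -/
def coneSnd : cone M ⟶ zeroDiff (shiftObj M) :=
  coneDesc M _ (fun _ => 0) (fun _ => 𝟙 _) (fun _ => by simp) (fun _ => by simp)

lemma coneInl_f (n : ℕ) : (coneInl M).f n = biprod.inl ≫ (coneXIso M n).inv := by
  have h : biprod.lift (𝟙 (M n)) (0 : M n ⟶ shiftObj M n) = biprod.inl :=
    biprod.hom_ext _ _ (by simp) (by simp)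
  exact congrArg (fun k => k ≫ (coneXIso M n).inv) h

lemma coneSnd_f (n : ℕ) : (coneSnd M).f n = (coneXIso M n).hom ≫ biprod.snd := by
  have h : biprod.desc (0 : M n ⟶ shiftObj M n) (𝟙 (shiftObj M n)) = biprod.snd :=
    biprod.hom_ext' _ _ (by simp) (by simp)
  exact congrArg (fun k => (coneXIso M n).hom ≫ k) h

lemma coneInl_snd : coneInl M ≫ coneSnd M = 0 := by
  ext n : 1
  rw [HomologicalComplex.comp_f, coneInl_f, coneSnd_f]
  simp

/-- The short exact sequence relating a graded module, its cone, and its shift. -/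
abbrev coneSequence : ShortComplex (ChainComplex (ModuleCat.{u} R) ℕ) :=
  ShortComplex.mk (coneInl M) (coneSnd M) (coneInl_snd M)

lemma coneSequence_shortExact : (coneSequence M).ShortExact := by
  refine HomologicalComplex.shortExact_of_degreewise_shortExact _ fun n => ?_
  have h1 : (coneInl M).f n ≫ (coneXIso M n).hom ≫ biprod.fst = 𝟙 _ := by
    rw [coneInl_f]; simp
  have h2 : (biprod.inr ≫ (coneXIso M n).inv) ≫ (coneSnd M).f n = 𝟙 _ := by
    rw [coneSnd_f]; simp
  have h3 : ((coneXIso M n).hom ≫ biprod.fst) ≫ (coneInl M).f n +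
      (coneSnd M).f n ≫ (biprod.inr ≫ (coneXIso M n).inv) = 𝟙 _ := by
    rw [coneSnd_f, coneInl_f, ← Iso.hom_inv_id (coneXIso M n)]
    simp only [Category.assoc]
    rw [← Preadditive.comp_add, ← Category.assoc biprod.fst, ← Category.assoc biprod.snd,
      ← Preadditive.add_comp, biprod.total, Category.id_comp]
  exact ShortComplex.Splitting.shortExact { r := _, s := _, f_r := h1, s_g := h2, id := h3 }

/-- The contracting homotopy of the cone in a degree. -/
def coneContraction (n : ℕ) : (cone M).X n ⟶ (cone M).X (n + 1) :=
  (coneXIso M n).hom ≫ biprod.fst ≫ (shiftSucc M n).inv ≫ biprod.inr ≫ (coneXIso M (n + 1)).inv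

lemma coneContraction_d (n : ℕ) : coneContraction M n ≫ (cone M).d (n + 1) n =
    (coneXIso M n).hom ≫ biprod.fst ≫ biprod.inl ≫ (coneXIso M n).inv := by
  rw [cone_d, coneContraction]
  simp

lemma d_coneContraction (n : ℕ) : (cone M).d (n + 1) n ≫ coneContraction M n =
    (coneXIso M (n + 1)).hom ≫ biprod.snd ≫ biprod.inr ≫ (coneXIso M (n + 1)).inv := by
  rw [cone_d, coneContraction]
  simp

lemma cone_total (n : ℕ) : 𝟙 ((cone M).X n) =
    (coneXIso M n).hom ≫ biprod.snd ≫ biprod.inr ≫ (coneXIso M n).inv +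
      (coneXIso M n).hom ≫ biprod.fst ≫ biprod.inl ≫ (coneXIso M n).inv := by
  rw [← Preadditive.comp_add, ← Category.assoc biprod.fst, ← Category.assoc biprod.snd,
    ← Preadditive.add_comp, add_comm, biprod.total, Category.id_comp, Iso.hom_inv_id]

/-- The cone of a graded module is contractible. -/
def coneHomotopy : Homotopy (𝟙 (cone M)) 0 where
  hom i j := if h : i + 1 = j then coneContraction M i ≫ eqToHom (by rw [h]) else 0
  zero i j hij := dif_neg hij
  comm n := by
    rw [Homotopy.prevD_chainComplex, dif_pos rfl, eqToHom_refl, Category.comp_id,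
      coneContraction_d, HomologicalComplex.zero_f, add_zero, HomologicalComplex.id_f,
      cone_total]
    congr 1
    cases n with
    | zero =>
      rw [Homotopy.dNext_zero_chainComplex]
      rw [(isZero_shiftObj_zero M).eq_zero_of_tgt (biprod.snd : M 0 ⊞ shiftObj M 0 ⟶ _)]
      simp
    | succ n =>
      rw [Homotopy.dNext_succ_chainComplex, dif_pos rfl, eqToHom_refl, Category.comp_id,
        d_coneContraction]

variable {M}

/-- The functoriality of the cone. -/
def coneMap : cone M ⟶ cone M' :=
  coneDesc M _ (fun n => f n ≫ biprod.inl ≫ (coneXIso M' n).inv)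
    (fun n => shiftMap f n ≫ biprod.inr ≫ (coneXIso M' n).inv)
    (fun n => by
      rw [cone_d]
      simp only [Category.assoc, Iso.inv_hom_id_assoc, biprod.inr_snd_assoc]
      rw [← Category.assoc, shiftMap_succ, Category.assoc])
    (fun n => by
      rw [cone_d]
      simp)

lemma coneInl_coneMap : coneInl M ≫ coneMap f = zeroDiffMap f ≫ coneInl M' := by
  ext n : 1
  rw [HomologicalComplex.comp_f, HomologicalComplex.comp_f, coneInl_f, coneInl_f]
  simp [coneMap, coneDesc]

lemma coneSnd_coneMap : coneMap f ≫ coneSnd M' = coneSnd M ≫ zeroDiffMap (shiftMap f) := by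
  ext n : 1
  rw [HomologicalComplex.comp_f, HomologicalComplex.comp_f, coneSnd_f, coneSnd_f]
  simp only [coneMap, coneDesc, Category.assoc]
  congr 1
  refine biprod.hom_ext' _ _ ?_ ?_
  · simp
  · simp

/-- The functoriality of the short exact sequence of the cone. -/
def coneSequenceMap : coneSequence M ⟶ coneSequence M' where
  τ₁ := zeroDiffMap f
  τ₂ := coneMap f
  τ₃ := zeroDiffMap (shiftMap f)
  comm₁₂ := (coneInl_coneMap f).symm
  comm₂₃ := coneSnd_coneMap f

variable (M) [IsDomain R] [IsPrincipalIdealRing R] (B : SimplicialObject (ModuleCat.{u} R)) (q : ℕ)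

/-- The suspension isomorphism. -/
def suspension (hM : ∀ n, Module.Flat R (M n)) :
    (tensorHomology (q + 1) B).obj (zeroDiff (shiftObj M)) ≅
      (tensorHomology q B).obj (zeroDiff M) :=
  have := isIso_tensorδ B (coneSequence_shortExact M) (flat_shiftObj M hM) q
    fun n => isZero_tensorHomology_of_contractible B (cone M) (coneHomotopy M) n
  asIso (tensorδ B (coneSequence_shortExact M) (flat_shiftObj M hM) q)

variable {M}

lemma suspension_naturality (hM : ∀ n, Module.Flat R (M n)) (hM' : ∀ n, Module.Flat R (M' n)) :
    (tensorHomology (q + 1) B).map (zeroDiffMap (shiftMap f)) ≫ (suspension M' B q hM').hom =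
      (suspension M B q hM).hom ≫ (tensorHomology q B).map (zeroDiffMap f) :=
  tensorδ_naturality B (coneSequence_shortExact M) (flat_shiftObj M hM) q
    (coneSequence_shortExact M') (flat_shiftObj M' hM') (coneSequenceMap f)

lemma suspension_naturality_right (hM : ∀ n, Module.Flat R (M n))
    {B' : SimplicialObject (ModuleCat.{u} R)} (β : B ⟶ B') :
    tensorHomologyMap (q + 1) β _ ≫ (suspension M B' q hM).hom =
      (suspension M B q hM).hom ≫ tensorHomologyMap q β _ :=
  tensorδ_naturality_right B (coneSequence_shortExact M) (flat_shiftObj M hM) q β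

end Graded

end VietorisRips

end

/-! ### Constant simplicial modules and complexes concentrated in degree zero -/

noncomputable section

namespace VietorisRips

variable {R : Type u} [CommRing R]

/-- Pasting of two commutative squares, the shape of most naturality proofs below. -/
lemma square_comp {C : Type*} [Category* C] {X₁ X₂ X₃ Y₁ Y₂ Y₃ : C} {f₁ : X₁ ⟶ Y₁} {f₂ : X₂ ⟶ Y₂}
    {f₃ : X₃ ⟶ Y₃} {x : X₁ ⟶ X₂} {x' : X₂ ⟶ X₃} {y : Y₁ ⟶ Y₂} {y' : Y₂ ⟶ Y₃}
    (h : f₁ ≫ y = x ≫ f₂) (h' : f₂ ≫ y' = x' ≫ f₃) : f₁ ≫ y ≫ y' = (x ≫ x') ≫ f₃ := by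
  rw [reassoc_of% h, h', Category.assoc]

section Constant

open Simplicial Opposite AlgebraicTopology

/-- The constant simplicial module. -/
abbrev constant (M : ModuleCat.{u} R) : SimplicialObject (ModuleCat.{u} R) :=
  (SimplicialObject.const _).obj M

/-- A map of constant simplicial modules. -/
abbrev constantMap {M M' : ModuleCat.{u} R} (f : M ⟶ M') : constant M ⟶ constant M' :=
  (SimplicialObject.const _).map f

/-- Degeneracies of a constant simplicial module are identities, whereas `PInfty` annihilates
degeneracies and restricts to the identity on normalized chains. -/
lemma isZero_moore_constant_succ (M : ModuleCat.{u} R) (n : ℕ) :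
    IsZero (((doldKan R).functor.obj (constant M)).X (n + 1)) := by
  have h1 : mooreInclusion (constant M) (n + 1) ≫ (DoldKan.PInfty (X := constant M)).f (n + 1) =
      mooreInclusion (constant M) (n + 1) := by
    rw [← mooreProjection_inclusion, reassoc_of% mooreInclusion_projection]
  have h2 : (DoldKan.PInfty (X := constant M)).f (n + 1) = 0 := by
    have h3 := DoldKan.σ_comp_PInfty (constant M) (0 : Fin (n + 1))
    have h4 : (constant M).σ (0 : Fin (n + 1)) ≫ (DoldKan.PInfty (X := constant M)).f (n + 1) =
      (DoldKan.PInfty (X := constant M)).f (n + 1) := Category.id_comp (X := M) _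
    exact h4.symm.trans h3
  rw [h2, comp_zero] at h1
  exact IsZero.of_mono_eq_zero _ h1.symm

/-- The normalized chains of a constant simplicial module. -/
def mooreConstant (M : ModuleCat.{u} R) :
    (doldKan R).functor.obj (constant M) ⟶ zeroDiff (singleObj M) where
  f
    | 0 => mooreInclusion (constant M) 0
    | _ + 1 => 0
  comm' i j hij := by
    obtain rfl : j + 1 = i := hij
    exact (isZero_moore_constant_succ M j).eq_of_src _ _

instance (M : ModuleCat.{u} R) : IsIso (mooreConstant M) := by
  have (n : ℕ) : IsIso ((mooreConstant M).f n) := by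
    cases n with
    | zero =>
      refine ⟨mooreProjection (constant M) 0, mooreInclusion_projection _ _, ?_⟩
      exact (mooreProjection_inclusion _ _).trans (DoldKan.PInfty_f_0)
    | succ n =>
      exact ⟨0, (isZero_moore_constant_succ M n).eq_of_src _ _,
        (isZero_singleObj_succ M n).eq_of_src _ _⟩
  exact HomologicalComplex.Hom.isIso_of_components _

lemma mooreConstant_naturality {M M' : ModuleCat.{u} R} (f : M ⟶ M') :
    (doldKan R).functor.map (constantMap f) ≫ mooreConstant M' =
      mooreConstant M ≫ zeroDiffMap (singleMap f) := by
  ext n : 1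
  cases n with
  | zero => exact moore_map_inclusion (constantMap f) 0
  | succ n => exact (isZero_moore_constant_succ M n).eq_of_src _ _

/-- The constant simplicial module corresponds under the Dold-Kan equivalence to the chain complex
concentrated in degree zero. -/
def constantIso (M : ModuleCat.{u} R) :
    constant M ≅ (doldKan R).inverse.obj (zeroDiff (singleObj M)) :=
  (doldKan R).unitIso.app (constant M) ≪≫ (doldKan R).inverse.mapIso (asIso (mooreConstant M))

lemma constantIso_naturality {M M' : ModuleCat.{u} R} (f : M ⟶ M') :
    constantMap f ≫ (constantIso M').hom =
      (constantIso M).hom ≫ (doldKan R).inverse.map (zeroDiffMap (singleMap f)) := by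
  have h := (doldKan R).unitIso.hom.naturality (constantMap f)
  have h' := congrArg (fun k => (doldKan R).inverse.map k) (mooreConstant_naturality f)
  simp only [Functor.map_comp] at h'
  have e1 (M : ModuleCat.{u} R) : (constantIso M).hom =
    (doldKan R).unitIso.hom.app (constant M) ≫ (doldKan R).inverse.map (mooreConstant M) := rfl
  rw [e1, e1, Category.assoc, ← h', ← Category.assoc, ← Category.assoc]
  exact congrArg (fun k => k ≫ _) h

/-- The chains of the tensor product with a constant simplicial module. -/
def constantTensorChains (M : ModuleCat.{u} R) (B : SimplicialObject (ModuleCat.{u} R)) :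
    ((tensorLeft M).mapHomologicalComplex _).obj ((alternatingFaceMapComplex _).obj B) ⟶
      (alternatingFaceMapComplex _).obj (constant M ⊗ B) where
  f n := 𝟙 (M ⊗ B _⦋n⦌)
  comm' i j hij := by
    obtain rfl : j + 1 = i := hij
    have h1 : M ◁ ((alternatingFaceMapComplex _).obj B).d (j + 1) j =
        ∑ i : Fin (j + 2), (-1 : ℤ) ^ (i : ℕ) • M ◁ B.δ i := by
      refine (congrArg (fun k => M ◁ k) (AlternatingFaceMapComplex.obj_d_eq B j)).trans ?_
      refine ((tensorLeft M).map_sum _ _).trans (Finset.sum_congr rfl fun i _ => ?_)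
      exact (tensorLeft M).map_zsmul
    have h2 := AlternatingFaceMapComplex.obj_d_eq (constant M ⊗ B) j
    refine (Category.id_comp _).trans (h2.trans ?_)
    exact h1.symm.trans (Category.comp_id _).symm

instance (M : ModuleCat.{u} R) (B : SimplicialObject (ModuleCat.{u} R)) :
    IsIso (constantTensorChains M B) := by
  have (n : ℕ) : IsIso ((constantTensorChains M B).f n) :=
    inferInstanceAs (IsIso (𝟙 (M ⊗ B _⦋n⦌)))
  exact HomologicalComplex.Hom.isIso_of_components _

lemma constantTensorChains_naturality {M M' : ModuleCat.{u} R} (f : M ⟶ M')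
    (B : SimplicialObject (ModuleCat.{u} R)) :
    (NatTrans.mapHomologicalComplex ((tensoringLeft _).map f) _).app _ ≫
      constantTensorChains M' B =
    constantTensorChains M B ≫ (alternatingFaceMapComplex _).map (constantMap f ▷ B) := by
  ext n : 1
  exact (Category.comp_id _).trans (Category.id_comp (f ▷ B _⦋n⦌)).symm

lemma constantTensorChains_naturality_right (M : ModuleCat.{u} R)
    {B B' : SimplicialObject (ModuleCat.{u} R)} (β : B ⟶ B') :
    ((tensorLeft M).mapHomologicalComplex _).map ((alternatingFaceMapComplex _).map β) ≫
      constantTensorChains M B' =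
    constantTensorChains M B ≫ (alternatingFaceMapComplex _).map (constant M ◁ β) := by
  ext n : 1
  exact (Category.comp_id _).trans (Category.id_comp (M ◁ β.app (op ⦋n⦌))).symm

/-- The homology of the tensor product with a constant flat simplicial module. -/
def constantTensorHomology (M : ModuleCat.{u} R) [Module.Flat R M]
    (B : SimplicialObject (ModuleCat.{u} R)) (q : ℕ) :
    M ⊗ (simplicialHomology q).obj B ≅ (simplicialHomology q).obj (constant M ⊗ B) :=
  ((((alternatingFaceMapComplex _).obj B).sc q).mapHomologyIso (tensorLeft M)).symm ≪≫
    (HomologicalComplex.homologyFunctor _ _ q).mapIso (asIso (constantTensorChains M B))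

lemma constantTensorHomology_naturality {M M' : ModuleCat.{u} R} [Module.Flat R M]
    [Module.Flat R M'] (f : M ⟶ M') (B : SimplicialObject (ModuleCat.{u} R)) (q : ℕ) :
    f ▷ (simplicialHomology q).obj B ≫ (constantTensorHomology M' B q).hom =
      (constantTensorHomology M B q).hom ≫ (simplicialHomology q).map (constantMap f ▷ B) := by
  have h := congrArg (fun k => HomologicalComplex.homologyMap k q)
    (constantTensorChains_naturality f B)
  simp only [HomologicalComplex.homologyMap_comp] at h
  let S := ((alternatingFaceMapComplex (ModuleCat.{u} R)).obj B).sc q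
  have h2 : f ▷ S.homology ≫ (S.mapHomologyIso (tensorLeft M')).inv =
      (S.mapHomologyIso (tensorLeft M)).inv ≫
        ShortComplex.homologyMap (S.mapNatTrans ((tensoringLeft (ModuleCat.{u} R)).map f)) := by
    rw [ShortComplex.homologyMap_mapNatTrans, Iso.inv_hom_id_assoc]
    rfl
  exact square_comp h2 h

lemma constantTensorHomology_naturality_right (M : ModuleCat.{u} R) [Module.Flat R M]
    {B B' : SimplicialObject (ModuleCat.{u} R)} (β : B ⟶ B') (q : ℕ) :
    M ◁ (simplicialHomology q).map β ≫ (constantTensorHomology M B' q).hom =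
      (constantTensorHomology M B q).hom ≫ (simplicialHomology q).map (constant M ◁ β) := by
  have h := congrArg (fun k => HomologicalComplex.homologyMap k q)
    (constantTensorChains_naturality_right M β)
  simp only [HomologicalComplex.homologyMap_comp] at h
  exact square_comp (ShortComplex.mapHomologyIso_inv_naturality
    ((HomologicalComplex.shortComplexFunctor _ _ q).map
      ((alternatingFaceMapComplex (ModuleCat.{u} R)).map β)) (tensorLeft M)) h

/-- The homology of the tensor product with a chain complex concentrated in degree zero. -/
def tensorHomologySingle (M : ModuleCat.{u} R) [Module.Flat R M]
    (B : SimplicialObject (ModuleCat.{u} R)) (q : ℕ) :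
    M ⊗ (simplicialHomology q).obj B ≅ (tensorHomology q B).obj (zeroDiff (singleObj M)) :=
  constantTensorHomology M B q ≪≫
    (simplicialHomology q).mapIso ((tensorRight B).mapIso (constantIso M))

lemma tensorHomologySingle_naturality {M M' : ModuleCat.{u} R} [Module.Flat R M]
    [Module.Flat R M'] (f : M ⟶ M') (B : SimplicialObject (ModuleCat.{u} R)) (q : ℕ) :
    f ▷ (simplicialHomology q).obj B ≫ (tensorHomologySingle M' B q).hom =
      (tensorHomologySingle M B q).hom ≫
        (tensorHomology q B).map (zeroDiffMap (singleMap f)) := by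
  have h := congrArg (fun k => (simplicialHomology q).map (k ▷ B)) (constantIso_naturality f)
  simp only [comp_whiskerRight, Functor.map_comp] at h
  exact square_comp (constantTensorHomology_naturality f B q) h

lemma tensorHomologySingle_naturality_right (M : ModuleCat.{u} R) [Module.Flat R M]
    {B B' : SimplicialObject (ModuleCat.{u} R)} (β : B ⟶ B') (q : ℕ) :
    M ◁ (simplicialHomology q).map β ≫ (tensorHomologySingle M B' q).hom =
      (tensorHomologySingle M B q).hom ≫ tensorHomologyMap q β _ := by
  have h := congrArg (fun k => (simplicialHomology q).map k)
    (whisker_exchange (constantIso M).hom β)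
  simp only [Functor.map_comp] at h
  exact square_comp (constantTensorHomology_naturality_right M β q) h

end Constant

end VietorisRips

end

/-! ### The Künneth decomposition for a graded module with zero differential -/

noncomputable section

namespace VietorisRips

variable {R : Type u} [CommRing R]

section GradedKunneth

/-- The homology of a simplicial module in degree `q - i`, which is zero for `i > q`. -/
def complementaryHomology : ℕ → ℕ → SimplicialObject (ModuleCat.{u} R) ⥤ ModuleCat.{u} R
  | q, 0 => simplicialHomology q
  | 0, _ + 1 => (Functor.const _).obj (ModuleCat.of R PUnit.{u + 1})
  | q + 1, i + 1 => complementaryHomology q i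
termination_by structural _ i => i

lemma isZero_complementaryHomology (B : SimplicialObject (ModuleCat.{u} R)) (q i : ℕ)
    (h : q < i) : IsZero ((complementaryHomology q i).obj B) := by
  induction i generalizing q with
  | zero => omega
  | succ i ih =>
    cases q with
    | zero => exact ModuleCat.isZero_of_subsingleton (ModuleCat.of R PUnit.{u + 1})
    | succ q => exact ih q (by omega)

lemma isZero_tensor {X Y : ModuleCat.{u} R} (h : IsZero Y) : IsZero (X ⊗ Y) :=
  (tensorLeft X).map_isZero h

variable (B : SimplicialObject (ModuleCat.{u} R))

lemma map_comp_eq_id (q : ℕ) {L L' : ChainComplex (ModuleCat.{u} R) ℕ} (f : L ⟶ L') (g : L' ⟶ L)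
    (h : f ≫ g = 𝟙 L) : (tensorHomology q B).map f ≫ (tensorHomology q B).map g = 𝟙 _ := by
  rw [← Functor.map_comp, h, CategoryTheory.Functor.map_id]

lemma map_comp_eq_zero (q : ℕ) {L L' L'' : ChainComplex (ModuleCat.{u} R) ℕ} (f : L ⟶ L')
    (g : L' ⟶ L'') (h : f ≫ g = 0) :
    (tensorHomology q B).map f ≫ (tensorHomology q B).map g = 0 := by
  rw [← Functor.map_comp, h, Functor.map_zero]

variable [IsDomain R] [IsPrincipalIdealRing R]

/-- The inclusion of a summand in the Künneth decomposition of `Γ(M) ⊗ B`, for a graded module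
`M`. -/
def gradedι : ∀ (q : ℕ) (M : ℕ → ModuleCat.{u} R) [∀ n, Module.Flat R (M n)] (i : ℕ),
    M i ⊗ (complementaryHomology q i).obj B ⟶ (tensorHomology q B).obj (zeroDiff M)
  | q, M, _, 0 => (tensorHomologySingle (M 0) B q).hom ≫
      (tensorHomology q B).map (zeroDiffMap (singleTo M))
  | 0, _, _, _ + 1 => 0
  | q + 1, M, _, i + 1 => gradedι q (tail M) i ≫
      (suspension (tail M) B q inferInstance).inv ≫
      (tensorHomology (q + 1) B).map (zeroDiffMap (shiftTailTo M))
termination_by structural _ _ _ i => i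

/-- The projection to a summand in the Künneth decomposition of `Γ(M) ⊗ B`, for a graded module
`M`. -/
def gradedπ : ∀ (q : ℕ) (M : ℕ → ModuleCat.{u} R) [∀ n, Module.Flat R (M n)] (i : ℕ),
    (tensorHomology q B).obj (zeroDiff M) ⟶ M i ⊗ (complementaryHomology q i).obj B
  | q, M, _, 0 => (tensorHomology q B).map (zeroDiffMap (toSingle M)) ≫
      (tensorHomologySingle (M 0) B q).inv
  | 0, _, _, _ + 1 => 0
  | q + 1, M, _, i + 1 => (tensorHomology (q + 1) B).map (zeroDiffMap (toShiftTail M)) ≫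
      (suspension (tail M) B q inferInstance).hom ≫ gradedπ q (tail M) i
termination_by structural _ _ _ i => i

lemma gradedι_π (q : ℕ) (M : ℕ → ModuleCat.{u} R) [∀ n, Module.Flat R (M n)] (i : ℕ) :
    gradedι B q M i ≫ gradedπ B q M i = 𝟙 _ := by
  induction i generalizing q M with
  | zero =>
    change ((tensorHomologySingle (M 0) B q).hom ≫ _) ≫ _ ≫ (tensorHomologySingle (M 0) B q).inv =
      𝟙 (M 0 ⊗ (simplicialHomology q).obj B)
    have := map_comp_eq_id B q _ _ (singleTo_toSingle M)
    rw [Category.assoc, reassoc_of% this, Iso.hom_inv_id]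
  | succ i ih =>
    cases q with
    | zero => exact (isZero_tensor (isZero_complementaryHomology B 0 (i + 1) i.succ_pos)).eq_of_src _ _
    | succ q =>
      change (gradedι B q (tail M) i ≫ (suspension (tail M) B q _).inv ≫ _) ≫ _ ≫
        (suspension (tail M) B q _).hom ≫ gradedπ B q (tail M) i =
          𝟙 (tail M i ⊗ (complementaryHomology q i).obj B)
      have := map_comp_eq_id B (q + 1) _ _ (shiftTailTo_toShiftTail M)
      rw [Category.assoc, Category.assoc, reassoc_of% this, Iso.inv_hom_id_assoc, ih]

lemma gradedι_π_of_ne (q : ℕ) (M : ℕ → ModuleCat.{u} R) [∀ n, Module.Flat R (M n)] (i j : ℕ)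
    (h : i ≠ j) : gradedι B q M i ≫ gradedπ B q M j = 0 := by
  induction i generalizing q M j with
  | zero =>
    cases j with
    | zero => exact absurd rfl h
    | succ j =>
      cases q with
      | zero => exact comp_zero
      | succ q =>
        change ((tensorHomologySingle (M 0) B (q + 1)).hom ≫ _) ≫ _ ≫ _ = 0
        have := map_comp_eq_zero B (q + 1) _ _ (singleTo_toShiftTail M)
        rw [Category.assoc, reassoc_of% this, zero_comp, comp_zero]
  | succ i ih =>
    cases q with
    | zero => exact zero_comp
    | succ q =>
      cases j with
      | zero =>
        change (gradedι B q (tail M) i ≫ (suspension (tail M) B q _).inv ≫ _) ≫ _ ≫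
          (tensorHomologySingle (M 0) B (q + 1)).inv =
            (0 : _ ⟶ M 0 ⊗ (simplicialHomology (q + 1)).obj B)
        have := map_comp_eq_zero B (q + 1) _ _ (shiftTailTo_toSingle M)
        rw [Category.assoc, Category.assoc, reassoc_of% this, zero_comp, comp_zero, comp_zero]
      | succ j =>
        change (gradedι B q (tail M) i ≫ (suspension (tail M) B q _).inv ≫ _) ≫ _ ≫
          (suspension (tail M) B q _).hom ≫ gradedπ B q (tail M) j = 0
        have := map_comp_eq_id B (q + 1) _ _ (shiftTailTo_toShiftTail M)
        rw [Category.assoc, Category.assoc, reassoc_of% this, Iso.inv_hom_id_assoc,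
          ih _ _ _ fun hij => h (congrArg _ hij)]

/-- By induction on `q`: the component of degree zero splits off, and suspension identifies the rest
with the same statement for `tail M` one degree lower. -/
lemma sum_gradedπ_ι (q : ℕ) (M : ℕ → ModuleCat.{u} R) [∀ n, Module.Flat R (M n)] :
    ∑ i ∈ Finset.range (q + 1), gradedπ B q M i ≫ gradedι B q M i = 𝟙 _ := by
  have h0 (q : ℕ) (M : ℕ → ModuleCat.{u} R) [∀ n, Module.Flat R (M n)] :
      gradedπ B q M 0 ≫ gradedι B q M 0 = (tensorHomology q B).map
        (zeroDiffMap (toSingle M) ≫ zeroDiffMap (singleTo M)) := by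
    change (_ ≫ (tensorHomologySingle (M 0) B q).inv) ≫ (tensorHomologySingle (M 0) B q).hom ≫ _ = _
    rw [Category.assoc, Iso.inv_hom_id_assoc, Functor.map_comp]
  have h1 (q : ℕ) (M : ℕ → ModuleCat.{u} R) :
      (tensorHomology q B).map (zeroDiffMap (toSingle M) ≫ zeroDiffMap (singleTo M)) +
      (tensorHomology q B).map (zeroDiffMap (toShiftTail M) ≫ zeroDiffMap (shiftTailTo M)) =
        𝟙 _ := by
    rw [← Functor.map_add, toSingle_singleTo_add, CategoryTheory.Functor.map_id]
  induction q generalizing M with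
  | zero =>
    rw [zero_add, Finset.sum_range_one, h0, ← h1, left_eq_add]
    -- The part of positive degree is zero in degree zero, so it contributes nothing to `H₀`.
    refine tensorHomology_map_eq_zero B _ 0 fun n hn => ?_
    obtain rfl : n = 0 := by omega
    exact zero_comp
  | succ q ih =>
    rw [Finset.sum_range_succ', h0, ← h1]
    refine (add_comm _ _).trans (congrArg _ ?_)
    have h2 (i : ℕ) : gradedπ B (q + 1) M (i + 1) ≫ gradedι B (q + 1) M (i + 1) =
        (tensorHomology (q + 1) B).map (zeroDiffMap (toShiftTail M)) ≫
        (suspension (tail M) B q inferInstance).hom ≫ (gradedπ B q (tail M) i ≫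
        gradedι B q (tail M) i) ≫ (suspension (tail M) B q inferInstance).inv ≫
      (tensorHomology (q + 1) B).map (zeroDiffMap (shiftTailTo M)) := by
      change (_ ≫ _ ≫ gradedπ B q (tail M) i) ≫ gradedι B q (tail M) i ≫ _ ≫ _ = _
      simp only [Category.assoc]
    rw [Finset.sum_congr rfl fun i _ => h2 i]
    rw [← Preadditive.comp_sum, ← Preadditive.comp_sum, ← Preadditive.sum_comp, ih,
      Category.id_comp, Iso.hom_inv_id_assoc, Functor.map_comp]

lemma gradedι_naturality (q : ℕ) {M M' : ℕ → ModuleCat.{u} R} [∀ n, Module.Flat R (M n)]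
    [∀ n, Module.Flat R (M' n)] (f : ∀ n, M n ⟶ M' n) (i : ℕ) :
    f i ▷ (complementaryHomology q i).obj B ≫ gradedι B q M' i =
      gradedι B q M i ≫ (tensorHomology q B).map (zeroDiffMap f) := by
  induction i generalizing q M M' with
  | zero =>
    have h := congrArg (fun k => (tensorHomology q B).map k) (singleTo_naturality f)
    simp only [Functor.map_comp] at h
    exact square_comp (tensorHomologySingle_naturality (f 0) B q) h
  | succ i ih =>
    cases q with
    | zero => exact comp_zero.trans zero_comp.symm
    | succ q =>
      have h := congrArg (fun k => (tensorHomology (q + 1) B).map k) (shiftTailTo_naturality f)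
      simp only [Functor.map_comp] at h
      have h' := suspension_naturality (M := tail M) (M' := tail M') (fun n => f (n + 1)) B q
        inferInstance inferInstance
      rw [← Iso.inv_comp_eq, ← Category.assoc, ← Iso.eq_comp_inv] at h'
      exact square_comp (ih q fun n => f (n + 1)) (square_comp h'.symm h)

lemma gradedι_naturality_right (q : ℕ) (M : ℕ → ModuleCat.{u} R) [∀ n, Module.Flat R (M n)]
    {B B' : SimplicialObject (ModuleCat.{u} R)} (β : B ⟶ B') (i : ℕ) :
    M i ◁ (complementaryHomology q i).map β ≫ gradedι B' q M i =
      gradedι B q M i ≫ tensorHomologyMap q β _ := by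
  induction i generalizing q M with
  | zero =>
    exact square_comp (tensorHomologySingle_naturality_right (M 0) β q)
      (tensorHomologyMap_naturality q β _).symm
  | succ i ih =>
    cases q with
    | zero => exact comp_zero.trans zero_comp.symm
    | succ q =>
      have h' := suspension_naturality_right (M := tail M) B q inferInstance β
      rw [← Iso.inv_comp_eq, ← Category.assoc, ← Iso.eq_comp_inv] at h'
      exact square_comp (ih q (tail M)) (square_comp h'.symm
        (tensorHomologyMap_naturality (q + 1) β _).symm)

/-- The Künneth decomposition of `Γ(M) ⊗ B`, for a graded module `M`. -/
def gradedKunneth (q : ℕ) (M : ℕ → ModuleCat.{u} R) [∀ n, Module.Flat R (M n)] :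
    (∐ fun i => M i ⊗ (complementaryHomology q i).obj B) ≅
      (tensorHomology q B).obj (zeroDiff M) where
  hom := Sigma.desc (gradedι B q M)
  inv := ∑ i ∈ Finset.range (q + 1), gradedπ B q M i ≫
    Sigma.ι (fun i => M i ⊗ (complementaryHomology q i).obj B) i
  hom_inv_id := Sigma.hom_ext _ _ fun j => by
    rw [Category.comp_id, Preadditive.comp_sum, Preadditive.comp_sum]
    simp only [Sigma.ι_desc_assoc]
    by_cases hj : j ∈ Finset.range (q + 1)
    · rw [Finset.sum_eq_single_of_mem j hj, reassoc_of% gradedι_π]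
      intro i _ hij
      rw [reassoc_of% gradedι_π_of_ne B q M j i hij.symm, zero_comp]
    -- For an index beyond `q` the complementary degree is negative, so the summand itself is zero.
    · rw [Finset.mem_range] at hj
      exact (isZero_tensor (isZero_complementaryHomology B q j (by omega))).eq_of_src _ _
  inv_hom_id := by
    rw [Preadditive.sum_comp]
    simp only [Category.assoc, Sigma.ι_desc]
    exact sum_gradedπ_ι B q M

end GradedKunneth

end VietorisRips

end

/-! ### Exactness of coproducts and transport of exact sequences -/

noncomputable section

namespace VietorisRips

variable {R : Type u} [CommRing R]

section Coproducts

/-- Exactness of functors on a discrete category is pointwise, and `colim` is exact there by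
assumption. -/
lemma exact_sigmaMap {ι : Type*} [HasColimitsOfShape (Discrete ι) (ModuleCat.{u} R)]
    [HasExactColimitsOfShape (Discrete ι) (ModuleCat.{u} R)] (S : ι → ShortComplex (ModuleCat.{u} R))
    (h : ∀ i, (S i).Exact) :
    (ShortComplex.mk (Limits.Sigma.map fun i => (S i).f) (Limits.Sigma.map fun i => (S i).g)
      (Limits.Sigma.hom_ext _ _ (by simp))).Exact := by
  let T : ShortComplex (Discrete ι ⥤ ModuleCat.{u} R) :=
    ShortComplex.mk
      (Discrete.natTrans fun i => (S i.as).f :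
        Discrete.functor (fun i => (S i).X₁) ⟶ Discrete.functor (fun i => (S i).X₂))
      (Discrete.natTrans fun i => (S i.as).g : _ ⟶ Discrete.functor (fun i => (S i).X₃))
      (by ext i : 2; exact (S i.as).zero)
  have hT : T.Exact := by
    rw [ShortComplex.exact_iff_isZero_homology]
    exact Functor.isZero _ fun i =>
      ((ShortComplex.exact_iff_isZero_homology _).1 (h i.as)).of_iso
        (T.mapHomologyIso ((evaluation _ _).obj i)).symm
  exact hT.map colim

lemma epi_whiskerRight {X Y : ModuleCat.{u} R} (f : X ⟶ Y) [Epi f] (Z : ModuleCat.{u} R) :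
    Epi (f ▷ Z) :=
  (ModuleCat.epi_iff_surjective _).2
    (LinearMap.rTensor_surjective Z ((ModuleCat.epi_iff_surjective f).1 inferInstance))

lemma sigmaMap_square {ι : Type} {X Y Z T : ι → ModuleCat.{u} R} {f : ∀ i, X i ⟶ Y i}
    {g : ∀ i, Y i ⟶ T i} {h : ∀ i, X i ⟶ Z i} {k : ∀ i, Z i ⟶ T i}
    (w : ∀ i, f i ≫ g i = h i ≫ k i) :
    Limits.Sigma.map f ≫ Limits.Sigma.map g = Limits.Sigma.map h ≫ Limits.Sigma.map k :=
  Limits.Sigma.hom_ext _ _ fun i => by simp [reassoc_of% (w i)]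

end Coproducts

section Exactness

variable {C : Type*} [Category* C] [Abelian C] {X Y Z X' Y' Z' : C}

lemma exact_of_isos {f : X ⟶ Y} {g : Y ⟶ Z} {w : f ≫ g = 0} (h : (ShortComplex.mk f g w).Exact)
    (e₁ : X ≅ X') (e₂ : Y ≅ Y') (e₃ : Z ≅ Z') {f' : X' ⟶ Y'} {g' : Y' ⟶ Z'}
    (hf : f ≫ e₂.hom = e₁.hom ≫ f') (hg : g ≫ e₃.hom = e₂.hom ≫ g') :
    ∃ w, (ShortComplex.mk f' g' w).Exact := by
  have w' : f' ≫ g' = 0 := by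
    rw [← cancel_epi e₁.hom, ← reassoc_of% hf, ← hg, reassoc_of% w, zero_comp, comp_zero]
  exact ⟨w', (ShortComplex.exact_iff_of_iso (ShortComplex.isoMk (S₁ := ShortComplex.mk f g w)
    (S₂ := ShortComplex.mk f' g' w') e₁ e₂ e₃ hf.symm hg.symm)).1 h⟩

end Exactness

/-! ### Cycles, boundaries and the connecting map of their sequence -/

section Cycles

variable (L : ChainComplex (ModuleCat.{u} R) ℕ)

/-- The cycles of a chain complex of modules. -/
abbrev cyc (n : ℕ) : ModuleCat.{u} R := L.cycles n

/-- The boundaries of a chain complex of modules. -/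
def bd (n : ℕ) : ModuleCat.{u} R := kernel (L.homologyπ n)

/-- The inclusion of the boundaries in the cycles. -/
def bdι (n : ℕ) : bd L n ⟶ cyc L n := kernel.ι (L.homologyπ n)

instance (n : ℕ) : Mono (bdι L n) := inferInstanceAs (Mono (kernel.ι _))

lemma bdι_homologyπ (n : ℕ) : bdι L n ≫ L.homologyπ n = 0 := kernel.condition _

/-- The short exact sequence defining homology. -/
abbrev bdSequence (n : ℕ) : ShortComplex (ModuleCat.{u} R) :=
  ShortComplex.mk (bdι L n) (L.homologyπ n) (bdι_homologyπ L n)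

lemma bdSequence_shortExact (n : ℕ) : (bdSequence L n).ShortExact where
  exact := ShortComplex.exact_of_f_is_kernel _ (kernelIsKernel (L.homologyπ n))

/-- The surjection to the boundaries. -/
def toBd (n : ℕ) : L.X (n + 1) ⟶ bd L n :=
  kernel.lift (L.homologyπ n) (L.toCycles (n + 1) n) (L.toCycles_comp_homologyπ _ _)

lemma toBd_ι (n : ℕ) : toBd L n ≫ bdι L n = L.toCycles (n + 1) n := kernel.lift_ι _ _ _

instance (n : ℕ) : Epi (toBd L n) :=
  (ShortComplex.exact_of_g_is_cokernel
    (ShortComplex.mk (L.toCycles (n + 1) n) (L.homologyπ n) (L.toCycles_comp_homologyπ _ _))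
    (L.homologyIsCokernel (n + 1) n (by simp))).epi_kernelLift

variable {L} {L' : ChainComplex (ModuleCat.{u} R) ℕ} (f : L ⟶ L')

/-- The map on boundaries. -/
def bdMap (n : ℕ) : bd L n ⟶ bd L' n :=
  kernel.map _ _ (HomologicalComplex.cyclesMap f n) (HomologicalComplex.homologyMap f n)
    (HomologicalComplex.homologyπ_naturality f n)

lemma bdMap_ι (n : ℕ) : bdMap f n ≫ bdι L' n = bdι L n ≫ HomologicalComplex.cyclesMap f n :=
  kernel.lift_ι _ _ _

lemma toBd_naturality (n : ℕ) : f.f (n + 1) ≫ toBd L' n = toBd L n ≫ bdMap f n := by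
  rw [← cancel_mono (bdι L' n), Category.assoc, Category.assoc, toBd_ι, bdMap_ι, ← Category.assoc,
    toBd_ι, ← cancel_mono (L'.iCycles n), Category.assoc, Category.assoc, L'.toCycles_i,
    HomologicalComplex.cyclesMap_i, ← Category.assoc, L.toCycles_i, f.comm]

variable (L)

/-- The component of the chain map to the shifted boundaries. -/
def toShiftBd : ∀ n, L.X n ⟶ shiftObj (bd L) n
  | 0 => 0
  | n + 1 => toBd L n

lemma d_toShiftBd (n : ℕ) : L.d (n + 1) n ≫ toShiftBd L n = 0 := by
  cases n with
  | zero => exact comp_zero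
  | succ n =>
    change L.d (n + 1 + 1) (n + 1) ≫ toBd L n = 0
    rw [← cancel_mono (bdι L n), Category.assoc, toBd_ι, ← cancel_mono (L.iCycles n),
      Category.assoc, L.toCycles_i, L.d_comp_d, zero_comp, zero_comp]

lemma iCycles_toShiftBd (n : ℕ) : L.iCycles n ≫ toShiftBd L n = 0 := by
  cases n with
  | zero => exact comp_zero
  | succ n =>
    change L.iCycles (n + 1) ≫ toBd L n = 0
    rw [← cancel_mono (bdι L n), Category.assoc, toBd_ι, ← cancel_mono (L.iCycles n),
      Category.assoc, L.toCycles_i, L.iCycles_d, zero_comp, zero_comp]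

/-- In degree zero everything is a cycle. In degree `n + 1` the differential is `toBd` followed by a
monomorphism, so `toBd` has the cycles as kernel. -/
lemma cyclesSequence_shortExact_eval (n : ℕ) :
    (ShortComplex.mk (L.iCycles n) (toShiftBd L n) (iCycles_toShiftBd L n)).ShortExact := by
  cases n with
  | zero =>
    have hz : IsZero (shiftObj (bd L) 0) := isZero_shiftObj_zero (bd L)
    have : IsIso (L.iCycles 0) := L.isIso_iCycles 0 _ rfl (by simp)
    refine ShortComplex.ShortExact.mk' ?_ inferInstance ⟨fun _ _ _ => hz.eq_of_src _ _⟩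
    exact (ShortComplex.exact_iff_epi _ (hz.eq_of_tgt _ _)).2 (inferInstanceAs (Epi (L.iCycles 0)))
  | succ n =>
    have : Epi (toShiftBd L (n + 1)) := inferInstanceAs (Epi (toBd L n))
    refine ShortComplex.ShortExact.mk' ?_ inferInstance this
    have hk := ShortComplex.exact_of_f_is_kernel
      (ShortComplex.mk (L.iCycles (n + 1)) (L.d (n + 1) n) (by simp)) (L.cyclesIsKernel (n + 1) n (by simp))
    let φ : ShortComplex.mk (L.iCycles (n + 1)) (toShiftBd L (n + 1)) (iCycles_toShiftBd L (n + 1)) ⟶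
        ShortComplex.mk (L.iCycles (n + 1)) (L.d (n + 1) n) (by simp) :=
      { τ₁ := 𝟙 _
        τ₂ := 𝟙 _
        τ₃ := bdι L n ≫ L.iCycles n
        comm₂₃ := by
          change 𝟙 _ ≫ L.d (n + 1) n = toBd L n ≫ bdι L n ≫ L.iCycles n
          rw [reassoc_of% toBd_ι, L.toCycles_i, Category.id_comp] }
    have h1 : Epi φ.τ₁ := inferInstanceAs (Epi (𝟙 _))
    have h2 : IsIso φ.τ₂ := inferInstanceAs (IsIso (𝟙 _))
    have h3 : Mono φ.τ₃ := inferInstanceAs (Mono (bdι L n ≫ L.iCycles n))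
    exact (ShortComplex.exact_iff_of_epi_of_isIso_of_mono φ).2 hk

/-- The inclusion of the cycles, as a chain map. -/
def cyclesι : zeroDiff (cyc L) ⟶ L where
  f n := L.iCycles n
  comm' i j _ := (L.iCycles_d i j).trans zero_comp.symm

/-- The chain map to the shifted boundaries. -/
def shiftBdπ : L ⟶ zeroDiff (shiftObj (bd L)) where
  f n := toShiftBd L n
  comm' i j hij := by
    obtain rfl : j + 1 = i := hij
    exact comp_zero.trans (d_toShiftBd L j).symm

/-- The short exact sequence of the cycles and the boundaries of a chain complex. -/
abbrev cyclesSequence : ShortComplex (ChainComplex (ModuleCat.{u} R) ℕ) :=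
  ShortComplex.mk (cyclesι L) (shiftBdπ L) (by ext n : 1; exact iCycles_toShiftBd L n)

lemma cyclesSequence_shortExact : (cyclesSequence L).ShortExact :=
  HomologicalComplex.shortExact_of_degreewise_shortExact _ (cyclesSequence_shortExact_eval L)

lemma cyclesι_naturality :
    zeroDiffMap (fun n => HomologicalComplex.cyclesMap f n) ≫ cyclesι L' = cyclesι L ≫ f := by
  ext n : 1
  exact HomologicalComplex.cyclesMap_i f n

lemma shiftBdπ_naturality :
    f ≫ shiftBdπ L' = shiftBdπ L ≫ zeroDiffMap (shiftMap (bdMap f)) := by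
  ext n : 1
  cases n with
  | zero => exact (isZero_shiftObj_zero (bd L')).eq_of_tgt _ _
  | succ n => exact toBd_naturality f n

/-- The component of the chain map from the cone of `n ↦ L.X (n + 1)` to `L`. -/
def coneToX : ∀ n, shiftObj (tail L.X) n ⟶ L.X n
  | 0 => 0
  | _ + 1 => 𝟙 _

/-- The chain map from the cone of `n ↦ L.X (n + 1)` to `L`. -/
def coneTo : cone (tail L.X) ⟶ L :=
  coneDesc (tail L.X) L (fun n => L.d (n + 1) n) (coneToX L)
    (fun _ => (Category.id_comp _).trans (Category.id_comp _).symm) (fun _ => L.d_comp_d _ _ _)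

lemma coneInl_coneTo :
    coneInl (tail L.X) ≫ coneTo L = zeroDiffMap (fun n => L.toCycles (n + 1) n) ≫ cyclesι L := by
  ext n : 1
  refine Eq.trans ?_ (L.toCycles_i (n + 1) n).symm
  rw [HomologicalComplex.comp_f, coneInl_f]
  simp [coneTo, coneDesc]

lemma coneTo_shiftBdπ :
    coneTo L ≫ shiftBdπ L = coneSnd (tail L.X) ≫ zeroDiffMap (shiftMap (toBd L)) := by
  ext n : 1
  have h : biprod.desc (L.d (n + 1) n) (coneToX L n) ≫ toShiftBd L n =
      biprod.snd ≫ shiftMap (toBd L) n := by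
    refine biprod.hom_ext' _ _ ?_ ?_
    · simp [d_toShiftBd]
    · rw [biprod.inr_desc_assoc, biprod.inr_snd_assoc]
      cases n with
      | zero => exact (isZero_shiftObj_zero (bd L)).eq_of_tgt _ _
      | succ n => exact Category.id_comp _
  rw [HomologicalComplex.comp_f, HomologicalComplex.comp_f, coneSnd_f]
  refine (Category.assoc _ _ _).trans (Eq.trans ?_ (Category.assoc _ _ _).symm)
  exact congrArg (fun k => (coneXIso (tail L.X) n).hom ≫ k) h

/-- The comparison of the sequence of the cone with the sequence of cycles and boundaries. -/
def coneSequenceTo : coneSequence (tail L.X) ⟶ cyclesSequence L where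
  τ₁ := zeroDiffMap fun n => L.toCycles (n + 1) n
  τ₂ := coneTo L
  τ₃ := zeroDiffMap (shiftMap (toBd L))
  comm₁₂ := (coneInl_coneTo L).symm
  comm₂₃ := coneTo_shiftBdπ L

variable [IsDomain R] [IsPrincipalIdealRing R]

/-- Torsion-freeness, which is flatness over a principal ideal domain, passes to submodules. -/
lemma flat_of_mono {X Y : ModuleCat.{u} R} (f : X ⟶ Y) [Mono f] [Module.Flat R Y] :
    Module.Flat R X := by
  have : Module.IsTorsionFree R X := ⟨fun r hr x y h => by
    have hf := (ModuleCat.mono_iff_injective f).1 ‹_›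
    apply hf
    apply hr.isSMulRegular (M := Y)
    simpa using congrArg f.hom h⟩
  infer_instance

instance flat_cyc [∀ n, Module.Flat R (L.X n)] (n : ℕ) : Module.Flat R (cyc L n) :=
  flat_of_mono (L.iCycles n)

instance flat_bd [∀ n, Module.Flat R (L.X n)] (n : ℕ) : Module.Flat R (bd L n) :=
  flat_of_mono (bdι L n)

variable (B : SimplicialObject (ModuleCat.{u} R)) (q : ℕ)

/-- The graded Künneth decomposition turns the map into a sum of maps `f i ⊗ 𝟙`, and tensor products
are right exact. -/
lemma epi_tensorHomology_map {M M' : ℕ → ModuleCat.{u} R} [∀ n, Module.Flat R (M n)]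
    [∀ n, Module.Flat R (M' n)] (f : ∀ n, M n ⟶ M' n) [∀ n, Epi (f n)] :
    Epi ((tensorHomology q B).map (zeroDiffMap f)) := by
  have h : Limits.Sigma.map (fun i => f i ▷ (complementaryHomology q i).obj B) ≫
      (gradedKunneth B q M').hom =
        (gradedKunneth B q M).hom ≫ (tensorHomology q B).map (zeroDiffMap f) :=
    Sigma.hom_ext _ _ fun i => by simp [gradedKunneth, gradedι_naturality]
  have (i : ℕ) : Epi (f i ▷ (complementaryHomology q i).obj B) :=
    epi_whiskerRight (f i) _
  have : Epi ((gradedKunneth B q M).hom ≫ (tensorHomology q B).map (zeroDiffMap f)) := by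
    rw [← h]
    infer_instance
  exact epi_of_epi (gradedKunneth B q M).hom _

instance (M : ℕ → ModuleCat.{u} R) [∀ n, Module.Flat R (M n)] (n : ℕ) :
    Module.Flat R (shiftObj M n) := flat_shiftObj M inferInstance n

variable [∀ n, Module.Flat R (L.X n)]

/-- The sequence of the cone of `n ↦ L.X (n + 1)`, whose connecting map is by definition a
suspension isomorphism, maps to the sequence of cycles and boundaries. On third terms this is the
shift of the surjection onto the boundaries, which stays an epimorphism on homology and can be
cancelled. Naturality of both connecting maps then forces the formula. -/
lemma tensorδ_cyclesSequence :
    tensorδ B (cyclesSequence_shortExact L) inferInstance q =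
      (suspension (bd L) B q inferInstance).hom ≫
        (tensorHomology q B).map (zeroDiffMap (bdι L)) := by
  have h1 := tensorδ_naturality B (coneSequence_shortExact (tail L.X)) inferInstance q
    (cyclesSequence_shortExact L) inferInstance (coneSequenceTo L)
  have h2 := suspension_naturality (M := tail L.X) (toBd L) B q inferInstance inferInstance
  have h3 : zeroDiffMap (toBd L) ≫ zeroDiffMap (bdι L) =
      zeroDiffMap fun n => L.toCycles (n + 1) n := by
    ext n : 1
    exact toBd_ι L n
  have h4 := congrArg (fun k => (tensorHomology q B).map k) h3
  simp only [Functor.map_comp] at h4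
  have h5 (n : ℕ) : Epi (shiftMap (toBd L) n) := by
    cases n with
    | zero => exact inferInstanceAs (Epi (𝟙 _))
    | succ n => exact inferInstanceAs (Epi (toBd L n))
  have h6 := epi_tensorHomology_map B (q + 1) (shiftMap (toBd L))
  rw [← cancel_epi ((tensorHomology (q + 1) B).map (zeroDiffMap (shiftMap (toBd L))))]
  refine h1.trans (Eq.trans ?_ ((congrArg (fun k => k ≫
    (tensorHomology q B).map (zeroDiffMap (bdι L))) h2.symm).trans (Category.assoc _ _ _)))
  exact (congrArg (fun k => _ ≫ k) h4.symm).trans (Category.assoc _ _ _).symm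

lemma exact_cyclesι : ∃ w, (ShortComplex.mk ((tensorHomology q B).map (zeroDiffMap (bdι L)))
    ((tensorHomology q B).map (cyclesι L)) w).Exact :=
  exact_of_isos (tensorδ_exact₁ B (cyclesSequence_shortExact L) inferInstance q)
    (suspension (bd L) B q inferInstance) (Iso.refl _) (Iso.refl _)
    ((Category.comp_id _).trans (tensorδ_cyclesSequence L B q))
    ((Category.comp_id _).trans (Category.id_comp _).symm)

/-- In positive degrees this is the long exact sequence, with suspension turning the connecting map
into the shifted inclusion of boundaries. In degree zero there is no connecting map, but the shifted
boundaries have no homology there. -/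
lemma exact_shiftBdπ : ∃ w, (ShortComplex.mk ((tensorHomology q B).map (shiftBdπ L))
    ((tensorHomology q B).map (zeroDiffMap (shiftMap (bdι L)))) w).Exact := by
  cases q with
  | zero =>
    have hz : IsZero ((tensorHomology 0 B).obj (zeroDiff (shiftObj (bd L)))) := by
      rw [IsZero.iff_id_eq_zero, ← CategoryTheory.Functor.map_id]
      refine tensorHomology_map_eq_zero B _ 0 fun n hn => ?_
      obtain rfl : n = 0 := by omega
      exact (isZero_shiftObj_zero (bd L)).eq_of_src _ _
    have h : (tensorHomology 0 B).map (shiftBdπ L) = 0 := hz.eq_zero_of_tgt _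
    exact ⟨by rw [h, zero_comp], ShortComplex.exact_of_isZero_X₂ _ hz⟩
  | succ q =>
    have h := (tensorδ_cyclesSequence L B q).trans
      (suspension_naturality (bdι L) B q inferInstance inferInstance).symm
    rw [← Iso.comp_inv_eq] at h
    exact exact_of_isos (tensorδ_exact₃ B (cyclesSequence_shortExact L) inferInstance q)
      (Iso.refl _) (Iso.refl _) (suspension (cyc L) B q inferInstance).symm
      ((Category.comp_id _).trans (Category.id_comp _).symm) (h.trans (Category.id_comp _).symm)

end Cycles

end VietorisRips

end

/-! ### The Künneth sequence for a degreewise flat chain complex -/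

noncomputable section

namespace VietorisRips

variable {R : Type u} [CommRing R]

section ComplexKunneth

lemma exact_whiskerRight {S : ShortComplex (ModuleCat.{u} R)} (hS : S.ShortExact)
    (N : ModuleCat.{u} R) : (S.map (tensorRight N)).Exact := by
  rw [ShortComplex.ShortExact.moduleCat_exact_iff_function_exact]
  exact rTensor_exact N ((ShortComplex.ShortExact.moduleCat_exact_iff_function_exact _).1 hS.exact)
    hS.moduleCat_surjective_g

/-- The maps `a`, `c`, `e`, `s` form an exact sequence through `W`. Here `b` exhibits `H` as the
cokernel of `a`, hence as the image of `c`, and `t` exhibits `U` as the kernel of `s`, hence as the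
image of `e`. -/
lemma shortExact_of_exact_pieces {A Z H W Y U V : ModuleCat.{u} R} {a : A ⟶ Z} {b : Z ⟶ H}
    {c : Z ⟶ W} {d : H ⟶ W} {e : W ⟶ Y} {g : W ⟶ U} {t : U ⟶ Y} {s : Y ⟶ V}
    {wab : a ≫ b = 0} {wac : a ≫ c = 0} {wce : c ≫ e = 0} {wes : e ≫ s = 0} {wts : t ≫ s = 0}
    (hab : (ShortComplex.mk a b wab).Exact) [Epi b] (hac : (ShortComplex.mk a c wac).Exact)
    (hd : b ≫ d = c) (hce : (ShortComplex.mk c e wce).Exact)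
    (hes : (ShortComplex.mk e s wes).Exact) (hts : (ShortComplex.mk t s wts).Exact) [Mono t]
    (hg : g ≫ t = e) : ∃ w, (ShortComplex.mk d g w).ShortExact := by
  have w : d ≫ g = 0 := by
    rw [← cancel_epi b, ← cancel_mono t, Category.assoc, Category.assoc, hg, reassoc_of% hd, wce]
    simp
  refine ⟨w, ?_⟩
  rw [ShortComplex.ShortExact.moduleCat_exact_iff_function_exact] at hab hac hce hes hts
  have hb := (ModuleCat.epi_iff_surjective b).1 inferInstance
  have ht := (ModuleCat.mono_iff_injective t).1 inferInstance
  have hd' (z) : d (b z) = c z := congrArg (fun k => k.hom z) hd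
  have hg' (x) : t (g x) = e x := congrArg (fun k => k.hom x) hg
  refine ModuleCat.shortComplex_shortExact _ ?_ ?_ ?_
  · intro x
    constructor
    · intro hx
      obtain ⟨z, rfl⟩ := (hce x).1 ((hg' x).symm.trans ((congrArg t hx).trans (map_zero t.hom)))
      exact ⟨b z, hd' z⟩
    · rintro ⟨h, rfl⟩
      exact congrArg (fun k => k.hom h) w
  · refine (injective_iff_map_eq_zero d.hom).2 fun h hh => ?_
    obtain ⟨z, rfl⟩ := hb h
    exact (hab z).2 ((hac z).1 ((hd' z).symm.trans hh))
  · intro x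
    obtain ⟨y, hy⟩ := (hes (t x)).1 ((hts (t x)).2 ⟨x, rfl⟩)
    exact ⟨y, ht ((hg' y).trans hy)⟩

variable (L : ChainComplex (ModuleCat.{u} R) ℕ) {L' : ChainComplex (ModuleCat.{u} R) ℕ}
  (f : L ⟶ L')

/-- The shift of the short exact sequences defining homology. -/
abbrev shiftBdSequence (n : ℕ) : ShortComplex (ModuleCat.{u} R) :=
  ShortComplex.mk (shiftMap (bdι L) n) (shiftMap (fun i => L.homologyπ i) n) (by
    cases n with
    | zero => exact (isZero_shiftObj_zero (bd L)).eq_of_src _ _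
    | succ n => exact bdι_homologyπ L n)

lemma shiftBdSequence_shortExact (n : ℕ) : (shiftBdSequence L n).ShortExact := by
  cases n with
  | zero =>
    exact ShortComplex.ShortExact.mk'
      (ShortComplex.exact_of_isZero_X₂ _ (isZero_shiftObj_zero (cyc L)))
      (inferInstanceAs (Mono (𝟙 _))) (inferInstanceAs (Epi (𝟙 _)))
  | succ n => exact bdSequence_shortExact L n

variable {L} in
/-- The functoriality of the shifted short exact sequences defining homology. -/
def shiftBdSequenceMap (n : ℕ) : shiftBdSequence L n ⟶ shiftBdSequence L' n where
  τ₁ := shiftMap (bdMap f) n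
  τ₂ := shiftMap (fun i => HomologicalComplex.cyclesMap f i) n
  τ₃ := shiftMap (fun i => HomologicalComplex.homologyMap f i) n
  comm₁₂ := by
    cases n with
    | zero => rfl
    | succ n => exact bdMap_ι f n
  comm₂₃ := by
    cases n with
    | zero => rfl
    | succ n => exact (HomologicalComplex.homologyπ_naturality f n).symm

variable (B : SimplicialObject (ModuleCat.{u} R)) (q : ℕ)

/-- The source of the Künneth sequence for `Γ(L) ⊗ B`. -/
abbrev kunnethTensor : ModuleCat.{u} R :=
  ∐ fun i => L.homology i ⊗ (complementaryHomology q i).obj B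

/-- The target of the Künneth sequence for `Γ(L) ⊗ B`. -/
abbrev kunnethTor : ModuleCat.{u} R :=
  ∐ fun i => ((Tor (ModuleCat.{u} R) 1).obj (shiftObj (fun i => L.homology i) i)).obj
    ((complementaryHomology q i).obj B)

variable [IsDomain R] [IsPrincipalIdealRing R] [∀ n, Module.Flat R (L.X n)]
  [∀ n, Module.Flat R (L'.X n)]

lemma gradedKunneth_naturality {M M' : ℕ → ModuleCat.{u} R} [∀ n, Module.Flat R (M n)]
    [∀ n, Module.Flat R (M' n)] (f : ∀ n, M n ⟶ M' n) :
    Limits.Sigma.map (fun i => f i ▷ (complementaryHomology q i).obj B) ≫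
      (gradedKunneth B q M').hom =
        (gradedKunneth B q M).hom ≫ (tensorHomology q B).map (zeroDiffMap f) :=
  Sigma.hom_ext _ _ fun i => by simp [gradedKunneth, gradedι_naturality]

lemma gradedKunneth_naturality_right (M : ℕ → ModuleCat.{u} R) [∀ n, Module.Flat R (M n)]
    {B B' : SimplicialObject (ModuleCat.{u} R)} (β : B ⟶ B') :
    Limits.Sigma.map (fun i => M i ◁ (complementaryHomology q i).map β) ≫
      (gradedKunneth B' q M).hom =
        (gradedKunneth B q M).hom ≫ tensorHomologyMap q β _ :=
  Sigma.hom_ext _ _ fun i => by simp [gradedKunneth, gradedι_naturality_right]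

/-- The map from the homology of the cycles to the sum of tensor products. -/
def cyclesToTensor : (tensorHomology q B).obj (zeroDiff (cyc L)) ⟶ kunnethTensor L B q :=
  (gradedKunneth B q (cyc L)).inv ≫
    Limits.Sigma.map fun i => L.homologyπ i ▷ (complementaryHomology q i).obj B

instance : Epi (cyclesToTensor L B q) := by
  have (i : ℕ) : Epi (L.homologyπ i ▷ (complementaryHomology q i).obj B) := epi_whiskerRight _ _
  unfold cyclesToTensor
  infer_instance

lemma exact_cyclesToTensor :
    ∃ w, (ShortComplex.mk ((tensorHomology q B).map (zeroDiffMap (bdι L)))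
      (cyclesToTensor L B q) w).Exact := by
  have h := exact_sigmaMap
    (fun i => (bdSequence L i).map (tensorRight ((complementaryHomology q i).obj B)))
    fun i => exact_whiskerRight (bdSequence_shortExact L i) _
  exact exact_of_isos h (gradedKunneth B q (bd L)) (gradedKunneth B q (cyc L)) (Iso.refl _)
    (gradedKunneth_naturality B q (bdι L))
    ((Category.comp_id _).trans ((gradedKunneth B q (cyc L)).hom_inv_id_assoc _).symm)

/-- The map from the sum of torsion products to the homology of the shifted boundaries. -/
def torToShiftBd : kunnethTor L B q ⟶ (tensorHomology q B).obj (zeroDiff (shiftObj (bd L))) :=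
  Limits.Sigma.map (fun i => torδ (shiftBdSequence_shortExact L i)
    ((complementaryHomology q i).obj B)) ≫ (gradedKunneth B q (shiftObj (bd L))).hom

instance : Mono (torToShiftBd L B q) := by
  -- The middle terms are shifted cycles, which are flat, so their `Tor₁` vanishes.
  have (i : ℕ) : Mono (torδ (shiftBdSequence_shortExact L i)
    ((complementaryHomology q i).obj B)) := torδ_mono _ _
      (inferInstanceAs (Module.Flat R (shiftObj (cyc L) i)))
  unfold torToShiftBd
  infer_instance

lemma exact_torToShiftBd :
    ∃ w, (ShortComplex.mk (torToShiftBd L B q)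
      ((tensorHomology q B).map (zeroDiffMap (shiftMap (bdι L)))) w).Exact := by
  have h := exact_sigmaMap
    (fun i => ShortComplex.mk (torδ (shiftBdSequence_shortExact L i)
      ((complementaryHomology q i).obj B)) _ (torδ_comp _ _)) fun i => torδ_exact _ _
  exact exact_of_isos h (Iso.refl _) (gradedKunneth B q (shiftObj (bd L)))
    (gradedKunneth B q (shiftObj (cyc L))) (Category.id_comp _).symm
    (gradedKunneth_naturality B q (shiftMap (bdι L)))

/-- The first map of the Künneth sequence for `Γ(L) ⊗ B`. -/
def kunnethι : kunnethTensor L B q ⟶ (tensorHomology q B).obj L :=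
  (exact_cyclesToTensor L B q).choose_spec.desc ((tensorHomology q B).map (cyclesι L))
    (exact_cyclesι L B q).choose

lemma cyclesToTensor_kunnethι :
    cyclesToTensor L B q ≫ kunnethι L B q = (tensorHomology q B).map (cyclesι L) :=
  (exact_cyclesToTensor L B q).choose_spec.g_desc _ _

/-- The second map of the Künneth sequence for `Γ(L) ⊗ B`. -/
def kunnethπ : (tensorHomology q B).obj L ⟶ kunnethTor L B q :=
  (exact_torToShiftBd L B q).choose_spec.lift ((tensorHomology q B).map (shiftBdπ L))
    (exact_shiftBdπ L B q).choose

lemma kunnethπ_torToShiftBd :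
    kunnethπ L B q ≫ torToShiftBd L B q = (tensorHomology q B).map (shiftBdπ L) :=
  (exact_torToShiftBd L B q).choose_spec.lift_f _ _

lemma kunneth_shortExact :
    ∃ w, (ShortComplex.mk (kunnethι L B q) (kunnethπ L B q) w).ShortExact :=
  shortExact_of_exact_pieces (exact_cyclesToTensor L B q).choose_spec
    (exact_cyclesι L B q).choose_spec (cyclesToTensor_kunnethι L B q)
    (tensorHomology_exact B (cyclesSequence_shortExact L) inferInstance q)
    (exact_shiftBdπ L B q).choose_spec (exact_torToShiftBd L B q).choose_spec
    (kunnethπ_torToShiftBd L B q)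

variable {L}

lemma cyclesToTensor_naturality :
    (tensorHomology q B).map (zeroDiffMap fun n => HomologicalComplex.cyclesMap f n) ≫
      cyclesToTensor L' B q = cyclesToTensor L B q ≫ Limits.Sigma.map (fun i =>
        HomologicalComplex.homologyMap f i ▷ (complementaryHomology q i).obj B) := by
  have hn := gradedKunneth_naturality B q
    (fun n => (HomologicalComplex.cyclesMap f n : cyc L n ⟶ cyc L' n))
  rw [← Iso.inv_comp_eq, ← Category.assoc, ← Iso.eq_comp_inv] at hn
  refine square_comp hn.symm (sigmaMap_square fun i => ?_)
  rw [← comp_whiskerRight, ← comp_whiskerRight, HomologicalComplex.homologyπ_naturality]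

/-- The map is determined by its composite with the epimorphism `cyclesToTensor`, so naturality
reduces to that of the inclusion of cycles. -/
lemma kunnethι_naturality :
    Limits.Sigma.map (fun i => HomologicalComplex.homologyMap f i ▷
      (complementaryHomology q i).obj B) ≫ kunnethι L' B q =
        kunnethι L B q ≫ (tensorHomology q B).map f := by
  rw [← cancel_epi (cyclesToTensor L B q), ← reassoc_of% cyclesToTensor_naturality f B q,
    cyclesToTensor_kunnethι, reassoc_of% cyclesToTensor_kunnethι, ← Functor.map_comp,
    ← Functor.map_comp, cyclesι_naturality]

lemma cyclesToTensor_naturality_right {B B' : SimplicialObject (ModuleCat.{u} R)} (β : B ⟶ B') :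
    tensorHomologyMap q β _ ≫ cyclesToTensor L B' q = cyclesToTensor L B q ≫
      Limits.Sigma.map (fun i => L.homology i ◁ (complementaryHomology q i).map β) := by
  have hn := gradedKunneth_naturality_right q (cyc L) β
  rw [← Iso.inv_comp_eq, ← Category.assoc, ← Iso.eq_comp_inv] at hn
  exact square_comp hn.symm (sigmaMap_square fun i => whisker_exchange _ _)

lemma kunnethι_naturality_right {B B' : SimplicialObject (ModuleCat.{u} R)} (β : B ⟶ B') :
    Limits.Sigma.map (fun i => L.homology i ◁ (complementaryHomology q i).map β) ≫
      kunnethι L B' q = kunnethι L B q ≫ tensorHomologyMap q β L := by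
  rw [← cancel_epi (cyclesToTensor L B q), ← reassoc_of% cyclesToTensor_naturality_right q β,
    cyclesToTensor_kunnethι, reassoc_of% cyclesToTensor_kunnethι, tensorHomologyMap_naturality]

lemma torToShiftBd_naturality :
    Limits.Sigma.map (fun i => ((Tor (ModuleCat.{u} R) 1).map
      (shiftMap (fun i => HomologicalComplex.homologyMap f i) i)).app
        ((complementaryHomology q i).obj B)) ≫ torToShiftBd L' B q =
    torToShiftBd L B q ≫ (tensorHomology q B).map (zeroDiffMap (shiftMap (bdMap f))) :=
  square_comp (sigmaMap_square fun i => torδ_naturality (shiftBdSequence_shortExact L i)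
    (shiftBdSequence_shortExact L' i) (shiftBdSequenceMap f i) _)
    (gradedKunneth_naturality B q (shiftMap (bdMap f)))

/-- Dual argument: the map is determined by its composite with the monomorphism `torToShiftBd`. -/
lemma kunnethπ_naturality :
    (tensorHomology q B).map f ≫ kunnethπ L' B q = kunnethπ L B q ≫
    Limits.Sigma.map (fun i => ((Tor (ModuleCat.{u} R) 1).map
      (shiftMap (fun i => HomologicalComplex.homologyMap f i) i)).app
        ((complementaryHomology q i).obj B)) := by
  rw [← cancel_mono (torToShiftBd L' B q), Category.assoc, Category.assoc,
    torToShiftBd_naturality, kunnethπ_torToShiftBd, reassoc_of% kunnethπ_torToShiftBd,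
    ← Functor.map_comp, ← Functor.map_comp, shiftBdπ_naturality]

lemma torToShiftBd_naturality_right {B B' : SimplicialObject (ModuleCat.{u} R)} (β : B ⟶ B') :
    Limits.Sigma.map (fun i => ((Tor (ModuleCat.{u} R) 1).obj
      (shiftObj (fun i => L.homology i) i)).map ((complementaryHomology q i).map β)) ≫
        torToShiftBd L B' q = torToShiftBd L B q ≫ tensorHomologyMap q β _ :=
  square_comp (sigmaMap_square fun i => torδ_map (shiftBdSequence_shortExact L i) _)
    (gradedKunneth_naturality_right q (shiftObj (bd L)) β)

lemma kunnethπ_naturality_right {B B' : SimplicialObject (ModuleCat.{u} R)} (β : B ⟶ B') :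
    tensorHomologyMap q β L ≫ kunnethπ L B' q = kunnethπ L B q ≫
    Limits.Sigma.map (fun i => ((Tor (ModuleCat.{u} R) 1).obj
      (shiftObj (fun i => L.homology i) i)).map ((complementaryHomology q i).map β)) := by
  rw [← cancel_mono (torToShiftBd L B' q), Category.assoc, Category.assoc,
    torToShiftBd_naturality_right, kunnethπ_torToShiftBd, reassoc_of% kunnethπ_torToShiftBd,
    tensorHomologyMap_naturality]

end ComplexKunneth

end VietorisRips

end

/-! ### A functorial levelwise flat resolution of a simplicial module -/

noncomputable section

namespace VietorisRips

variable {R : Type u} [CommRing R]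

section Resolution

open Simplicial Opposite AlgebraicTopology

variable {A A' A'' : SimplicialObject (ModuleCat.{u} R)}

/-- The functoriality of the module of tuples. -/
def tuplesNat (f : A ⟶ A') : tuples A ⟶ tuples A' where
  app n := tupleLift fun i => entry A n i ≫ f.app n
  naturality m _ θ := tuples_hom_ext fun i =>
    congrArg (fun k => entry A m (θ.unop.toOrderHom i) ≫ k) (f.naturality θ)

lemma tuplesNat_comp (f : A ⟶ A') (g : A' ⟶ A'') :
    tuplesNat f ≫ tuplesNat g = tuplesNat (f ≫ g) := rfl

lemma diagonal_tuplesNat (f : A ⟶ A') : diagonal A ≫ tuplesNat f = f ≫ diagonal A' := by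
  refine NatTrans.ext (F := A) (G := tuples A') (funext fun n => tuples_hom_ext fun i => ?_)
  exact (Category.id_comp (f.app n)).trans (Category.comp_id (f.app n)).symm

lemma shortExact_of_app {J : Type*} [Category* J] {S : ShortComplex (J ⥤ ModuleCat.{u} R)}
    (h : ∀ j, (S.map ((evaluation _ _).obj j)).ShortExact) : S.ShortExact where
  exact := by
    rw [ShortComplex.exact_iff_isZero_homology]
    exact Functor.isZero _ fun j =>
      ((ShortComplex.exact_iff_isZero_homology _).1 (h j).exact).of_iso
        (S.mapHomologyIso ((evaluation _ _).obj j)).symm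
  mono_f := by
    have (j : J) : Mono (S.f.app j) := (h j).mono_f
    exact NatTrans.mono_of_mono_app _
  epi_g := by
    have (j : J) : Epi (S.g.app j) := (h j).epi_g
    exact NatTrans.epi_of_epi_app _

lemma shortExact_app {J : Type*} [Category* J] {S : ShortComplex (J ⥤ ModuleCat.{u} R)}
    (h : S.ShortExact) (j : J) : (S.map ((evaluation _ _).obj j)).ShortExact :=
  h.map_of_exact _

lemma shortExact_tuplesNat {f : A ⟶ A'} {g : A' ⟶ A''} {w : f ≫ g = 0}
    (h : (ShortComplex.mk f g w).ShortExact) :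
    ∃ w, (ShortComplex.mk (tuplesNat f) (tuplesNat g) w).ShortExact := by
  have w' : tuplesNat f ≫ tuplesNat g = 0 := by
    rw [tuplesNat_comp, w]
    refine NatTrans.ext (F := tuples A) (G := tuples A'') (funext fun n => tuples_hom_ext fun i => ?_)
    exact (comp_zero : entry A n i ≫ (0 : A.obj n ⟶ A''.obj n) = 0).trans zero_comp.symm
  refine ⟨w', shortExact_of_app fun n => ?_⟩
  have hn := shortExact_app h n
  have hex := (ShortComplex.ShortExact.moduleCat_exact_iff_function_exact _).1 hn.exact
  refine ModuleCat.shortComplex_shortExact _ ?_ ?_ ?_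
  · intro x
    constructor
    · intro hx
      choose y hy using fun i => (hex (x i)).1 (congrFun hx i)
      exact ⟨y, funext hy⟩
    · rintro ⟨y, rfl⟩
      exact funext fun i => (hex _).2 ⟨y i, rfl⟩
  · exact fun x y hxy => funext fun i => hn.moduleCat_injective_f (congrFun hxy i)
  · intro x
    choose y hy using fun i => hn.moduleCat_surjective_g (x i)
    exact ⟨y, funext hy⟩

/-- The levelwise free simplicial module on the elements of a simplicial module. -/
def freeOn : SimplicialObject (ModuleCat.{u} R) ⥤ SimplicialObject (ModuleCat.{u} R) :=
  (Functor.whiskeringRight _ _ _).obj (forget _ ⋙ ModuleCat.free R)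

/-- The canonical surjection from the levelwise free simplicial module. -/
def freeOnπ : freeOn (R := R) ⟶ 𝟭 _ :=
  (Functor.whiskeringRight _ _ _).map (ModuleCat.adj R).counit

instance (A : SimplicialObject (ModuleCat.{u} R)) : Epi (freeOnπ.app A) := by
  have (n : SimplexCategoryᵒᵖ) : Epi ((freeOnπ.app A).app n) :=
    inferInstanceAs (Epi ((ModuleCat.adj R).counit.app (A.obj n)))
  exact NatTrans.epi_of_epi_app _

instance flat_freeOn (A : SimplicialObject (ModuleCat.{u} R)) (n : SimplexCategoryᵒᵖ) :
    Module.Flat R ((freeOn.obj A).obj n) :=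
  inferInstanceAs (Module.Flat R (A.obj n →₀ R))

variable (A)

/-- The kernel of the surjection from the levelwise free simplicial module. -/
abbrev relations : SimplicialObject (ModuleCat.{u} R) := kernel (freeOnπ.app A)

lemma freeOn_shortExact : (ShortComplex.mk (kernel.ι (freeOnπ.app A)) (freeOnπ.app A)
    (kernel.condition _)).ShortExact where
  exact := ShortComplex.exact_of_f_is_kernel _ (kernelIsKernel _)
  mono_f := inferInstanceAs (Mono (kernel.ι _))
  epi_g := inferInstanceAs (Epi (freeOnπ.app A))

/-- A levelwise flat simplicial module with a map to `A` whose kernel consists of tuples. -/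
def resolution : SimplicialObject (ModuleCat.{u} R) :=
  pullback (tuplesNat (freeOnπ.app A)) (diagonal A)

/-- The projection of the resolution to tuples in the free module. -/
def resolutionFst : resolution A ⟶ tuples (freeOn.obj A) := pullback.fst _ _

/-- The augmentation of the resolution. -/
def resolutionπ : resolution A ⟶ A := pullback.snd _ _

lemma resolution_condition :
    resolutionFst A ≫ tuplesNat (freeOnπ.app A) = resolutionπ A ≫ diagonal A := pullback.condition

variable {A} in
lemma resolution_hom_ext {X : SimplicialObject (ModuleCat.{u} R)} {f g : X ⟶ resolution A}
    (h₁ : f ≫ resolutionFst A = g ≫ resolutionFst A) (h₂ : f ≫ resolutionπ A = g ≫ resolutionπ A) :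
    f = g := pullback.hom_ext h₁ h₂

lemma diagonal_injective {X : SimplicialObject (ModuleCat.{u} R)} {f g : X ⟶ A}
    (h : f ≫ diagonal A = g ≫ diagonal A) : f = g := by
  refine NatTrans.ext (funext fun n => ?_)
  exact congrArg (fun k => k.app n ≫ entry A n 0) h

instance : Mono (diagonal A) := ⟨fun _ _ h => diagonal_injective A h⟩

instance : Mono (resolutionFst A) := inferInstanceAs (Mono (pullback.fst _ _))

variable {A}

/-- The functoriality of the resolution. -/
def resolutionMap (f : A ⟶ A') : resolution A ⟶ resolution A' :=
  pullback.lift (resolutionFst A ≫ tuplesNat (freeOn.map f)) (resolutionπ A ≫ f) (by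
    have h : freeOn.map f ≫ freeOnπ.app A' = freeOnπ.app A ≫ f := freeOnπ.naturality f
    rw [Category.assoc, Category.assoc, ← diagonal_tuplesNat, tuplesNat_comp, h,
      ← tuplesNat_comp, reassoc_of% resolution_condition])

lemma resolutionMap_π (f : A ⟶ A') :
    resolutionMap f ≫ resolutionπ A' = resolutionπ A ≫ f := pullback.lift_snd _ _ _

/-- Base change along the diagonal preserves the kernel of `tuplesNat (freeOnπ.app A)`, which is the
module of tuples of relations, and it preserves epimorphisms because the category is abelian. -/
lemma resolution_shortExact (A : SimplicialObject (ModuleCat.{u} R)) :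
    ∃ (i : tuples (relations A) ⟶ resolution A) (w : i ≫ resolutionπ A = 0),
      (ShortComplex.mk i (resolutionπ A) w).ShortExact := by
  obtain ⟨w, h⟩ := shortExact_tuplesNat (freeOn_shortExact A)
  have := h.mono_f
  have := h.epi_g
  have w' : tuplesNat (kernel.ι (freeOnπ.app A)) ≫ tuplesNat (freeOnπ.app A) =
    0 ≫ diagonal A := w.trans zero_comp.symm
  let i : tuples (relations A) ⟶ resolution A := pullback.lift _ _ w'
  have hi : i ≫ resolutionFst A = tuplesNat (kernel.ι (freeOnπ.app A)) := pullback.lift_fst _ _ _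
  have hi' : i ≫ resolutionπ A = 0 := pullback.lift_snd _ _ _
  refine ⟨i, hi', ?_⟩
  have h1 : Mono i := by
    have : Mono (i ≫ resolutionFst A) := by
      rw [hi]
      exact ‹Mono (tuplesNat _)›
    exact mono_of_mono i (resolutionFst A)
  have h2 : Epi (resolutionπ A) := inferInstanceAs (Epi (pullback.snd _ _))
  refine ShortComplex.ShortExact.mk' ?_ h1 h2
  rw [ShortComplex.exact_iff_exact_up_to_refinements]
  intro X x hx
  have hx' : x ≫ resolutionπ A = 0 := hx
  have hx1 : (x ≫ resolutionFst A) ≫ tuplesNat (freeOnπ.app A) = 0 := by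
    rw [Category.assoc, resolution_condition, reassoc_of% hx', zero_comp]
  refine ⟨X, 𝟙 X, inferInstance, h.exact.lift _ hx1, resolution_hom_ext ?_ ?_⟩
  · have := h.exact.lift_f _ hx1
    refine (congrArg (fun k => k ≫ resolutionFst A) (Category.id_comp x)).trans (this.symm.trans ?_)
    exact (congrArg (fun k => h.exact.lift _ hx1 ≫ k) hi.symm).trans (Category.assoc _ _ _).symm
  · refine (congrArg (fun k => k ≫ resolutionπ A) (Category.id_comp x)).trans (hx'.trans ?_)
    exact (((Category.assoc _ _ _).trans (congrArg (fun k => h.exact.lift _ hx1 ≫ k) hi')).trans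
      comp_zero).symm

/-- Each level embeds in a finite power of a free module. -/
lemma flat_resolution [IsDomain R] [IsPrincipalIdealRing R]
    (A : SimplicialObject (ModuleCat.{u} R)) (n : SimplexCategoryᵒᵖ) :
    Module.Flat R ((resolution A).obj n) := by
  have : Module.Flat R ((tuples (freeOn.obj A)).obj n) :=
    inferInstanceAs (Module.Flat R (Fin (n.unop.len + 1) → (freeOn.obj A).obj n))
  exact flat_of_mono ((resolutionFst A).app n)

lemma isIso_simplicialHomology_map {S : ShortComplex (SimplicialObject (ModuleCat.{u} R))}
    (hS : S.ShortExact) (h : ∀ q, IsZero ((simplicialHomology q).obj S.X₁)) (q : ℕ) :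
    IsIso ((simplicialHomology q).map S.g) := by
  let K := alternatingFaceMapComplex (ModuleCat.{u} R)
  have hT : (S.map K).ShortExact := HomologicalComplex.shortExact_of_degreewise_shortExact _
    fun n => shortExact_app hS (op ⦋n⦌)
  have : Mono ((simplicialHomology q).map S.g) :=
    (hT.homology_exact₂ q).mono_g ((h q).eq_of_src _ _)
  have : Epi ((simplicialHomology q).map S.g) := by
    cases q with
    -- No further term of the long exact sequence is available in degree zero; there surjectivity on
    -- chains suffices.
    | zero =>
      have := hT.epi_g
      exact HomologicalComplex.epi_homologyMap_of_epi_of_not_rel (S.map K).g 0 (by simp)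
    | succ q => exact (hT.homology_exact₃ (q + 1) q rfl).epi_f ((h q).eq_of_tgt _ _)
  exact isIso_of_mono_of_epi _

lemma isIso_simplicialHomology_resolutionπ (A : SimplicialObject (ModuleCat.{u} R)) (q : ℕ) :
    IsIso ((simplicialHomology q).map (resolutionπ A)) := by
  obtain ⟨i, w, h⟩ := resolution_shortExact A
  refine isIso_simplicialHomology_map h (fun q => ?_) q
  -- Acyclicity of plain tuples is the case where the second factor is the tensor unit.
  exact (isZero_simplicialHomology_tuples_tensor (relations A) (𝟙_ _) q).of_iso
    ((simplicialHomology q).mapIso (ρ_ (tuples (relations A))).symm)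

/-- The vanishing of `Tor₁` serves only to keep the resolution sequence exact after tensoring; the
kernel, being tuples tensored with `B`, is acyclic in any case. -/
lemma isIso_simplicialHomology_resolutionπ_whiskerRight (A B : SimplicialObject (ModuleCat.{u} R))
    (hAB : ∀ n, IsZero (((Tor (ModuleCat.{u} R) 1).obj (A.obj n)).obj (B.obj n))) (q : ℕ) :
    IsIso ((simplicialHomology q).map (resolutionπ A ▷ B)) := by
  obtain ⟨i, w, h⟩ := resolution_shortExact A
  have hB : ((ShortComplex.mk i (resolutionπ A) w).map (tensorRight B)).ShortExact :=
    shortExact_of_app fun n =>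
      shortExact_whiskerRight_of_isZero_tor (Y := B.obj n) (shortExact_app h n) (hAB n)
  exact isIso_simplicialHomology_map hB
    (fun q => isZero_simplicialHomology_tuples_tensor (relations A) B q) q

end Resolution

end VietorisRips

end

/-! ### The Künneth sequence for simplicial modules -/

noncomputable section

namespace VietorisRips

variable {R : Type u} [CommRing R]

/-- The homology in degree `i - 1`, which is zero for `i = 0`. -/
def shiftedHomology : ℕ → SimplicialObject (ModuleCat.{u} R) ⥤ ModuleCat.{u} R
  | 0 => (Functor.const _).obj (ModuleCat.of R PUnit.{u + 1})
  | i + 1 => simplicialHomology i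

section SimplicialKunneth

open Simplicial Opposite AlgebraicTopology

variable {A A' : SimplicialObject (ModuleCat.{u} R)}

/-- The normalized chains of the resolution of a simplicial module. -/
def resolutionChains (A : SimplicialObject (ModuleCat.{u} R)) : ChainComplex (ModuleCat.{u} R) ℕ :=
  (doldKan R).functor.obj (resolution A)

/-- The functoriality of `resolutionChains`. -/
def resolutionChainsMap (f : A ⟶ A') : resolutionChains A ⟶ resolutionChains A' :=
  (doldKan R).functor.map (resolutionMap f)

instance [IsDomain R] [IsPrincipalIdealRing R] (A : SimplicialObject (ModuleCat.{u} R)) (n : ℕ) :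
    Module.Flat R ((resolutionChains A).X n) :=
  have := flat_resolution A (op ⦋n⦌)
  flat_of_mono (X := ((doldKan R).functor.obj (resolution A)).X n)
    (mooreInclusion (resolution A) n)

/-- The comparison of the homology of `resolutionChains A` with the homology of `A`. -/
def homologyComparison (A : SimplicialObject (ModuleCat.{u} R)) (i : ℕ) :
    (resolutionChains A).homology i ⟶ (simplicialHomology i).obj A :=
  HomologicalComplex.homologyMap (inclusionOfMooreComplexMap (resolution A)) i ≫
    (simplicialHomology i).map (resolutionπ A)

instance (A : SimplicialObject (ModuleCat.{u} R)) (i : ℕ) : IsIso (homologyComparison A i) := by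
  -- Normalized chains are homotopy equivalent to all chains.
  have h1 : IsIso (HomologicalComplex.homologyMap (inclusionOfMooreComplexMap (resolution A)) i) :=
    ((DoldKan.homotopyEquivNormalizedMooreComplexAlternatingFaceMapComplex
      (Y := resolution A)).toHomologyIso i).isIso_hom
  have h2 := isIso_simplicialHomology_resolutionπ A i
  exact IsIso.comp_isIso' h1 h2

lemma homologyComparison_naturality (f : A ⟶ A') (i : ℕ) :
    HomologicalComplex.homologyMap (resolutionChainsMap f) i ≫ homologyComparison A' i =
      homologyComparison A i ≫ (simplicialHomology i).map f := by
  have h1 := congrArg (fun k => HomologicalComplex.homologyMap k i)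
    ((inclusionOfMooreComplex (ModuleCat.{u} R)).naturality (resolutionMap f))
  have h2 := congrArg (fun k => (simplicialHomology i).map k) (resolutionMap_π f)
  simp only [HomologicalComplex.homologyMap_comp, Functor.map_comp] at h1 h2
  exact square_comp h1 h2

/-- The shift of the comparison of homology. -/
def shiftedComparison (A : SimplicialObject (ModuleCat.{u} R)) (i : ℕ) :
    shiftObj (fun i => (resolutionChains A).homology i) i ⟶ (shiftedHomology i).obj A :=
  match i with
  | 0 => 𝟙 (ModuleCat.of R PUnit.{u + 1})
  | i + 1 => homologyComparison A i

instance (A : SimplicialObject (ModuleCat.{u} R)) (i : ℕ) : IsIso (shiftedComparison A i) := by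
  cases i with
  | zero => exact inferInstanceAs (IsIso (𝟙 (ModuleCat.of R PUnit.{u + 1})))
  | succ i => exact inferInstanceAs (IsIso (homologyComparison A i))

lemma shiftedComparison_naturality (f : A ⟶ A') (i : ℕ) :
    shiftMap (fun i => HomologicalComplex.homologyMap (resolutionChainsMap f) i) i ≫
        shiftedComparison A' i =
      shiftedComparison A i ≫ (shiftedHomology i).map f := by
  cases i with
  | zero => rfl
  | succ i => exact homologyComparison_naturality f i

/-- The map from the simplicial module of `resolutionChains A` to `A`. -/
def augmentationMap (A : SimplicialObject (ModuleCat.{u} R)) :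
    (doldKan R).inverse.obj (resolutionChains A) ⟶ A :=
  (doldKan R).unitIso.inv.app (resolution A) ≫ resolutionπ A

lemma augmentationMap_naturality (f : A ⟶ A') :
    (doldKan R).inverse.map (resolutionChainsMap f) ≫ augmentationMap A' =
      augmentationMap A ≫ f :=
  square_comp ((doldKan R).unitIso.inv.naturality (resolutionMap f)) (resolutionMap_π f)

variable (A) in
/-- The comparison of `Γ(resolutionChains A) ⊗ B` with `A ⊗ B`. -/
def tensorComparison (B : SimplicialObject (ModuleCat.{u} R)) (q : ℕ) :
    (tensorHomology q B).obj (resolutionChains A) ⟶ (simplicialHomology q).obj (A ⊗ B) :=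
  (simplicialHomology q).map (augmentationMap A ▷ B)

lemma isIso_tensorComparison (A B : SimplicialObject (ModuleCat.{u} R)) (q : ℕ)
    (h : ∀ n, IsZero (((Tor (ModuleCat.{u} R) 1).obj (A.obj n)).obj (B.obj n))) :
    IsIso (tensorComparison A B q) := by
  have h1 := isIso_simplicialHomology_resolutionπ_whiskerRight A B h q
  have h2 : tensorComparison A B q =
      (simplicialHomology q).map ((doldKan R).unitIso.inv.app (resolution A) ▷ B) ≫
        (simplicialHomology q).map (resolutionπ A ▷ B) := by
    rw [← Functor.map_comp, ← comp_whiskerRight]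
    rfl
  have h3 : IsIso ((simplicialHomology q).map
      ((doldKan R).unitIso.inv.app (resolution A) ▷ B)) :=
    ((simplicialHomology q).mapIso
      ((tensorRight B).mapIso ((doldKan R).unitIso.symm.app (resolution A)))).isIso_hom
  rw [h2]
  exact IsIso.comp_isIso' h3 h1

variable {B B' : SimplicialObject (ModuleCat.{u} R)} (f : A ⟶ A') (β : B ⟶ B') (q : ℕ)

lemma tensorComparison_naturality :
    ((tensorHomology q B).map (resolutionChainsMap f) ≫ tensorHomologyMap q β _) ≫
        tensorComparison A' B' q =
      tensorComparison A B q ≫ (simplicialHomology q).map (f ⊗ₘ β) := by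
  have h := congrArg (fun k => (simplicialHomology q).map (k ▷ B)) (augmentationMap_naturality f)
  have h' := congrArg (fun k => (simplicialHomology q).map k)
    (whisker_exchange (augmentationMap A') β)
  simp only [Functor.map_comp, comp_whiskerRight] at h h'
  rw [MonoidalCategory.tensorHom_def, Functor.map_comp]
  exact (square_comp h.symm h'.symm).symm

variable [IsDomain R] [IsPrincipalIdealRing R]

variable (A B) in
/-- The first map of the Künneth sequence for simplicial modules. -/
def simplicialKunnethι :
    (∐ fun i => (simplicialHomology i).obj A ⊗ (complementaryHomology q i).obj B) ⟶
      (simplicialHomology q).obj (A ⊗ B) :=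
  Limits.Sigma.map (fun i => inv (homologyComparison A i) ▷ (complementaryHomology q i).obj B) ≫
    kunnethι (resolutionChains A) B q ≫ tensorComparison A B q

variable (A B) in
/-- The second map of the Künneth sequence for simplicial modules. -/
def simplicialKunnethπ [IsIso (tensorComparison A B q)] :
    (simplicialHomology q).obj (A ⊗ B) ⟶
      ∐ fun i => ((Tor (ModuleCat.{u} R) 1).obj ((shiftedHomology i).obj A)).obj
        ((complementaryHomology q i).obj B) :=
  inv (tensorComparison A B q) ≫ kunnethπ (resolutionChains A) B q ≫
    Limits.Sigma.map (fun i => ((Tor (ModuleCat.{u} R) 1).map (shiftedComparison A i)).app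
      ((complementaryHomology q i).obj B))

lemma simplicialKunnethι_naturality :
    Limits.Sigma.map (fun i => (simplicialHomology i).map f ⊗ₘ (complementaryHomology q i).map β) ≫
        simplicialKunnethι A' B' q =
      simplicialKunnethι A B q ≫ (simplicialHomology q).map (f ⊗ₘ β) := by
  have h1 : Limits.Sigma.map
        (fun i => (simplicialHomology i).map f ⊗ₘ (complementaryHomology q i).map β) ≫
      Limits.Sigma.map
        (fun i => inv (homologyComparison A' i) ▷ (complementaryHomology q i).obj B') =
    Limits.Sigma.map (fun i => inv (homologyComparison A i) ▷ (complementaryHomology q i).obj B) ≫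
      Limits.Sigma.map (fun i => HomologicalComplex.homologyMap (resolutionChainsMap f) i ⊗ₘ
        (complementaryHomology q i).map β) := by
    refine sigmaMap_square fun i => ?_
    have h := homologyComparison_naturality f i
    rw [← IsIso.inv_comp_eq, ← Category.assoc, ← IsIso.eq_comp_inv] at h
    rw [MonoidalCategory.tensorHom_def', MonoidalCategory.tensorHom_def', Category.assoc, ← comp_whiskerRight, ← h,
      comp_whiskerRight, whisker_exchange_assoc]
  have h2 : Limits.Sigma.map (fun i => HomologicalComplex.homologyMap (resolutionChainsMap f) i ⊗ₘ
        (complementaryHomology q i).map β) ≫ kunnethι (resolutionChains A') B' q =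
      kunnethι (resolutionChains A) B q ≫
        ((tensorHomology q B).map (resolutionChainsMap f) ≫ tensorHomologyMap q β _) := by
    have h3 : Limits.Sigma.map (fun i => HomologicalComplex.homologyMap (resolutionChainsMap f) i ⊗ₘ
        (complementaryHomology q i).map β) =
      Limits.Sigma.map (fun i => HomologicalComplex.homologyMap (resolutionChainsMap f) i ▷
        (complementaryHomology q i).obj B) ≫
      Limits.Sigma.map (fun i => (resolutionChains A').homology i ◁
        (complementaryHomology q i).map β) :=
      Sigma.hom_ext _ _ fun i => by simp [MonoidalCategory.tensorHom_def]
    rw [h3, Category.assoc, kunnethι_naturality_right, ← Category.assoc, kunnethι_naturality,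
      Category.assoc]
  exact square_comp h1 (square_comp h2 (tensorComparison_naturality f β q))

lemma simplicialKunnethπ_naturality [IsIso (tensorComparison A B q)]
    [IsIso (tensorComparison A' B' q)] :
    (simplicialHomology q).map (f ⊗ₘ β) ≫ simplicialKunnethπ A' B' q =
      simplicialKunnethπ A B q ≫ Limits.Sigma.map (fun i =>
        ((Tor (ModuleCat.{u} R) 1).map ((shiftedHomology i).map f)).app _ ≫
          ((Tor (ModuleCat.{u} R) 1).obj _).map ((complementaryHomology q i).map β)) := by
  have h1 := tensorComparison_naturality f β q
  rw [← IsIso.eq_comp_inv, Category.assoc, ← IsIso.inv_comp_eq] at h1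
  have h2 : ((tensorHomology q B).map (resolutionChainsMap f) ≫ tensorHomologyMap q β _) ≫
      kunnethπ (resolutionChains A') B' q = kunnethπ (resolutionChains A) B q ≫
      Limits.Sigma.map (fun i => ((Tor (ModuleCat.{u} R) 1).map
        (shiftMap (fun i => HomologicalComplex.homologyMap (resolutionChainsMap f) i) i)).app
          ((complementaryHomology q i).obj B) ≫
        ((Tor (ModuleCat.{u} R) 1).obj
          (shiftObj (fun i => (resolutionChains A').homology i) i)).map
            ((complementaryHomology q i).map β)) := by
    rw [Category.assoc, kunnethπ_naturality_right, reassoc_of% kunnethπ_naturality]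
    congr 1
    exact Sigma.hom_ext _ _ fun i => by simp
  refine square_comp h1.symm (square_comp h2 (sigmaMap_square fun i => ?_))
  have h := congrArg (fun k => ((Tor (ModuleCat.{u} R) 1).map k).app
    ((complementaryHomology q i).obj B)) (shiftedComparison_naturality f i)
  simp only [Functor.map_comp, NatTrans.comp_app] at h
  rw [Category.assoc, NatTrans.naturality, reassoc_of% h]

lemma simplicialKunneth_shortExact [IsIso (tensorComparison A B q)] :
    ∃ w, (ShortComplex.mk (simplicialKunnethι A B q) (simplicialKunnethπ A B q) w).ShortExact := by
  obtain ⟨w, h⟩ := kunneth_shortExact (resolutionChains A) B q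
  let e₁ := asIso (Limits.Sigma.map
    (fun i => homologyComparison A i ▷ (complementaryHomology q i).obj B))
  let e₂ := asIso (tensorComparison A B q)
  let e₃ := asIso (Limits.Sigma.map
    (fun i => ((Tor (ModuleCat.{u} R) 1).map (shiftedComparison A i)).app
      ((complementaryHomology q i).obj B)))
  have h1 : e₁.hom ≫ simplicialKunnethι A B q =
      kunnethι (resolutionChains A) B q ≫ e₂.hom :=
    Sigma.hom_ext _ _ fun i => by
      simp [e₁, e₂, simplicialKunnethι, ← comp_whiskerRight_assoc]
  have h2 : e₂.hom ≫ simplicialKunnethπ A B q =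
      kunnethπ (resolutionChains A) B q ≫ e₃.hom := by
    simp [e₂, e₃, simplicialKunnethπ]
  have w' : simplicialKunnethι A B q ≫ simplicialKunnethπ A B q = 0 := by
    rw [← cancel_epi e₁.hom, reassoc_of% h1, h2, reassoc_of% w, zero_comp, comp_zero]
  refine ⟨w', ShortComplex.shortExact_of_iso (ShortComplex.isoMk
    (S₁ := ShortComplex.mk (kunnethι (resolutionChains A) B q)
      (kunnethπ (resolutionChains A) B q) w)
    (S₂ := ShortComplex.mk (simplicialKunnethι A B q) (simplicialKunnethπ A B q) w')
    e₁ e₂ e₃ h1 h2) h⟩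

end SimplicialKunneth

end VietorisRips

end

/-! ### Direct sums of copies of a module, their tensor products and `Tor₁` -/

noncomputable section

namespace VietorisRips

variable {R : Type u} [CommRing R]

section Copowers

variable (X Y : Type u) (M N : ModuleCat.{u} R)

/-- A direct sum of copies of `M` is the module of finitely supported functions. -/
def copowerIso : (∐ fun _ : X => M) ≅ ModuleCat.of R (X →₀ M) where
  hom := Sigma.desc fun x => ModuleCat.ofHom (Finsupp.lsingle x)
  inv := ModuleCat.ofHom (Finsupp.lsum R fun x => (Sigma.ι (fun _ : X => M) x).hom)
  hom_inv_id := Sigma.hom_ext _ _ fun x => by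
    ext m
    simp
  inv_hom_id := by
    ext1
    refine Finsupp.lhom_ext fun x m => ?_
    simp

variable {X M} in
lemma ι_copowerIso_hom (x : X) (m : M) :
    (copowerIso X M).hom (Sigma.ι (fun _ : X => M) x m) = Finsupp.single x m :=
  ConcreteCategory.congr_hom
      (Sigma.ι_desc (fun x => ModuleCat.ofHom (Finsupp.lsingle (R := R) (M := M) x)) x) m

variable {X M} in
lemma copowerIso_inv_single (x : X) (m : M) :
    (copowerIso X M).inv (Finsupp.single x m) = Sigma.ι (fun _ : X => M) x m := by
  rw [← ι_copowerIso_hom]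
  exact ConcreteCategory.congr_hom (copowerIso X M).hom_inv_id _

/-- The tensor product of direct sums of copies of `M` and of `N`. -/
def copowerTensorIso :
    (∐ fun _ : X => M) ⊗ (∐ fun _ : Y => N) ≅ ∐ fun _ : X × Y => M ⊗ N :=
  (copowerIso X M ⊗ᵢ copowerIso Y N) ≪≫
    LinearEquiv.toModuleIso (finsuppTensorFinsupp R R M N X Y) ≪≫
    (copowerIso (X × Y) (M ⊗ N)).symm

variable {X Y M N}

lemma ι_tensor_ι_copowerTensorIso_hom (x : X) (y : Y) :
    (Sigma.ι (fun _ : X => M) x ⊗ₘ Sigma.ι (fun _ : Y => N) y) ≫ (copowerTensorIso X Y M N).hom =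
      Sigma.ι (fun _ : X × Y => M ⊗ N) (x, y) := by
  refine ModuleCat.MonoidalCategory.tensor_ext fun m n => ?_
  change (copowerIso (X × Y) (M ⊗ N)).inv (finsuppTensorFinsupp R R M N X Y
    ((copowerIso X M).hom (Sigma.ι (fun _ : X => M) x m) ⊗ₜ
      (copowerIso Y N).hom (Sigma.ι (fun _ : Y => N) y n))) = _
  rw [ι_copowerIso_hom, ι_copowerIso_hom, finsuppTensorFinsupp_single, copowerIso_inv_single]

lemma copower_tensor_hom_ext {Z : ModuleCat.{u} R}
    {f g : (∐ fun _ : X => M) ⊗ (∐ fun _ : Y => N) ⟶ Z}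
    (h : ∀ x y, (Sigma.ι (fun _ : X => M) x ⊗ₘ Sigma.ι (fun _ : Y => N) y) ≫ f =
      (Sigma.ι (fun _ : X => M) x ⊗ₘ Sigma.ι (fun _ : Y => N) y) ≫ g) : f = g := by
  rw [← cancel_epi (copowerTensorIso X Y M N).inv]
  refine Sigma.hom_ext _ _ fun p => ?_
  rw [← ι_tensor_ι_copowerTensorIso_hom p.1 p.2]
  simpa using h p.1 p.2

end Copowers

section CopowerTor

variable {X Y : Type u}

/-- Take a projective presentation of `M` with kernel `K`. The hypothesis makes `K ⊗ N ⟶ P ⊗ N`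
injective. Copowers of the presentation, tensored with the copower of `N`, give a direct sum over `X
× Y` of copies of this map, which is again injective. Flatness of the copower of `P` then yields the
vanishing. -/
lemma isZero_tor_copower {M N : ModuleCat.{u} R}
    (h : IsZero (((Tor (ModuleCat.{u} R) 1).obj M).obj N)) :
    IsZero (((Tor (ModuleCat.{u} R) 1).obj (∐ fun _ : X => M)).obj (∐ fun _ : Y => N)) := by
  let S : ShortComplex (ModuleCat.{u} R) :=
    ShortComplex.mk (kernel.ι (Projective.π M)) (Projective.π M) (kernel.condition _)
  have hS : S.ShortExact := { exact := ShortComplex.exact_of_f_is_kernel _ (kernelIsKernel _) }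
  have hSN : Mono (S.f ▷ N) := (shortExact_whiskerRight_of_isZero_tor hS h).mono_f
  have hX : (ShortComplex.mk (Limits.Sigma.map fun _ : X => S.f) (Limits.Sigma.map fun _ => S.g)
      (Limits.Sigma.hom_ext _ _ (by simp))).ShortExact :=
    { exact := exact_sigmaMap (fun _ : X => S) fun _ => hS.exact
      mono_f := inferInstance
      epi_g := inferInstance }
  have : Projective S.X₂ := Projective.projective_over M
  have : Module.Flat R S.X₂ := flat_of_projective S.X₂
  have : Module.Flat R (ModuleCat.of R (X →₀ S.X₂)) :=
    by classical exact Module.Flat.of_linearEquiv (finsuppLequivDFinsupp R)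
  refine isZero_tor_of_mono_whiskerRight hX
    (Module.Flat.of_linearEquiv (copowerIso X S.X₂).toLinearEquiv) ?_
  have hcomm : (Limits.Sigma.map fun _ : X => S.f) ▷ (∐ fun _ : Y => N) ≫
      (copowerTensorIso X Y S.X₂ N).hom =
      (copowerTensorIso X Y S.X₁ N).hom ≫ (Limits.Sigma.map fun _ : X × Y => S.f ▷ N) :=
    copower_tensor_hom_ext fun x y => by
      rw [reassoc_of% (ι_tensor_ι_copowerTensorIso_hom (M := S.X₁) (N := N) x y), ← tensorHom_id,
        tensorHom_comp_tensorHom_assoc, Sigma.ι_map, Sigma.ι_map, Category.comp_id,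
        ← tensorHom_id, ← ι_tensor_ι_copowerTensorIso_hom, tensorHom_comp_tensorHom_assoc,
        Category.id_comp]
  rw [← Iso.eq_comp_inv] at hcomm
  exact hcomm ▸ inferInstance

end CopowerTor

end VietorisRips

end

/-! ### Chains on Vietoris–Rips complexes and on strong products -/

noncomputable section

namespace VietorisRips

variable {R : Type u} [CommRing R]

section Chains

/-- The simplicial module of chains on the Vietoris-Rips complex. -/
def chains (M : ModuleCat.{u} R) (G : Graph.{u}) : SimplicialObject (ModuleCat.{u} R) :=
  ((SimplicialObject.whiskering _ _).obj (sigmaConst.obj M)).obj G.vrComplex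

variable {M M' N N' : ModuleCat.{u} R} {G G' H H' : Graph.{u}}

/-- The inclusion of the summand of a simplex. -/
def chainι (M : ModuleCat.{u} R) (G : Graph.{u}) {n : SimplexCategoryᵒᵖ} (x : G.vrComplex.obj n) :
    M ⟶ (chains M G).obj n :=
  Sigma.ι (fun _ : G.vrComplex.obj n => M) x

lemma chains_hom_ext {n : SimplexCategoryᵒᵖ} {Z : ModuleCat.{u} R} {f g : (chains M G).obj n ⟶ Z}
    (h : ∀ x, chainι M G x ≫ f = chainι M G x ≫ g) : f = g :=
  Sigma.hom_ext _ _ h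

lemma chains_tensor_hom_ext {n : SimplexCategoryᵒᵖ} {Z : ModuleCat.{u} R}
    {f g : (chains M G).obj n ⊗ (chains N H).obj n ⟶ Z}
    (h : ∀ x y, (chainι M G x ⊗ₘ chainι N H y) ≫ f = (chainι M G x ⊗ₘ chainι N H y) ≫ g) : f = g :=
  copower_tensor_hom_ext h

lemma chainι_map {n m : SimplexCategoryᵒᵖ} (θ : n ⟶ m) (x : G.vrComplex.obj n) :
    chainι M G x ≫ (chains M G).map θ = chainι M G (G.vrComplex.map θ x) :=
  (Sigma.ι_comp_map' _ _ _).trans (Category.id_comp _)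

/-- The map on the Vietoris-Rips complexes. -/
def vrMap (g : G ⟶ H) (n : SimplexCategoryᵒᵖ) (x : G.vrComplex.obj n) : H.vrComplex.obj n :=
  (Graph.vrFunctor.map g).app n x

/-- The linear map out of the chains determined by the summands of simplices. -/
def chainsDesc {n : SimplexCategoryᵒᵖ} {Z : ModuleCat.{u} R} (f : G.vrComplex.obj n → (M ⟶ Z)) :
    (chains M G).obj n ⟶ Z :=
  Sigma.desc f

lemma chainι_chainsDesc {n : SimplexCategoryᵒᵖ} {Z : ModuleCat.{u} R}
    (f : G.vrComplex.obj n → (M ⟶ Z)) (x : G.vrComplex.obj n) :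
    chainι M G x ≫ chainsDesc f = f x :=
  Sigma.ι_desc _ _

/-- The functoriality of the simplicial module of chains. -/
def chainsMap (m : M ⟶ M') (g : G ⟶ H) : chains M G ⟶ chains M' H where
  app n := chainsDesc fun x => m ≫ chainι M' H (vrMap g n x)
  naturality n n' θ := chains_hom_ext fun x => by
    rw [reassoc_of% chainι_map, chainι_chainsDesc, reassoc_of% chainι_chainsDesc, Category.assoc,
      chainι_map]
    rfl

lemma chainι_chainsMap (m : M ⟶ M') (g : G ⟶ H) {n : SimplexCategoryᵒᵖ} (x : G.vrComplex.obj n) :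
    chainι M G x ≫ (chainsMap m g).app n = m ≫ chainι M' H (vrMap g n x) :=
  chainι_chainsDesc _ _

/-- A simplex of the Vietoris-Rips complex of a strong product is a pair of simplices. -/
def pairEquiv (G H : Graph.{u}) (n : SimplexCategoryᵒᵖ) :
    G.vrComplex.obj n × H.vrComplex.obj n ≃ (G.strongProd H).vrComplex.obj n where
  toFun p := ⟨fun i => (p.1.1 i, p.2.1 i), fun i j =>
    (Graph.strongProd_rel _ _ _ _).2 ⟨p.1.2 i j, p.2.2 i j⟩⟩
  invFun z := (⟨fun i => (z.1 i).1, fun i j => ((Graph.strongProd_rel _ _ _ _).1 (z.2 i j)).1⟩,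
    ⟨fun i => (z.1 i).2, fun i j => ((Graph.strongProd_rel _ _ _ _).1 (z.2 i j)).2⟩)
  left_inv _ := rfl
  right_inv _ := rfl

/-- The degreewise comparison of the tensor product of chains with chains on the strong product. -/
def chainsTensorIsoApp (M N : ModuleCat.{u} R) (G H : Graph.{u}) (n : SimplexCategoryᵒᵖ) :
    (chains M G).obj n ⊗ (chains N H).obj n ≅ (chains (M ⊗ N) (G.strongProd H)).obj n :=
  copowerTensorIso (G.vrComplex.obj n) (H.vrComplex.obj n) M N ≪≫
    (Sigma.whiskerEquiv (f := fun _ => M ⊗ N) (g := fun _ => M ⊗ N) (pairEquiv G H n)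
      fun _ => Iso.refl (M ⊗ N) :)

/-- Determines the comparison on summands; since such tensors of inclusions are jointly epimorphic,
its naturality in all variables is checked on them. -/
lemma chainι_tensor_chainι {n : SimplexCategoryᵒᵖ} (x : G.vrComplex.obj n)
    (y : H.vrComplex.obj n) :
    (chainι M G x ⊗ₘ chainι N H y) ≫ (chainsTensorIsoApp M N G H n).hom =
      chainι (M ⊗ N) (G.strongProd H) (pairEquiv G H n (x, y)) := by
  refine (Category.assoc _ _ _).symm.trans ((congrArg (fun k => k ≫ _)
    (ι_tensor_ι_copowerTensorIso_hom x y)).trans ?_)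
  exact (Sigma.ι_comp_map' _ _ _).trans (Category.id_comp _)

lemma chainsTensorIsoApp_naturality (M N : ModuleCat.{u} R) (G H : Graph.{u})
    {n m : SimplexCategoryᵒᵖ} (θ : n ⟶ m) :
    ((chains M G).map θ ⊗ₘ (chains N H).map θ) ≫ (chainsTensorIsoApp M N G H m).hom =
      (chainsTensorIsoApp M N G H n).hom ≫ (chains (M ⊗ N) (G.strongProd H)).map θ :=
  chains_tensor_hom_ext fun x y => by
    rw [tensorHom_comp_tensorHom_assoc, chainι_map, chainι_map, chainι_tensor_chainι,
      reassoc_of% chainι_tensor_chainι, chainι_map]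
    -- Structure maps of the Vietoris–Rips complex act coordinatewise on pairs of simplices.
    rfl

/-- The tensor product of chains is the simplicial module of chains on the strong product. -/
def chainsTensorIso (M N : ModuleCat.{u} R) (G H : Graph.{u}) :
    chains M G ⊗ chains N H ≅ chains (M ⊗ N) (G.strongProd H) :=
  NatIso.ofComponents (fun n => chainsTensorIsoApp M N G H n)
    fun θ => chainsTensorIsoApp_naturality M N G H θ

/-- The functoriality of the strong product. -/
def strongProdMap (g : G ⟶ G') (h : H ⟶ H') : G.strongProd H ⟶ G'.strongProd H' :=
  Graph.strongProdFunctor.map (X := (G, H)) (Y := (G', H')) (g, h)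

lemma chainsTensorIsoApp_naturality_left (m : M ⟶ M') (n : N ⟶ N') (g : G ⟶ G') (h : H ⟶ H')
    (k : SimplexCategoryᵒᵖ) :
    ((chainsMap m g).app k ⊗ₘ (chainsMap n h).app k) ≫ (chainsTensorIsoApp M' N' G' H' k).hom =
      (chainsTensorIsoApp M N G H k).hom ≫ (chainsMap (m ⊗ₘ n) (strongProdMap g h)).app k :=
  chains_tensor_hom_ext fun x y => by
    rw [tensorHom_comp_tensorHom_assoc, chainι_chainsMap, chainι_chainsMap,
      ← tensorHom_comp_tensorHom_assoc, chainι_tensor_chainι,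
      reassoc_of% chainι_tensor_chainι, chainι_chainsMap]
    rfl

lemma chainsTensorIso_naturality (m : M ⟶ M') (n : N ⟶ N') (g : G ⟶ G') (h : H ⟶ H') :
    (chainsMap m g ⊗ₘ chainsMap n h) ≫ (chainsTensorIso M' N' G' H').hom =
      (chainsTensorIso M N G H).hom ≫ chainsMap (m ⊗ₘ n) (strongProdMap g h) :=
  NatTrans.ext (funext fun k => chainsTensorIsoApp_naturality_left m n g h k)

lemma isZero_tor_chains (h : IsZero (((Tor (ModuleCat.{u} R) 1).obj M).obj N))
    (n : SimplexCategoryᵒᵖ) :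
    IsZero (((Tor (ModuleCat.{u} R) 1).obj ((chains M G).obj n)).obj ((chains N H).obj n)) :=
  isZero_tor_copower h

/-- Homology of simplicial modules in integral degrees. -/
def intHomology : ℤ → SimplicialObject (ModuleCat.{u} R) ⥤ ModuleCat.{u} R
  | .ofNat n => simplicialHomology n
  | .negSucc _ => (Functor.const _).obj (ModuleCat.of R PUnit.{u + 1})

/-- Vietoris-Rips homology is the homology of the simplicial module of chains. -/
def homologyIso (q : ℤ) (M : ModuleCat.{u} R) (G : Graph.{u}) :
    (Functor.uncurry.obj (homology R q)).obj (M, G) ≅ (intHomology q).obj (chains M G) :=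
  match q with
  | .ofNat _ => Iso.refl _
  | .negSucc _ => Iso.refl _

lemma chainsMap_left (m : M ⟶ M') (G : Graph.{u}) :
    ((sigmaConst ⋙ SimplicialObject.whiskering _ _).map m).app G.vrComplex = chainsMap m (𝟙 G) :=
  NatTrans.ext (F := chains M G) (G := chains M' G) (funext fun n => chains_hom_ext fun x =>
    (Sigma.ι_map (f := fun _ : G.vrComplex.obj n => M) (fun _ => m) x).trans
      (chainι_chainsMap m (𝟙 G) x).symm)

lemma chainsMap_right (M : ModuleCat.{u} R) (g : G ⟶ H) :
    ((sigmaConst ⋙ SimplicialObject.whiskering _ _).obj M).map (Graph.vrFunctor.map g) =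
      chainsMap (𝟙 M) g :=
  NatTrans.ext (F := chains M G) (G := chains M H) (funext fun _ => chains_hom_ext fun x =>
    (Sigma.ι_comp_map' _ _ _).trans (chainι_chainsMap (𝟙 M) g x).symm)

lemma chainsMap_id_comp (m : M ⟶ M') (g : G ⟶ H) :
    chainsMap m (𝟙 G) ≫ chainsMap (𝟙 M') g = chainsMap m g :=
  NatTrans.ext (funext fun k => chains_hom_ext fun x => by
    rw [NatTrans.comp_app, reassoc_of% chainι_chainsMap, chainι_chainsMap, chainι_chainsMap]
    exact congrArg (fun k => m ≫ k) (Category.id_comp _))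

lemma homologyIso_naturality (q : ℤ) (m : M ⟶ M') (g : G ⟶ H) :
    (Functor.uncurry.obj (homology R q)).map (X := (M, G)) (Y := (M', H)) (m, g) ≫
      (homologyIso q M' H).hom =
      (homologyIso q M G).hom ≫ (intHomology q).map (chainsMap m g) := by
  match q with
  | .ofNat n =>
    refine (Category.comp_id _).trans (Eq.trans ?_ (Category.id_comp _).symm)
    rw [← chainsMap_id_comp, CategoryTheory.Functor.map_comp, ← chainsMap_left, ← chainsMap_right]
    rfl
  | .negSucc _ => rfl

end Chains

end VietorisRips

end

/-! ### Reindexing by pairs of integral degrees -/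

noncomputable section

namespace VietorisRips

variable {R : Type u} [CommRing R]

/-- An equality of functors, so that `eqToHom` supplies a comparison that is automatically natural.
-/
lemma complementaryHomology_eq : ∀ n i : ℕ,
    complementaryHomology (R := R) n i = intHomology ((n : ℤ) - i)
  | n, 0 => by
    have : (n : ℤ) - (0 : ℕ) = Int.ofNat n := by simp
    rw [this]
    cases n <;> rfl
  | 0, i + 1 => by
    have : ((0 : ℕ) : ℤ) - (i + 1 : ℕ) = Int.negSucc i := by omega
    rw [this]
    rfl
  | n + 1, i + 1 => by
    have : ((n + 1 : ℕ) : ℤ) - (i + 1 : ℕ) = n - i := by omega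
    rw [this, ← complementaryHomology_eq n i]
    rfl

lemma shiftedHomology_eq : ∀ i : ℕ, shiftedHomology (R := R) i = intHomology ((i : ℤ) - 1)
  | 0 => rfl
  | i + 1 => by
    have : ((i + 1 : ℕ) : ℤ) - 1 = Int.ofNat i := by simp
    rw [this]
    rfl

lemma simplicialHomology_eq (i : ℕ) :
    simplicialHomology (R := R) i = intHomology ((i : ℤ) - 0) := by
  have : (i : ℤ) - 0 = Int.ofNat i := by simp
  rw [this]
  rfl

lemma isZero_intHomology {q : ℤ} (hq : q < 0) (A : SimplicialObject (ModuleCat.{u} R)) :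
    IsZero ((intHomology q).obj A) :=
  match q, hq with
  | .negSucc _, _ => ModuleCat.isZero_of_subsingleton (ModuleCat.of R PUnit.{u + 1})

section Reindex

/-- Summands outside the image of `e` are zero, so the inverse may be taken to be zero on them. -/
lemma isIso_sigmaMap' {ι κ : Type} {X : ι → ModuleCat.{u} R} {Y : κ → ModuleCat.{u} R}
    (e : ι → κ) (he : Function.Injective e) (hY : ∀ k, k ∉ Set.range e → IsZero (Y k))
    (f : ∀ i, X i ⟶ Y (e i)) (hf : ∀ i, IsIso (f i)) : IsIso (Sigma.map' e f) := by
  classical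
  let r : (k : κ) → (Y k ⟶ ∐ X) := fun k =>
    if h : ∃ i, e i = k then eqToHom (congrArg Y h.choose_spec.symm) ≫ inv (f h.choose) ≫
      Sigma.ι X h.choose else 0
  have hr (i : ι) : r (e i) = inv (f i) ≫ Sigma.ι X i := by
    have h : ∃ j, e j = e i := ⟨i, rfl⟩
    -- Stated for an arbitrary preimage `j`, so that injectivity can identify it with `i` and remove
    -- the `eqToHom`.
    have aux : ∀ (j : ι) (hj : e j = e i), eqToHom (congrArg Y hj.symm) ≫ inv (f j) ≫
        Sigma.ι X j = inv (f i) ≫ Sigma.ι X i := by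
      intro j hj
      obtain rfl := he hj
      simp
    exact (dif_pos h).trans (aux _ h.choose_spec)
  refine ⟨Sigma.desc r, Sigma.hom_ext _ _ fun i => ?_, Sigma.hom_ext _ _ fun k => ?_⟩
  · rw [Sigma.ι_comp_map'_assoc, Sigma.ι_desc, hr, IsIso.hom_inv_id_assoc, Category.comp_id]
  · by_cases hk : k ∈ Set.range e
    · obtain ⟨i, rfl⟩ := hk
      rw [Sigma.ι_desc_assoc, hr, Category.assoc, Sigma.ι_comp_map', IsIso.inv_hom_id_assoc,
        Category.comp_id]
    · exact (hY k hk).eq_of_src _ _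

end Reindex

lemma inv_square {C : Type*} [Category* C] {X Y X' Y' : C} {e : X ≅ Y} {e' : X' ≅ Y'} {a : X ⟶ X'}
    {b : Y ⟶ Y'} (h : a ≫ e'.hom = e.hom ≫ b) : b ≫ e'.inv = e.inv ≫ a := by
  rw [Iso.comp_inv_eq, Category.assoc, h, Iso.inv_hom_id_assoc]

section Input

variable (X : Input R) {X' : Input R}

/-- The chains on the first graph. -/
def chainsLeft : SimplicialObject (ModuleCat.{u} R) := chains X.2.obj.1 X.1.1

/-- The chains on the second graph. -/
def chainsRight : SimplicialObject (ModuleCat.{u} R) := chains X.2.obj.2 X.1.2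

/-- The identification of the homology of the first graph. -/
def homologyLeftIso (q : ℤ) :
    (intHomology q).obj (chainsLeft X) ≅ (Input.homologyLeft R q).obj X :=
  (homologyIso q X.2.obj.1 X.1.1).symm

/-- The identification of the homology of the second graph. -/
def homologyRightIso (q : ℤ) :
    (intHomology q).obj (chainsRight X) ≅ (Input.homologyRight R q).obj X :=
  (homologyIso q X.2.obj.2 X.1.2).symm

/-- The identification of the homology of the strong product. -/
def homologyStrongProdIso (q : ℤ) :
    (intHomology q).obj (chainsLeft X ⊗ chainsRight X) ≅ (Input.homologyStrongProd R q).obj X :=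
  (intHomology q).mapIso (chainsTensorIso X.2.obj.1 X.2.obj.2 X.1.1 X.1.2) ≪≫
    (homologyIso q (X.2.obj.1 ⊗ X.2.obj.2) (X.1.1.strongProd X.1.2)).symm

variable {X} (f : X ⟶ X')

/-- The functoriality of the chains on the first graph. -/
def chainsLeftMap : chainsLeft X ⟶ chainsLeft X' := chainsMap f.2.hom.1 f.1.1

/-- The functoriality of the chains on the second graph. -/
def chainsRightMap : chainsRight X ⟶ chainsRight X' := chainsMap f.2.hom.2 f.1.2

lemma homologyLeftIso_naturality (q : ℤ) :
    (intHomology q).map (chainsLeftMap f) ≫ (homologyLeftIso X' q).hom =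
      (homologyLeftIso X q).hom ≫ (Input.homologyLeft R q).map f :=
  inv_square (homologyIso_naturality q f.2.hom.1 f.1.1)

lemma homologyRightIso_naturality (q : ℤ) :
    (intHomology q).map (chainsRightMap f) ≫ (homologyRightIso X' q).hom =
      (homologyRightIso X q).hom ≫ (Input.homologyRight R q).map f :=
  inv_square (homologyIso_naturality q f.2.hom.2 f.1.2)

lemma homologyStrongProdIso_naturality (q : ℤ) :
    (intHomology q).map (chainsLeftMap f ⊗ₘ chainsRightMap f) ≫ (homologyStrongProdIso X' q).hom =
      (homologyStrongProdIso X q).hom ≫ (Input.homologyStrongProd R q).map f := by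
  have h := congrArg (intHomology q).map
    (chainsTensorIso_naturality f.2.hom.1 f.2.hom.2 f.1.1 f.1.2)
  rw [CategoryTheory.Functor.map_comp, CategoryTheory.Functor.map_comp] at h
  exact square_comp h
    (inv_square (homologyIso_naturality q (f.2.hom.1 ⊗ₘ f.2.hom.2) (strongProdMap f.1.1 f.1.2)))

lemma isZero_homologyLeft {q : ℤ} (hq : q < 0) : IsZero ((Input.homologyLeft R q).obj X) :=
  (isZero_intHomology hq _).of_iso (homologyLeftIso X q).symm

lemma isZero_homologyRight {q : ℤ} (hq : q < 0) : IsZero ((Input.homologyRight R q).obj X) :=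
  (isZero_intHomology hq _).of_iso (homologyRightIso X q).symm

lemma isZero_homologyStrongProd {q : ℤ} (hq : q < 0) :
    IsZero ((Input.homologyStrongProd R q).obj X) :=
  (isZero_intHomology hq _).of_iso (homologyStrongProdIso X q).symm

end Input

section Index

variable (T : ModuleCat.{u} R × ModuleCat.{u} R ⥤ ModuleCat.{u} R)

/-- The direct sum of the values of a bifunctor on homology modules of total degree `r`. -/
def bifunctorSum (r : ℤ) : Input R ⥤ ModuleCat.{u} R :=
  directSum fun p : { p : ℤ × ℤ // p.1 + p.2 = r } =>
    (Input.homologyLeft R p.1.1).prod' (Input.homologyRight R p.1.2) ⋙ T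

/-- A negative total degree forces a negative degree in one factor, whose homology is zero. -/
lemma isZero_bifunctorSum (hT : ∀ P : ModuleCat.{u} R × ModuleCat.{u} R, IsZero P.1 → IsZero (T.obj P))
    (hT' : ∀ P : ModuleCat.{u} R × ModuleCat.{u} R, IsZero P.2 → IsZero (T.obj P))
    {r : ℤ} (hr : r < 0) (X : Input R) : IsZero ((bifunctorSum T r).obj X) := by
  rw [IsZero.iff_id_eq_zero]
  refine Sigma.hom_ext _ _ fun p => IsZero.eq_of_src ?_ _ _
  by_cases h : p.1.1 < 0
  · exact hT _ (isZero_homologyLeft h)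
  · exact hT' _ (isZero_homologyRight (by have := p.2; omega))

variable {s r : ℤ} {n : ℕ} (hr : r = n - s)
  {F : ℕ → SimplicialObject (ModuleCat.{u} R) ⥤ ModuleCat.{u} R}
  (hF : ∀ i, F i = intHomology ((i : ℤ) - s))

/-- The pairs of degrees with sum `r`, the first of which is at least `-s`. -/
def degreePair (i : ℕ) : { p : ℤ × ℤ // p.1 + p.2 = r } :=
  ⟨((i : ℤ) - s, (n : ℤ) - i), by omega⟩

/-- The comparison of the homology of the first graph. -/
def leftComponent (X : Input R) (i : ℕ) :
    (F i).obj (chainsLeft X) ⟶ (Input.homologyLeft R ((i : ℤ) - s)).obj X :=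
  (eqToHom (hF i)).app (chainsLeft X) ≫ (homologyLeftIso X _).hom

/-- The comparison of the homology of the second graph. -/
def rightComponent (n : ℕ) (X : Input R) (i : ℕ) :
    (complementaryHomology n i).obj (chainsRight X) ⟶
      (Input.homologyRight R ((n : ℤ) - i)).obj X :=
  (eqToHom (complementaryHomology_eq n i)).app (chainsRight X) ≫ (homologyRightIso X _).hom

instance (X : Input R) (i : ℕ) : IsIso (leftComponent hF X i) := by
  unfold leftComponent
  infer_instance

instance (X : Input R) (i : ℕ) : IsIso (rightComponent n X i) := by
  unfold rightComponent
  infer_instance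

/-- The values of a bifunctor on homology modules. -/
def pairObj (X : Input R) (p : ℤ × ℤ) : ModuleCat.{u} R :=
  T.obj ((Input.homologyLeft R p.1).obj X, (Input.homologyRight R p.2).obj X)

/-- The comparison of the values of a bifunctor on homology modules. -/
def indexComponent (X : Input R) (i : ℕ) :
    T.obj ((F i).obj (chainsLeft X), (complementaryHomology n i).obj (chainsRight X)) ⟶
      pairObj T X (degreePair hr i).1 :=
  T.map (X := (_, _)) (Y := (_, _)) (leftComponent hF X i, rightComponent n X i)

instance (X : Input R) (i : ℕ) : IsIso (indexComponent T hr hF X i) :=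
  (T.mapIso (Iso.prod (asIso (leftComponent hF X i)) (asIso (rightComponent n X i)))).isIso_hom

/-- The map between the values of a bifunctor on homology modules. -/
def indexMap (F : ℕ → SimplicialObject (ModuleCat.{u} R) ⥤ ModuleCat.{u} R) (n : ℕ)
    {X X' : Input R} (f : X ⟶ X') (i : ℕ) :
    T.obj ((F i).obj (chainsLeft X), (complementaryHomology n i).obj (chainsRight X)) ⟶
      T.obj ((F i).obj (chainsLeft X'), (complementaryHomology n i).obj (chainsRight X')) :=
  T.map (X := (_, _)) (Y := (_, _))
    ((F i).map (chainsLeftMap f), (complementaryHomology n i).map (chainsRightMap f))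

/-- The map between the summands of `bifunctorSum`. -/
def pairMap {X X' : Input R} (f : X ⟶ X') (p : ℤ × ℤ) : pairObj T X p ⟶ pairObj T X' p :=
  T.map (X := (_, _)) (Y := (_, _))
    ((Input.homologyLeft R p.1).map f, (Input.homologyRight R p.2).map f)

lemma indexComponent_naturality {X X' : Input R} (f : X ⟶ X') (i : ℕ) :
    indexMap T F n f i ≫ indexComponent T hr hF X' i =
      indexComponent T hr hF X i ≫ pairMap T f (degreePair hr i).1 := by
  have h1 : (F i).map (chainsLeftMap f) ≫ leftComponent hF X' i =
      leftComponent hF X i ≫ (Input.homologyLeft R ((i : ℤ) - s)).map f :=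
    square_comp ((eqToHom (hF i)).naturality _) (homologyLeftIso_naturality f _)
  have h2 : (complementaryHomology n i).map (chainsRightMap f) ≫ rightComponent n X' i =
      rightComponent n X i ≫ (Input.homologyRight R ((n : ℤ) - i)).map f :=
    square_comp ((eqToHom (complementaryHomology_eq n i)).naturality _)
      (homologyRightIso_naturality f _)
  exact (T.map_comp _ _).symm.trans ((congrArg T.map (Prod.ext h1 h2)).trans (T.map_comp _ _))

/-- The comparison of a direct sum over the natural numbers with a direct sum over pairs of
degrees. -/
def indexComparison (X : Input R) :
    (∐ fun i => T.obj ((F i).obj (chainsLeft X), (complementaryHomology n i).obj (chainsRight X))) ⟶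
      ∐ fun p : { p : ℤ × ℤ // p.1 + p.2 = r } => pairObj T X p.1 :=
  Sigma.map' (degreePair hr) (indexComponent T hr hF X)

/-- The offset `s` is `0` for tensor products and `1` for torsion products. Pairs that are not
reached have first degree below `-s ≤ 0`, where homology vanishes. Pairs with negative second degree
are reached, and there both sides are compared by an isomorphism of zero homology modules. -/
lemma isIso_indexComparison
    (hT : ∀ P : ModuleCat.{u} R × ModuleCat.{u} R, IsZero P.1 → IsZero (T.obj P))
    (hs : 0 ≤ s) (X : Input R) : IsIso (indexComparison T hr hF X) := by
  refine isIso_sigmaMap' _ (fun i j h => ?_) (fun p hp => hT _ (isZero_homologyLeft ?_)) _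
    fun i => inferInstanceAs (IsIso (indexComponent T hr hF X i))
  · have := congrArg (fun p => p.1.1) h
    dsimp [degreePair] at this
    omega
  · by_contra! h
    have := p.2
    -- The index is recovered from the first degree by undoing the offset; `0 ≤ s` makes it a
    -- natural number.
    refine hp ⟨(p.1.1 + s).toNat, Subtype.ext (Prod.ext ?_ ?_)⟩ <;> dsimp [degreePair] <;> omega

lemma indexComparison_naturality {X X' : Input R} (f : X ⟶ X') :
    Limits.Sigma.map (indexMap T F n f) ≫ indexComparison T hr hF X' =
      indexComparison T hr hF X ≫
        Limits.Sigma.map fun p : { p : ℤ × ℤ // p.1 + p.2 = r } => pairMap T f p.1 := by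
  refine Sigma.hom_ext _ _ fun i => ?_
  rw [Sigma.ι_map_assoc, indexComparison, indexComparison, Sigma.ι_comp_map',
    Sigma.ι_comp_map'_assoc, Sigma.ι_map, reassoc_of% indexComponent_naturality T hr hF f i]

end Index

end VietorisRips

end

/-! ### The Künneth sequence for Vietoris–Rips homology -/

noncomputable section

namespace VietorisRips

variable {R : Type u} [CommRing R]

section NonnegativeDegrees

lemma isZero_tensor_of_left (P : ModuleCat.{u} R × ModuleCat.{u} R) (h : IsZero P.1) :
    IsZero ((tensor (ModuleCat.{u} R)).obj P) :=
  (tensorRight P.2).map_isZero h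

lemma isZero_tensor_of_right (P : ModuleCat.{u} R × ModuleCat.{u} R) (h : IsZero P.2) :
    IsZero ((tensor (ModuleCat.{u} R)).obj P) :=
  isZero_tensor h

lemma isZero_tor_of_left (P : ModuleCat.{u} R × ModuleCat.{u} R) (h : IsZero P.1) :
    IsZero ((Functor.uncurry.obj (Tor (ModuleCat.{u} R) 1)).obj P) :=
  have := ModuleCat.subsingleton_of_isZero h
  isZero_tor_one_of_flat P.1 P.2

lemma isZero_tor_of_right (P : ModuleCat.{u} R × ModuleCat.{u} R) (h : IsZero P.2) :
    IsZero ((Functor.uncurry.obj (Tor (ModuleCat.{u} R) 1)).obj P) :=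
  have : Projective P.2 := Projective.of_iso h.isoZero.symm inferInstance
  isZero_Tor_succ_of_projective _ P.1 P.2 0

variable (n : ℕ)

/-- The comparison of direct sums of tensor products. -/
def tensorIndexIso (X : Input R) :
    (∐ fun i => (simplicialHomology i).obj (chainsLeft X) ⊗
      (complementaryHomology n i).obj (chainsRight X)) ≅ (Input.tensorSum R n).obj X :=
  @asIso _ _ _ _ (indexComparison (tensor (ModuleCat.{u} R)) (sub_zero (n : ℤ)).symm
    simplicialHomology_eq X) (isIso_indexComparison _ _ _ isZero_tensor_of_left le_rfl X)

/-- The comparison of direct sums of torsion products. -/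
def torIndexIso (X : Input R) :
    (∐ fun i => ((Tor (ModuleCat.{u} R) 1).obj ((shiftedHomology i).obj (chainsLeft X))).obj
      ((complementaryHomology n i).obj (chainsRight X))) ≅ (Input.torSum R (n - 1)).obj X :=
  @asIso _ _ _ _ (indexComparison (Functor.uncurry.obj (Tor (ModuleCat.{u} R) 1))
    (rfl : (n : ℤ) - 1 = _) shiftedHomology_eq X)
    (isIso_indexComparison _ _ _ isZero_tor_of_left zero_le_one X)

variable {X X' : Input R} (f : X ⟶ X')

lemma tensorIndexIso_naturality :
    Limits.Sigma.map (fun i => (simplicialHomology i).map (chainsLeftMap f) ⊗ₘ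
      (complementaryHomology n i).map (chainsRightMap f)) ≫ (tensorIndexIso n X').hom =
      (tensorIndexIso n X).hom ≫ (Input.tensorSum R n).map f :=
  indexComparison_naturality (tensor (ModuleCat.{u} R)) (sub_zero (n : ℤ)).symm
    simplicialHomology_eq f

lemma torIndexIso_naturality :
    Limits.Sigma.map (fun i =>
        ((Tor (ModuleCat.{u} R) 1).map ((shiftedHomology i).map (chainsLeftMap f))).app _ ≫
          ((Tor (ModuleCat.{u} R) 1).obj _).map
            ((complementaryHomology n i).map (chainsRightMap f))) ≫ (torIndexIso n X').hom =
      (torIndexIso n X).hom ≫ (Input.torSum R (n - 1)).map f :=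
  indexComparison_naturality (Functor.uncurry.obj (Tor (ModuleCat.{u} R) 1))
    (rfl : (n : ℤ) - 1 = _) shiftedHomology_eq f

/-- The identification of the homology of the strong product. -/
def strongProdIso (X : Input R) :
    (simplicialHomology n).obj (chainsLeft X ⊗ chainsRight X) ≅
      (Input.homologyStrongProd R n).obj X :=
  homologyStrongProdIso X n

lemma strongProdIso_naturality :
    (simplicialHomology n).map (chainsLeftMap f ⊗ₘ chainsRightMap f) ≫ (strongProdIso n X').hom =
      (strongProdIso n X).hom ≫ (Input.homologyStrongProd R n).map f :=
  homologyStrongProdIso_naturality f n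

variable [IsDomain R] [IsPrincipalIdealRing R]

/-- This is where `Tor₁(M, M') = 0` enters: it passes to the chain modules in every simplicial
degree. -/
instance (X : Input R) (n : ℕ) : IsIso (tensorComparison (chainsLeft X) (chainsRight X) n) :=
  isIso_tensorComparison _ _ n fun k => isZero_tor_chains X.2.property k

/-- The cross product in Vietoris-Rips homology. -/
def vietorisRipsι : Input.tensorSum R n ⟶ Input.homologyStrongProd R n where
  app X := (tensorIndexIso n X).inv ≫
    simplicialKunnethι (chainsLeft X) (chainsRight X) n ≫ (strongProdIso n X).hom
  naturality _ _ f :=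
    square_comp (inv_square (tensorIndexIso_naturality n f))
      (square_comp (simplicialKunnethι_naturality _ _ n) (strongProdIso_naturality n f))

/-- The projection of Vietoris-Rips homology to the torsion products. -/
def vietorisRipsπ : Input.homologyStrongProd R n ⟶ Input.torSum R (n - 1) where
  app X := (strongProdIso n X).inv ≫
    simplicialKunnethπ (chainsLeft X) (chainsRight X) n ≫ (torIndexIso n X).hom
  naturality _ _ f :=
    square_comp (inv_square (strongProdIso_naturality n f))
      (square_comp (simplicialKunnethπ_naturality _ _ n) (torIndexIso_naturality n f))

lemma vietorisRips_shortExact (X : Input R) :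
    ∃ w, (ShortComplex.mk ((vietorisRipsι n).app X) ((vietorisRipsπ n).app X) w).ShortExact := by
  obtain ⟨w, h⟩ := simplicialKunneth_shortExact (A := chainsLeft X) (B := chainsRight X) (q := n)
  have h1 : (tensorIndexIso n X).hom ≫ (vietorisRipsι n).app X =
      simplicialKunnethι (chainsLeft X) (chainsRight X) n ≫ (strongProdIso n X).hom := by
    simp [vietorisRipsι]
  have h2 : (strongProdIso n X).hom ≫ (vietorisRipsπ n).app X =
      simplicialKunnethπ (chainsLeft X) (chainsRight X) n ≫ (torIndexIso n X).hom := by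
    simp [vietorisRipsπ]
  have w' : (vietorisRipsι n).app X ≫ (vietorisRipsπ n).app X = 0 := by
    rw [← cancel_epi (tensorIndexIso n X).hom, reassoc_of% h1, h2, reassoc_of% w, zero_comp,
      comp_zero]
  exact ⟨w', ShortComplex.shortExact_of_iso (ShortComplex.isoMk
    (S₁ := ShortComplex.mk (simplicialKunnethι (chainsLeft X) (chainsRight X) n)
      (simplicialKunnethπ (chainsLeft X) (chainsRight X) n) w)
    (S₂ := ShortComplex.mk ((vietorisRipsι n).app X) ((vietorisRipsπ n).app X) w')
    (tensorIndexIso n X) (strongProdIso n X) (torIndexIso n X) h1 h2) h⟩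

end NonnegativeDegrees

end VietorisRips

end

theorem mainTheorem3 (R : Type u) [CommRing R] [IsDomain R] [IsPrincipalIdealRing R] (q : ℤ) :
    ∃ (α : VietorisRips.Input.tensorSum R q ⟶ VietorisRips.Input.homologyStrongProd R q)
      (β : VietorisRips.Input.homologyStrongProd R q ⟶ VietorisRips.Input.torSum R (q - 1)),
      ∀ X : VietorisRips.Input R, ∃ w : α.app X ≫ β.app X = 0,
        (ShortComplex.mk (α.app X) (β.app X) w).ShortExact := by
  rcases lt_or_ge q 0 with hq | hq
  -- In negative degrees all three terms vanish, so the zero maps form the sequence.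
  · refine ⟨0, 0, fun X => ⟨comp_zero, ?_⟩⟩
    have h1 : IsZero ((VietorisRips.Input.tensorSum R q).obj X) :=
      VietorisRips.isZero_bifunctorSum _ VietorisRips.isZero_tensor_of_left
        VietorisRips.isZero_tensor_of_right hq X
    have h2 := VietorisRips.isZero_homologyStrongProd (X := X) hq
    have h3 : IsZero ((VietorisRips.Input.torSum R (q - 1)).obj X) :=
      VietorisRips.isZero_bifunctorSum _ VietorisRips.isZero_tor_of_left
        VietorisRips.isZero_tor_of_right (by omega) X
    exact
      { exact := ShortComplex.exact_of_isZero_X₂ _ h2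
        mono_f := ⟨fun _ _ _ => h1.eq_of_tgt _ _⟩
        epi_g := ⟨fun _ _ _ => h3.eq_of_src _ _⟩ }
  · lift q to ℕ using hq
    exact ⟨VietorisRips.vietorisRipsι q, VietorisRips.vietorisRipsπ q,
      VietorisRips.vietorisRips_shortExact q⟩
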